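/- Let $(\mathcal M,\otimes,\mathbf 1,c)$ be a braided monoidal category whose underlying category is abelian, complete, cocomplete and satisfies AB5, such that all functors $X\otimes -$ and $-\otimes X$ are additive and exact (i.e. $\mathcal M$ is an abelian and coabelian monoidal category) and commute with arbitrary direct sums. A braided bialgebra is an object with an algebra and a coalgebra structure whose comultiplication and counit are algebra homomorphisms (with respect to $c$). Let $B=\bigoplus_{n\in\mathbb N}B_n$ be a graded braided bialgebra in $\mathcal M$, i.e. a braided bialgebra whose multiplication and comultiplication are graded homomorphisms. Write $i_n,p_n$ for the canonical injections and projections of a graded object, $m_{a,b}=p_{a+b}\,m\,(i_a\otimes i_b):B_a\otimes B_b\to B_{a+b}$ and $\Delta_{a,b}=(p_a\otimes p_b)\,\Delta\, i_{a+b}:B_{a+b}\to B_a\otimes B_b$. Then $B_0$ is a bialgebra with structure $m_{0,0},\ p_0u,\ \Delta_{0,0},\ \varepsilon i_0$, and $B_1$ is a $B_0$-bimodule via $\mu^l=m_{0,1},\ \mu^r=m_{1,0}$ and a $B_0$-bicomodule via $\rho^l=\Delta_{0,1},\ \rho^r=\Delta_{1,0}$. Let $T=T_{B_0}(B_1)=\bigoplus_n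 B_1^{\otimes_{B_0}n}$ be the relative tensor algebra and $T^c=T^c_{B_0}(B_1)=\bigoplus_n B_1^{\square_{B_0}n}$ the relative cotensor coalgebra. There is a unique graded braided bialgebra structure on $T$ that extends its graded algebra structure and satisfies $\Delta_T i_0=(i_0\otimes i_0)\Delta_{0,0}$, $\Delta_T i_1=(i_0\otimes i_1)\rho^l+(i_1\otimes i_0)\rho^r$, $\varepsilon_T i_0=\varepsilon i_0$, $\varepsilon_Ti_1=0$; and there is a unique graded braided bialgebra structure on $T^c$ that extends its graded coalgebra structure and satisfies $p_0m_{T^c}=m_{0,0}(p_0\otimes p_0)$, $p_1m_{T^c}=\mu^l(p_0\otimes p_1)+\mu^r(p_1\otimes p_0)$, $p_0u_{T^c}=p_0u$, $p_1u_{T^c}=0$. With these structures: 1. There is a unique algebra homomorphism $\varphi:T\to B$ with $\varphi i_0^T=i_0^B$ and $\varphi i_1^T=i_1^B$; it is a homomorphism of graded bialgebras. 2. There is a unique coalgebra homomorphism $\psi:B\to T^c$ with $p_0^{T^c}\psi=p_0^B$ and $p_1^{T^c}\psi=p_1^B$; it is a homomorphism of graded bialgebras. 3. There is a unique algebra homomorphism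 $F:T\to T^c$ with $Fi_0^T=i_0^{T^c}$ and $Fi_1^T=i_1^{T^c}$; one has $\psi\circ\varphi=F$, and $F$ is a homomorphism of graded bialgebras. Let $F_n=p_nFi_n$ and factor $F_n$ as an epimorphism $T_n\to\operatorname{Im}(F_n)$ followed by a monomorphism $\operatorname{Im}(F_n)\to T^c_n$. Their direct sums are an epimorphism $\varphi_F:T\to\operatorname{Im}(F)=\bigoplus_n\operatorname{Im}(F_n)$ and a monomorphism $\psi_F:\operatorname{Im}(F)\to T^c$ with $F=\psi_F\varphi_F$, and there is a unique graded braided bialgebra structure on $\operatorname{Im}(F)$ for which $\varphi_F$ and $\psi_F$ are homomorphisms of graded bialgebras. With this structure, $B_0[B_1]:=\operatorname{Im}(F)$ is called the braided bialgebra of type one associated to $B_0$ and $B_1$. The following assertions are equivalent: (a) $B$ is strongly $\mathbb N$-graded both as an algebra and as a coalgebra, i.e. every $m_{a,b}$ is an epimorphism and every $\Delta_{a,b}$ is a monomorphism; (b) $\varphi$ is an epimorphism and $\psi$ is a monomorphism; (c) $\varphi=\varphi_F$ and $\psi=\psi_F$ up to an identification of $B$ with $\operatorname{Im}(F)$, i.e.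 there is an isomorphism $\theta:B\to\operatorname{Im}(F)$ in $\mathcal M$ with $\theta\varphi=\varphi_F$ and $\psi_F\theta=\psi$; (d) $B=B_0[B_1]$ is the braided bialgebra of type one associated to $B_0$ and $B_1$, i.e. there is an isomorphism of graded bialgebras $\theta:B\to B_0[B_1]$ which is the canonical identification in degrees $0$ and $1$, meaning $\theta i_0^B=\varphi_Fi_0^T$ and $\theta i_1^B=\varphi_Fi_1^T$; (e) $B$ and $B_0[B_1]$ are isomorphic as graded bialgebras. -/

import Mathlib

open CategoryTheory Limits MonoidalCategory Opposite
open scoped MonObj ComonObj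

universe v u

/-! ### Relative tensor powers of a bimodule

`D` is a monoidal category with coequalizers, preserved by the tensor product in each variable. -/

namespace RelTensor

variable {D : Type u} [Category.{v} D] [MonoidalCategory D]

/-- A right module over an algebra `A` in a monoidal category. -/
structure RightModule (A : Mon D) where
  /-- The underlying object. -/
  X : D
  /-- The right action. -/
  act : X ⊗ A.X ⟶ X
  act_one : X ◁ η[A.X] ≫ act = (ρ_ X).hom
  act_assoc : X ◁ μ[A.X] ≫ act = (α_ X A.X A.X).inv ≫ act ▷ A.X ≫ act

/-- An algebra as a right module over itself. -/
def RightModule.regular (A : Mon D) : RightModule A where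
  X := A.X
  act := μ[A.X]
  act_one := MonObj.mul_one A.X
  act_assoc := by simp

/-- The right module underlying a bimodule. -/
def RightModule.ofBimod {A : Mon D} (M : Bimod A A) : RightModule A where
  X := M.X
  act := M.actRight
  act_one := M.actRight_one
  act_assoc := M.right_assoc

variable [HasCoequalizers D]

/-- The tensor product `V ⊗_A M` over `A`, i.e. the coequalizer of the two maps
`(V ⊗ A) ⊗ M ⟶ V ⊗ M` given by the two actions. -/
noncomputable def tensorOver {A : Mon D} (V : RightModule A) (M : Bimod A A) : D :=
  coequalizer (V.act ▷ M.X) ((α_ V.X A.X M.X).hom ≫ V.X ◁ M.actLeft)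

/-- The canonical morphism `χ : V ⊗ M ⟶ V ⊗_A M`. -/
noncomputable def toTensorOver {A : Mon D} (V : RightModule A) (M : Bimod A A) :
    V.X ⊗ M.X ⟶ tensorOver V M :=
  coequalizer.π _ _

theorem toTensorOver_condition {A : Mon D} (V : RightModule A) (M : Bimod A A) :
    V.act ▷ M.X ≫ toTensorOver V M =
      (α_ V.X A.X M.X).hom ≫ V.X ◁ M.actLeft ≫ toTensorOver V M := by
  have := coequalizer.condition (V.act ▷ M.X) ((α_ V.X A.X M.X).hom ≫ V.X ◁ M.actLeft)
  rw [Category.assoc] at this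
  exact this

section Left

variable [∀ Z : D, PreservesColimitsOfShape WalkingParallelPair (tensorLeft Z)]

/-- The morphism `Z ⊗ (V ⊗_A M) ⟶ W` induced by a morphism `Z ⊗ (V ⊗ M) ⟶ W` which
coequalizes the two actions; it exists since `Z ⊗ -` preserves coequalizers. -/
noncomputable def descLeft {A : Mon D} (V : RightModule A) (M : Bimod A A) {Z W : D}
    (f : Z ⊗ (V.X ⊗ M.X) ⟶ W)
    (h : Z ◁ (V.act ▷ M.X) ≫ f = Z ◁ ((α_ V.X A.X M.X).hom ≫ V.X ◁ M.actLeft) ≫ f) :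
    Z ⊗ tensorOver V M ⟶ W :=
  (PreservesCoequalizer.iso (tensorLeft Z) _ _).inv ≫ coequalizer.desc f h

theorem toTensorOver_descLeft {A : Mon D} (V : RightModule A) (M : Bimod A A) {Z W : D}
    (f : Z ⊗ (V.X ⊗ M.X) ⟶ W)
    (h : Z ◁ (V.act ▷ M.X) ≫ f = Z ◁ ((α_ V.X A.X M.X).hom ≫ V.X ◁ M.actLeft) ≫ f) :
    Z ◁ toTensorOver V M ≫ descLeft V M f h = f :=
  map_π_preserves_coequalizer_inv_desc (tensorLeft Z) _ _ f h

theorem epi_whiskerLeft_toTensorOver {A : Mon D} (V : RightModule A) (M : Bimod A A) (Z : D) :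
    Epi (Z ◁ toTensorOver V M) := 
  map_π_epi (tensorLeft Z) (V.act ▷ M.X) ((α_ V.X A.X M.X).hom ≫ V.X ◁ M.actLeft)

end Left

section Right

variable [∀ Z : D, PreservesColimitsOfShape WalkingParallelPair (tensorRight Z)]

/-- The morphism `(V ⊗_A M) ⊗ Z ⟶ W` induced by a morphism `(V ⊗ M) ⊗ Z ⟶ W` which
coequalizes the two actions; it exists since `- ⊗ Z` preserves coequalizers. -/
noncomputable def descRight {A : Mon D} (V : RightModule A) (M : Bimod A A) {Z W : D}
    (f : (V.X ⊗ M.X) ⊗ Z ⟶ W)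
    (h : (V.act ▷ M.X) ▷ Z ≫ f = ((α_ V.X A.X M.X).hom ≫ V.X ◁ M.actLeft) ▷ Z ≫ f) :
    tensorOver V M ⊗ Z ⟶ W :=
  (PreservesCoequalizer.iso (tensorRight Z) _ _).inv ≫ coequalizer.desc f h

theorem toTensorOver_descRight {A : Mon D} (V : RightModule A) (M : Bimod A A) {Z W : D}
    (f : (V.X ⊗ M.X) ⊗ Z ⟶ W)
    (h : (V.act ▷ M.X) ▷ Z ≫ f = ((α_ V.X A.X M.X).hom ≫ V.X ◁ M.actLeft) ▷ Z ≫ f) :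
    toTensorOver V M ▷ Z ≫ descRight V M f h = f :=
  map_π_preserves_coequalizer_inv_desc (tensorRight Z) _ _ f h

theorem epi_toTensorOver_whiskerRight {A : Mon D} (V : RightModule A) (M : Bimod A A) (Z : D) :
    Epi (toTensorOver V M ▷ Z) := 
  map_π_epi (tensorRight Z) (V.act ▷ M.X) ((α_ V.X A.X M.X).hom ≫ V.X ◁ M.actLeft)

/-- The right action of `A` on `V ⊗_A M`, induced by the right action on `M`. -/
noncomputable def tensorOverAct {A : Mon D} (V : RightModule A) (M : Bimod A A) :
    tensorOver V M ⊗ A.X ⟶ tensorOver V M :=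
  descRight V M ((α_ V.X M.X A.X).hom ≫ V.X ◁ M.actRight ≫ toTensorOver V M) (by
    have e1 : (V.act ▷ M.X) ▷ A.X ≫ (α_ V.X M.X A.X).hom ≫ V.X ◁ M.actRight =
        (α_ _ _ _).hom ≫ (V.X ⊗ A.X) ◁ M.actRight ≫ V.act ▷ M.X := by
      rw [whisker_exchange]; simp
    have e2 : ((α_ V.X A.X M.X).hom ≫ V.X ◁ M.actLeft) ▷ A.X ≫ (α_ V.X M.X A.X).hom ≫
          V.X ◁ M.actRight =
        (α_ _ _ _).hom ≫ (V.X ⊗ A.X) ◁ M.actRight ≫ (α_ V.X A.X M.X).hom ≫ V.X ◁ M.actLeft := by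
      have := M.middle_assoc
      simp only [comp_whiskerRight, Category.assoc]
      rw [associator_naturality_middle_assoc, ← whiskerLeft_comp, this]
      simp
    rw [reassoc_of% e1, reassoc_of% e2, toTensorOver_condition])

theorem toTensorOver_tensorOverAct {A : Mon D} (V : RightModule A) (M : Bimod A A) :
    toTensorOver V M ▷ A.X ≫ tensorOverAct V M =
      (α_ V.X M.X A.X).hom ≫ V.X ◁ M.actRight ≫ toTensorOver V M :=
  toTensorOver_descRight V M _ _

/-- `V ⊗_A M` as a right module. -/
noncomputable def RightModule.tensor {A : Mon D} (V : RightModule A) (M : Bimod A A) :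
    RightModule A where
  X := tensorOver V M
  act := tensorOverAct V M
  act_one := by
    have := epi_toTensorOver_whiskerRight V M (𝟙_ D)
    rw [← cancel_epi (toTensorOver V M ▷ 𝟙_ D), ← whisker_exchange_assoc,
      toTensorOver_tensorOverAct, rightUnitor_naturality, associator_naturality_right_assoc,
      ← whiskerLeft_comp_assoc, M.actRight_one]
    simp
  act_assoc := by
    have := epi_toTensorOver_whiskerRight V M (A.X ⊗ A.X)
    rw [← cancel_epi (toTensorOver V M ▷ (A.X ⊗ A.X)), ← whisker_exchange_assoc,
      toTensorOver_tensorOverAct, associator_inv_naturality_left_assoc,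
      ← comp_whiskerRight_assoc, toTensorOver_tensorOverAct, associator_naturality_right_assoc,
      ← whiskerLeft_comp_assoc, M.right_assoc]
    simp only [comp_whiskerRight, Category.assoc, whisker_assoc]
    rw [toTensorOver_tensorOverAct]
    simp

/-- The tensor powers over `A` of an `A`-bimodule `M`, as right modules:
`M^{⊗ 0} = A`, `M^{⊗ 1} = M` and `M^{⊗ (n + 2)} = M^{⊗ (n + 1)} ⊗_A M`. -/
noncomputable def relPow {A : Mon D} (M : Bimod A A) : ℕ → RightModule A
  | 0 => RightModule.regular A
  | 1 => RightModule.ofBimod M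
  | n + 2 => (relPow M (n + 1)).tensor M

variable [∀ Z : D, PreservesColimitsOfShape WalkingParallelPair (tensorLeft Z)]

/-- Morphisms `Z ⊗ V ⟶ W` which are right `A`-linear. -/
def LinearMor {A : Mon D} (Z : D) (V W : RightModule A) :=
  { f : Z ⊗ V.X ⟶ W.X // f ▷ A.X ≫ W.act = (α_ Z V.X A.X).hom ≫ Z ◁ V.act ≫ f }

/-- The right `A`-linear morphism `f ⊗_A M : Z ⊗ (V ⊗_A M) ⟶ W ⊗_A M` attached to a right
`A`-linear morphism `f : Z ⊗ V ⟶ W`. -/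
noncomputable def LinearMor.tensor {A : Mon D} {Z : D} {V W : RightModule A}
    (f : LinearMor Z V W) (M : Bimod A A) : LinearMor Z (V.tensor M) (W.tensor M) :=
  have h : Z ◁ (V.act ▷ M.X) ≫ (α_ Z V.X M.X).inv ≫ f.1 ▷ M.X ≫ toTensorOver W M =
      Z ◁ ((α_ V.X A.X M.X).hom ≫ V.X ◁ M.actLeft) ≫
        (α_ Z V.X M.X).inv ≫ f.1 ▷ M.X ≫ toTensorOver W M := by
    have e : (α_ Z V.X A.X).inv ▷ M.X ≫ (f.1 ▷ A.X) ▷ M.X ≫ W.act ▷ M.X =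
        (Z ◁ V.act) ▷ M.X ≫ f.1 ▷ M.X := by
      rw [← comp_whiskerRight, ← comp_whiskerRight, f.2]; simp
    rw [associator_inv_naturality_middle_assoc, ← reassoc_of% e, toTensorOver_condition,
      associator_naturality_left_assoc, ← whisker_exchange_assoc]
    simp
  ⟨descLeft V M ((α_ Z V.X M.X).inv ≫ f.1 ▷ M.X ≫ toTensorOver W M) h, by
    have := epi_whiskerLeft_toTensorOver V M Z
    have h2 : Epi ((Z ◁ toTensorOver V M) ▷ A.X) := by
      have h3 : Epi (Z ◁ (toTensorOver V M ▷ A.X)) :=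
        map_π_epi (tensorRight A.X ⋙ tensorLeft Z) (V.act ▷ M.X)
          ((α_ V.X A.X M.X).hom ≫ V.X ◁ M.actLeft)
      rw [whisker_assoc]; infer_instance
    change descLeft V M _ h ▷ A.X ≫ tensorOverAct W M =
      (α_ Z (tensorOver V M) A.X).hom ≫ Z ◁ tensorOverAct V M ≫ descLeft V M _ h
    rw [← cancel_epi ((Z ◁ toTensorOver V M) ▷ A.X), ← comp_whiskerRight_assoc,
      toTensorOver_descLeft, associator_naturality_middle_assoc, ← whiskerLeft_comp_assoc,
      toTensorOver_tensorOverAct, whiskerLeft_comp_assoc, whiskerLeft_comp_assoc,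
      toTensorOver_descLeft]
    simp only [comp_whiskerRight, Category.assoc]
    rw [toTensorOver_tensorOverAct, associator_inv_naturality_right_assoc,
      associator_naturality_left_assoc, ← whisker_exchange_assoc]
    monoidal⟩

/-- The multiplication `M^{⊗ a} ⊗ M^{⊗ b} ⟶ M^{⊗ (a + b)}` of the relative tensor algebra:
the right action of `A` for `b = 0`; the left action of `A` on `M` for `a = 0`, `b = 1`;
the canonical morphism `χ` for `a ≥ 1`, `b = 1`; then recursively by applying `- ⊗_A M`. -/
noncomputable def relMulLinear {A : Mon D} (M : Bimod A A) (a : ℕ) :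
    (b : ℕ) → LinearMor (relPow M a).X (relPow M b) (relPow M (a + b))
  | 0 => ⟨(relPow M a).act, by
      have := (relPow M a).act_assoc
      change (relPow M a).act ▷ A.X ≫ (relPow M a).act =
        (α_ _ _ _).hom ≫ (relPow M a).X ◁ μ[A.X] ≫ (relPow M a).act
      rw [this]; simp⟩
  | 1 => match a with
    | 0 => ⟨M.actLeft, M.middle_assoc⟩
    | a + 1 => ⟨toTensorOver (relPow M (a + 1)) M, toTensorOver_tensorOverAct _ M⟩
  | b + 2 => (relMulLinear M a (b + 1)).tensor M

/-- The multiplication `M^{⊗ a} ⊗ M^{⊗ b} ⟶ M^{⊗ (a + b)}` of the relative tensor algebra. -/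
noncomputable def relMul {A : Mon D} (M : Bimod A A) (a b : ℕ) :
    (relPow M a).X ⊗ (relPow M b).X ⟶ (relPow M (a + b)).X :=
  (relMulLinear M a b).1

end Right

end RelTensor

/-! ### Abelian and coabelian monoidal categories -/

/-- An abelian monoidal category: an abelian category with a monoidal structure such that
all functors `X ⊗ -` and `- ⊗ X` are additive and right exact. -/
class AbelianMonoidal (C : Type u) [Category.{v} C] [Abelian C] [MonoidalCategory C] : Prop
    extends MonoidalPreadditive C where
  left_rightExact (X : C) : PreservesFiniteColimits (tensorLeft X)
  right_rightExact (X : C) : PreservesFiniteColimits (tensorRight X)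

/-- A coabelian monoidal category: an abelian category with a monoidal structure such that
all functors `X ⊗ -` and `- ⊗ X` are additive and left exact (so that the opposite monoidal
category is abelian monoidal). -/
class CoabelianMonoidal (C : Type u) [Category.{v} C] [Abelian C] [MonoidalCategory C] : Prop
    extends MonoidalPreadditive C where
  left_leftExact (X : C) : PreservesFiniteLimits (tensorLeft X)
  right_leftExact (X : C) : PreservesFiniteLimits (tensorRight X)

/-- The tensor product commutes, in each variable, with arbitrary (small) direct sums. -/
class TensorCommutesWithDirectSums (C : Type u) [Category.{v} C] [MonoidalCategory C] : Prop where
  left (X : C) (J : Type v) : PreservesColimitsOfShape (Discrete J) (tensorLeft X)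
  right (X : C) (J : Type v) : PreservesColimitsOfShape (Discrete J) (tensorRight X)

attribute [instance] AbelianMonoidal.left_rightExact AbelianMonoidal.right_rightExact
  CoabelianMonoidal.left_leftExact CoabelianMonoidal.right_leftExact
  TensorCommutesWithDirectSums.left TensorCommutesWithDirectSums.right

instance instPreservesTensorLeftNat (C : Type u) [Category.{v} C] [MonoidalCategory C]
    [TensorCommutesWithDirectSums C] (X : C) :
    PreservesColimitsOfShape (Discrete ℕ) (tensorLeft X) :=
  preservesColimitsOfShape_of_equiv
    (Discrete.equivalence (Equiv.ulift : ULift.{v} ℕ ≃ ℕ)) (tensorLeft X)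

instance instPreservesTensorRightNat (C : Type u) [Category.{v} C] [MonoidalCategory C]
    [TensorCommutesWithDirectSums C] (X : C) :
    PreservesColimitsOfShape (Discrete ℕ) (tensorRight X) :=
  preservesColimitsOfShape_of_equiv
    (Discrete.equivalence (Equiv.ulift : ULift.{v} ℕ ≃ ℕ)) (tensorRight X)

section Op

variable {C : Type u} [Category.{v} C] [Abelian C] [MonoidalCategory C] [CoabelianMonoidal C]

instance instPreservesTensorLeftOp (X : Cᵒᵖ) :
    PreservesColimitsOfShape WalkingParallelPair (tensorLeft X) :=
  have : PreservesLimitsOfShape WalkingParallelPairᵒᵖ (tensorLeft X.unop) :=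
    preservesLimitsOfShape_of_equiv walkingParallelPairOpEquiv _
  preservesColimitsOfShape_op WalkingParallelPair (tensorLeft X.unop)

instance instPreservesTensorRightOp (X : Cᵒᵖ) :
    PreservesColimitsOfShape WalkingParallelPair (tensorRight X) :=
  have : PreservesLimitsOfShape WalkingParallelPairᵒᵖ (tensorRight X.unop) :=
    preservesLimitsOfShape_of_equiv walkingParallelPairOpEquiv _
  preservesColimitsOfShape_op WalkingParallelPair (tensorRight X.unop)

end Op

/-! ### Bicomodules -/

/-- A bicomodule over a coalgebra `H` in a monoidal category. -/
structure Bicomodule {C : Type u} [Category.{v} C] [MonoidalCategory C] (H : Comon C) where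
  /-- The underlying object. -/
  X : C
  /-- The left coaction. -/
  coactLeft : X ⟶ H.X ⊗ X
  /-- The right coaction. -/
  coactRight : X ⟶ X ⊗ H.X
  coactLeft_counit : coactLeft ≫ ε[H.X] ▷ X = (λ_ X).inv
  coactRight_counit : coactRight ≫ X ◁ ε[H.X] = (ρ_ X).inv
  left_coassoc :
    coactLeft ≫ Δ[H.X] ▷ X = coactLeft ≫ H.X ◁ coactLeft ≫ (α_ H.X H.X X).inv
  right_coassoc :
    coactRight ≫ X ◁ Δ[H.X] = coactRight ≫ coactRight ▷ H.X ≫ (α_ X H.X H.X).hom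
  middle_coassoc :
    coactRight ≫ coactLeft ▷ H.X = coactLeft ≫ H.X ◁ coactRight ≫ (α_ H.X X H.X).inv

/-- A bicomodule over `H`, viewed as a bimodule over the algebra `H` of the opposite
monoidal category. -/
def Bicomodule.toOp {C : Type u} [Category.{v} C] [MonoidalCategory C] {H : Comon C}
    (M : Bicomodule H) :
    Bimod (Comon.ComonToMonOpOpObj H) (Comon.ComonToMonOpOpObj H) where
  X := op M.X
  actLeft := M.coactLeft.op
  actRight := M.coactRight.op
  one_actLeft := congrArg Quiver.Hom.op M.coactLeft_counit
  actRight_one := congrArg Quiver.Hom.op M.coactRight_counit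
  left_assoc := 
    congrArg Quiver.Hom.op (M.left_coassoc.trans (Category.assoc _ _ _).symm)
  right_assoc := 
    congrArg Quiver.Hom.op (M.right_coassoc.trans (Category.assoc _ _ _).symm)
  middle_assoc := 
    congrArg Quiver.Hom.op (M.middle_coassoc.trans (Category.assoc _ _ _).symm)

/-! ### Graded braided bialgebras -/

section Graded

set_option linter.unusedSectionVars false

variable {C : Type u} [Category.{v} C] [Abelian C] [MonoidalCategory C] [BraidedCategory C]
  [HasColimits C]

/-- The component `(X ⊗ X)_n = ⨁_{a + b = n} X_a ⊗ X_b` of the graded object `X ⊗ X`. -/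
noncomputable abbrev tensorSqComp (X : ℕ → C) (n : ℕ) : C :=
  ∐ fun s : { s : ℕ × ℕ // s.1 + s.2 = n } => X s.1.1 ⊗ X s.1.2

/-- The canonical injection `(X ⊗ X)_n ⟶ X ⊗ X`, where `X = ⨁ X_n`. -/
noncomputable def tensorSqInj (X : ℕ → C) (n : ℕ) : tensorSqComp X n ⟶ (∐ X) ⊗ (∐ X) :=
  Limits.Sigma.desc fun s : { s : ℕ × ℕ // s.1 + s.2 = n } => Limits.Sigma.ι X s.1.1 ⊗ₘ Limits.Sigma.ι X s.1.2

/-- A graded braided bialgebra with homogeneous components `X 0, X 1, …`: a bialgebra structure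
on `⨁ X_n` whose multiplication and comultiplication are graded homomorphisms. -/
structure GradedBialgebra (X : ℕ → C) where
  /-- The bialgebra structure on the direct sum. -/
  [bimonObj : BimonObj (∐ X)]
  mul_graded (n : ℕ) : ∃ m : tensorSqComp X n ⟶ X n, tensorSqInj X n ≫ μ = m ≫ Limits.Sigma.ι X n
  comul_graded (n : ℕ) : ∃ d : X n ⟶ tensorSqComp X n, Limits.Sigma.ι X n ≫ Δ = d ≫ tensorSqInj X n

namespace GradedBialgebra

variable {X Y : ℕ → C} (A : GradedBialgebra X) (B : GradedBialgebra Y)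

/-- The underlying object `⨁ X_n`. -/
noncomputable def obj (_ : GradedBialgebra X) : C := ∐ X

noncomputable instance : BimonObj A.obj := A.bimonObj

/-- The canonical injection `i_n`. -/
noncomputable def inj (n : ℕ) : X n ⟶ A.obj := Limits.Sigma.ι X n

/-- The canonical projection `p_n`. -/
noncomputable def proj (n : ℕ) : A.obj ⟶ X n := Limits.Sigma.π X n

/-- The component `m_{a,b}` of the multiplication. -/
noncomputable def mulComp (a b : ℕ) : X a ⊗ X b ⟶ X (a + b) :=
  (A.inj a ⊗ₘ A.inj b) ≫ μ ≫ A.proj (a + b)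

/-- The component `Δ_{a,b}` of the comultiplication. -/
noncomputable def comulComp (a b : ℕ) : X (a + b) ⟶ X a ⊗ X b :=
  A.inj (a + b) ≫ Δ ≫ (A.proj a ⊗ₘ A.proj b)

/-- `B` is strongly `ℕ`-graded as an algebra. -/
def StronglyGradedAlgebra : Prop := ∀ a b : ℕ, Epi (A.mulComp a b)

/-- `B` is strongly `ℕ`-graded as a coalgebra. -/
def StronglyGradedCoalgebra : Prop := ∀ a b : ℕ, Mono (A.comulComp a b)

variable {A B} in
/-- `f` is a homomorphism of graded bialgebras. -/
structure IsGradedHom (f : A.obj ⟶ B.obj) : Prop where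
  isBimonHom : IsBimonHom f
  graded (n : ℕ) : ∃ g : X n ⟶ Y n, A.inj n ≫ f = g ≫ B.inj n

/-! #### The bialgebra `B_0` and the `B_0`-(co)bimodule `B_1` -/

theorem inj_proj_self (n : ℕ) : A.inj n ≫ A.proj n = 𝟙 _ := Sigma.ι_π_eq_id X n

theorem inj_proj_ne {m n : ℕ} (h : m ≠ n) : A.inj m ≫ A.proj n = 0 := Sigma.ι_π_of_ne X h

instance (n : ℕ) : Mono (A.inj n) := by
  have := A.inj_proj_self n
  exact mono_of_mono_fac this

instance (n : ℕ) : Epi (A.proj n) := by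
  have := A.inj_proj_self n
  exact epi_of_epi_fac this

theorem mulComp_inj (a b : ℕ) :
    A.mulComp a b ≫ A.inj (a + b) = (A.inj a ⊗ₘ A.inj b) ≫ μ := by
  obtain ⟨m, hm⟩ := A.mul_graded (a + b)
  obtain ⟨k, hk⟩ : ∃ k : X a ⊗ X b ⟶ X (a + b),
      (A.inj a ⊗ₘ A.inj b) ≫ μ[A.obj] = k ≫ A.inj (a + b) := by
    let t : X a ⊗ X b ⟶ tensorSqComp X (a + b) := Limits.Sigma.ι (fun s : { s : ℕ × ℕ // s.1 + s.2 = a + b } => X s.1.1 ⊗ X s.1.2)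
      ⟨(a, b), rfl⟩
    have e : t ≫ tensorSqInj X (a + b) = (Limits.Sigma.ι X a ⊗ₘ Limits.Sigma.ι X b) :=
      Limits.Sigma.ι_desc _ _
    refine ⟨t ≫ m, ?_⟩
    have := congrArg (fun f => t ≫ f) hm
    rw [reassoc_of% e, ← Category.assoc t m] at this
    exact this
  have : A.mulComp a b = k := by
    rw [mulComp, reassoc_of% hk, inj_proj_self, Category.comp_id]
  rw [this, hk]

theorem mulComp_assoc (a b c : ℕ) :
    (A.mulComp a b ▷ X c ≫ A.mulComp (a + b) c) ≫ A.inj (a + b + c) =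
      ((α_ (X a) (X b) (X c)).hom ≫ X a ◁ A.mulComp b c ≫ A.mulComp a (b + c)) ≫
        A.inj (a + (b + c)) := by
  have h1 : A.mulComp a b ▷ X c ≫ (A.inj (a + b) ⊗ₘ A.inj c) =
      ((A.inj a ⊗ₘ A.inj b) ⊗ₘ A.inj c) ≫ μ ▷ A.obj := by
    rw [← MonoidalCategory.tensorHom_id, ← MonoidalCategory.tensorHom_id,
      MonoidalCategory.tensorHom_comp_tensorHom, MonoidalCategory.tensorHom_comp_tensorHom,
      mulComp_inj, Category.id_comp, Category.comp_id]
  have h2 : X a ◁ A.mulComp b c ≫ (A.inj a ⊗ₘ A.inj (b + c)) =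
      (A.inj a ⊗ₘ (A.inj b ⊗ₘ A.inj c)) ≫ A.obj ◁ μ := by
    rw [← MonoidalCategory.id_tensorHom, ← MonoidalCategory.id_tensorHom,
      MonoidalCategory.tensorHom_comp_tensorHom, MonoidalCategory.tensorHom_comp_tensorHom,
      mulComp_inj, Category.id_comp, Category.comp_id]
  rw [Category.assoc, Category.assoc, Category.assoc, mulComp_inj, mulComp_inj, reassoc_of% h1,
    reassoc_of% h2, MonObj.mul_assoc, MonoidalCategory.associator_naturality_assoc]

theorem inj_comul_eq_zero (n : ℕ) {Z W : C} (f : A.obj ⟶ Z) (g : A.obj ⟶ W)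
    (h : ∀ a b : ℕ, a + b = n → (A.inj a ≫ f) ⊗ₘ (A.inj b ≫ g) = 0) :
    A.inj n ≫ Δ[A.obj] ≫ (f ⊗ₘ g) = 0 := by
  obtain ⟨d, hd⟩ := A.comul_graded n
  have hz : tensorSqInj X n ≫ ((f ⊗ₘ g : A.obj ⊗ A.obj ⟶ _) : (∐ X) ⊗ (∐ X) ⟶ _) = 0 := by
    refine Limits.Sigma.hom_ext _ _ fun s => ?_
    have e : Limits.Sigma.ι (fun s : { s : ℕ × ℕ // s.1 + s.2 = n } => X s.1.1 ⊗ X s.1.2) s ≫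
      tensorSqInj X n = (A.inj s.1.1 ⊗ₘ A.inj s.1.2) := Limits.Sigma.ι_desc _ _
    have := h _ _ s.2
    rw [← MonoidalCategory.tensorHom_comp_tensorHom, ← e] at this
    exact ((Category.assoc _ _ _).symm.trans this).trans comp_zero.symm
  have hd' : A.inj n ≫ Δ[A.obj] = d ≫ tensorSqInj X n := hd
  rw [reassoc_of% hd']
  exact (Category.assoc _ _ _).trans ((congrArg (fun t => d ≫ t) hz).trans comp_zero)

variable [AbelianMonoidal C]

theorem proj_comulComp (a b : ℕ) :
    A.proj (a + b) ≫ A.comulComp a b = Δ ≫ (A.proj a ⊗ₘ A.proj b) := by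
  refine Limits.Sigma.hom_ext (f := X) _ _ fun n => ?_
  change A.inj n ≫ A.proj (a + b) ≫ A.comulComp a b = A.inj n ≫ Δ ≫ (A.proj a ⊗ₘ A.proj b)
  by_cases h : n = a + b
  · subst h
    rw [← Category.assoc, inj_proj_self, Category.id_comp, comulComp]
  · rw [← Category.assoc, inj_proj_ne _ h, zero_comp, inj_comul_eq_zero]
    intro a' b' hab
    by_cases ha : a' = a
    · have hb : b' ≠ b := by omega
      rw [inj_proj_ne _ hb, MonoidalCategory.tensorHom_def, MonoidalPreadditive.whiskerLeft_zero, comp_zero]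
    · rw [inj_proj_ne _ ha, MonoidalCategory.tensorHom_def, MonoidalPreadditive.zero_whiskerRight, zero_comp]

/-- The unit `u_0 = p_0 u` of `B_0`. -/
noncomputable def unitZero : 𝟙_ C ⟶ X 0 := η[A.obj] ≫ A.proj 0

/-- The counit `ε_0 = ε i_0` of `B_0`. -/
noncomputable def counitZero : X 0 ⟶ 𝟙_ C := A.inj 0 ≫ ε[A.obj]

theorem comulComp_coassoc' (a b c : ℕ) :
    A.proj (a + (b + c)) ≫ A.comulComp a (b + c) ≫ X a ◁ A.comulComp b c =
      A.proj (a + b + c) ≫ A.comulComp (a + b) c ≫ A.comulComp a b ▷ X c ≫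
        (α_ (X a) (X b) (X c)).hom := by
  have h1 : (A.proj (a + b) ⊗ₘ A.proj c) ≫ A.comulComp a b ▷ X c =
      Δ ▷ A.obj ≫ ((A.proj a ⊗ₘ A.proj b) ⊗ₘ A.proj c) := by
    rw [← MonoidalCategory.tensorHom_id, ← MonoidalCategory.tensorHom_id,
      MonoidalCategory.tensorHom_comp_tensorHom, MonoidalCategory.tensorHom_comp_tensorHom,
      proj_comulComp, Category.id_comp, Category.comp_id]
  have h2 : (A.proj a ⊗ₘ A.proj (b + c)) ≫ X a ◁ A.comulComp b c =
      A.obj ◁ Δ ≫ (A.proj a ⊗ₘ (A.proj b ⊗ₘ A.proj c)) := by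
    rw [← MonoidalCategory.id_tensorHom, ← MonoidalCategory.id_tensorHom,
      MonoidalCategory.tensorHom_comp_tensorHom, MonoidalCategory.tensorHom_comp_tensorHom,
      proj_comulComp, Category.id_comp, Category.comp_id]
  rw [← Category.assoc, proj_comulComp, Category.assoc, h2, ← Category.assoc (A.proj _),
    proj_comulComp, Category.assoc, reassoc_of% h1, ComonObj.comul_assoc_assoc,
    MonoidalCategory.associator_naturality]

theorem comulComp_coassoc (a b c : ℕ) :
    A.proj (a + b + c) ≫ A.comulComp (a + b) c ≫ A.comulComp a b ▷ X c =
      A.proj (a + (b + c)) ≫ A.comulComp a (b + c) ≫ X a ◁ A.comulComp b c ≫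
        (α_ (X a) (X b) (X c)).inv := by
  have := congrArg (fun f => f ≫ (α_ (X a) (X b) (X c)).inv) (A.comulComp_coassoc' a b c)
  simpa using this.symm

theorem tensor_sub {W₁ W₂ Z₁ Z₂ : C} (f : W₁ ⟶ Z₁) (g h : W₂ ⟶ Z₂) :
    f ⊗ₘ (g - h) = (f ⊗ₘ g) - (f ⊗ₘ h) := by
  rw [eq_sub_iff_add_eq, ← MonoidalPreadditive.tensor_add, sub_add_cancel]

theorem sub_tensor {W₁ W₂ Z₁ Z₂ : C} (f g : W₁ ⟶ Z₁) (h : W₂ ⟶ Z₂) :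
    (f - g) ⊗ₘ h = (f ⊗ₘ h) - (g ⊗ₘ h) := by
  rw [eq_sub_iff_add_eq, ← MonoidalPreadditive.add_tensor, sub_add_cancel]

theorem inj_comul_proj_counit (n : ℕ) :
    (A.inj n ≫ Δ ≫ (A.proj n ⊗ₘ A.proj 0)) ≫ X n ◁ A.counitZero = (ρ_ (X n)).inv := by
  have h := A.inj_comul_eq_zero n (A.proj n) (ε[A.obj] - A.proj 0 ≫ A.counitZero) (by
    intro a b hab
    by_cases ha : a = n
    · obtain rfl : b = 0 := by omega
      have : A.inj 0 ≫ (ε[A.obj] - A.proj 0 ≫ A.counitZero) = 0 := by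
        rw [Preadditive.comp_sub, ← Category.assoc, inj_proj_self, Category.id_comp, counitZero,
          sub_self]
      rw [this, MonoidalCategory.tensorHom_def, MonoidalPreadditive.whiskerLeft_zero, comp_zero]
    · rw [inj_proj_ne _ ha, MonoidalCategory.tensorHom_def, MonoidalPreadditive.zero_whiskerRight,
        zero_comp])
  rw [tensor_sub, Preadditive.comp_sub, Preadditive.comp_sub, sub_eq_zero,
    ComonObj.comul_counit_hom, ← Category.assoc, inj_proj_self, Category.id_comp] at h
  rw [Category.assoc, Category.assoc, h]
  simp [MonoidalCategory.tensorHom_def]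

theorem inj_comul_counit_proj (n : ℕ) :
    (A.inj n ≫ Δ ≫ (A.proj 0 ⊗ₘ A.proj n)) ≫ A.counitZero ▷ X n = (λ_ (X n)).inv := by
  have h := A.inj_comul_eq_zero n (ε[A.obj] - A.proj 0 ≫ A.counitZero) (A.proj n) (by
    intro a b hab
    by_cases hb : b = n
    · obtain rfl : a = 0 := by omega
      have : A.inj 0 ≫ (ε[A.obj] - A.proj 0 ≫ A.counitZero) = 0 := by
        rw [Preadditive.comp_sub, ← Category.assoc, inj_proj_self, Category.id_comp, counitZero,
          sub_self]
      rw [this, MonoidalCategory.tensorHom_def, MonoidalPreadditive.zero_whiskerRight, zero_comp]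
    · rw [inj_proj_ne _ hb, MonoidalCategory.tensorHom_def, MonoidalPreadditive.whiskerLeft_zero,
        comp_zero])
  rw [sub_tensor, Preadditive.comp_sub, Preadditive.comp_sub, sub_eq_zero,
    ComonObj.counit_comul_hom, ← Category.assoc, inj_proj_self, Category.id_comp] at h
  rw [Category.assoc, Category.assoc, h]
  simp [MonoidalCategory.tensorHom_def']

variable [TensorCommutesWithDirectSums C]

theorem whiskerLeft_hom_ext {Z W : C} {f g : Z ⊗ A.obj ⟶ W}
    (h : ∀ n, Z ◁ A.inj n ≫ f = Z ◁ A.inj n ≫ g) : f = g :=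
  (isColimitOfPreserves (tensorLeft Z) (coproductIsCoproduct X)).hom_ext fun ⟨n⟩ => h n

theorem whiskerRight_hom_ext {Z W : C} {f g : A.obj ⊗ Z ⟶ W}
    (h : ∀ n, A.inj n ▷ Z ≫ f = A.inj n ▷ Z ≫ g) : f = g :=
  (isColimitOfPreserves (tensorRight Z) (coproductIsCoproduct X)).hom_ext fun ⟨n⟩ => h n

theorem unit_inj_mul_proj (n : ℕ) :
    X n ◁ A.unitZero ≫ (A.inj n ⊗ₘ A.inj 0) ≫ μ ≫ A.proj n = (ρ_ (X n)).hom := by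
  have key : X n ◁ A.proj 0 ≫ (A.inj n ⊗ₘ A.inj 0) ≫ μ ≫ A.proj n =
      A.inj n ▷ A.obj ≫ μ ≫ A.proj n := by
    refine A.whiskerLeft_hom_ext fun b => ?_
    rw [← MonoidalCategory.tensorHom_def'_assoc, ← whiskerLeft_comp_assoc]
    by_cases hb : b = 0
    · subst hb
      rw [inj_proj_self]; simp
    · rw [inj_proj_ne _ hb, MonoidalPreadditive.whiskerLeft_zero, zero_comp,
        ← Category.assoc _ μ[A.obj], ← mulComp_inj, Category.assoc, inj_proj_ne _ (by omega),
        comp_zero]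
  rw [unitZero, whiskerLeft_comp, Category.assoc, key, whisker_exchange_assoc,
    MonObj.mul_one_assoc, rightUnitor_naturality_assoc, inj_proj_self, Category.comp_id]

theorem inj_unit_mul_proj (n : ℕ) :
    A.unitZero ▷ X n ≫ (A.inj 0 ⊗ₘ A.inj n) ≫ μ ≫ A.proj n = (λ_ (X n)).hom := by
  have key : A.proj 0 ▷ X n ≫ (A.inj 0 ⊗ₘ A.inj n) ≫ μ ≫ A.proj n =
      A.obj ◁ A.inj n ≫ μ ≫ A.proj n := by
    refine A.whiskerRight_hom_ext fun b => ?_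
    rw [← MonoidalCategory.tensorHom_def_assoc, ← comp_whiskerRight_assoc]
    by_cases hb : b = 0
    · subst hb
      rw [inj_proj_self]; simp
    · rw [inj_proj_ne _ hb, MonoidalPreadditive.zero_whiskerRight, zero_comp,
        ← Category.assoc _ μ[A.obj], ← mulComp_inj, Category.assoc, inj_proj_ne _ (by omega),
        comp_zero]
  rw [unitZero, comp_whiskerRight, Category.assoc, key, ← whisker_exchange_assoc,
    MonObj.one_mul_assoc, leftUnitor_naturality_assoc, inj_proj_self, Category.comp_id]

/-- The algebra `B_0`, with multiplication `m_{0,0}` and unit `u_0`. -/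
noncomputable def algZero : Mon C where
  X := X 0
  mon :=
    { one := A.unitZero
      mul := A.mulComp 0 0
      one_mul := A.inj_unit_mul_proj 0
      mul_one := A.unit_inj_mul_proj 0
      mul_assoc := (cancel_mono (A.inj 0)).1 (A.mulComp_assoc 0 0 0) }

/-- The coalgebra `B_0`, with comultiplication `Δ_{0,0}` and counit `ε_0`. -/
noncomputable def coalgZero : Comon C where
  X := X 0
  comon :=
    { counit := A.counitZero
      comul := A.comulComp 0 0
      counit_comul := A.inj_comul_counit_proj 0
      comul_counit := A.inj_comul_proj_counit 0
      comul_assoc := (cancel_epi (A.proj 0)).1 (A.comulComp_coassoc' 0 0 0) }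

/-- The `B_0`-bimodule `B_1`, with actions `m_{0,1}` and `m_{1,0}`. -/
noncomputable def bimodOne : Bimod A.algZero A.algZero where
  X := X 1
  actLeft := A.mulComp 0 1
  actRight := A.mulComp 1 0
  one_actLeft := A.inj_unit_mul_proj 1
  actRight_one := A.unit_inj_mul_proj 1
  left_assoc := (cancel_mono (A.inj 1)).1 (A.mulComp_assoc 0 0 1)
  right_assoc := by
    rw [Iso.eq_inv_comp]
    exact (cancel_mono (A.inj 1)).1 (A.mulComp_assoc 1 0 0).symm
  middle_assoc := (cancel_mono (A.inj 1)).1 (A.mulComp_assoc 0 1 0)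

/-- The `B_0`-bicomodule `B_1`, with coactions `Δ_{0,1}` and `Δ_{1,0}`. -/
noncomputable def bicomodOne : Bicomodule A.coalgZero where
  X := X 1
  coactLeft := A.comulComp 0 1
  coactRight := A.comulComp 1 0
  coactLeft_counit := A.inj_comul_counit_proj 1
  coactRight_counit := A.inj_comul_proj_counit 1
  left_coassoc := (cancel_epi (A.proj 1)).1 (A.comulComp_coassoc 0 0 1)
  right_coassoc := (cancel_epi (A.proj 1)).1 (A.comulComp_coassoc' 1 0 0)
  middle_coassoc := (cancel_epi (A.proj 1)).1 (A.comulComp_coassoc 0 1 0)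

/-! #### The tensor algebra `T_{B_0}(B_1)` and the cotensor coalgebra `T^c_{B_0}(B_1)` -/

/-- The component `B_1^{⊗ n}` (tensor power over `B_0`) of `T_{B_0}(B_1)`. -/
noncomputable def tensorPow (n : ℕ) : C := (RelTensor.relPow A.bimodOne n).X

/-- The multiplication `B_1^{⊗ a} ⊗ B_1^{⊗ b} ⟶ B_1^{⊗ (a + b)}` of `T_{B_0}(B_1)`. -/
noncomputable def tensorMul (a b : ℕ) :
    A.tensorPow a ⊗ A.tensorPow b ⟶ A.tensorPow (a + b) :=
  RelTensor.relMul A.bimodOne a b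

section Tensor

variable {A} (T : GradedBialgebra A.tensorPow)

/-- The canonical injection `B_0 ⟶ T_{B_0}(B_1)`. -/
noncomputable def tensorInjZero : X 0 ⟶ T.obj := T.inj 0

/-- The canonical injection `B_1 ⟶ T_{B_0}(B_1)`. -/
noncomputable def tensorInjOne : X 1 ⟶ T.obj := T.inj 1

/-- `T` is the canonical graded bialgebra structure on the tensor algebra `T_{B_0}(B_1)`: its
algebra structure is that of the tensor algebra, and the algebra homomorphisms `Δ_T`, `ε_T` are
given on generators by `Δ_T i_0 = (i_0 ⊗ i_0) Δ_{B_0}`,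
`Δ_T i_1 = (i_0 ⊗ i_1) ρ^l + (i_1 ⊗ i_0) ρ^r`, `ε_T i_0 = ε_{B_0}` and `ε_T i_1 = 0`. -/
structure IsTensorBialgebra : Prop where
  mulComp_eq (a b : ℕ) : T.mulComp a b = A.tensorMul a b
  unit_eq : η[T.obj] = A.unitZero ≫ tensorInjZero T
  comul_zero : tensorInjZero T ≫ Δ = A.comulComp 0 0 ≫ (tensorInjZero T ⊗ₘ tensorInjZero T)
  comul_one : tensorInjOne T ≫ Δ =
    A.comulComp 0 1 ≫ (tensorInjZero T ⊗ₘ tensorInjOne T) +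
      A.comulComp 1 0 ≫ (tensorInjOne T ⊗ₘ tensorInjZero T)
  counit_zero : tensorInjZero T ≫ ε = A.counitZero
  counit_one : tensorInjOne T ≫ ε = 0

/-- `φ : T_{B_0}(B_1) ⟶ B` is an algebra homomorphism with `φ i_0 = i_0` and `φ i_1 = i_1`. -/
structure IsTensorLift (φ : T.obj ⟶ A.obj) : Prop where
  isMonHom : IsMonHom φ
  inj_zero : tensorInjZero T ≫ φ = A.inj 0
  inj_one : tensorInjOne T ≫ φ = A.inj 1

end Tensor

variable [CoabelianMonoidal C]

/-- The component `B_1^{□ n}` (cotensor power over `B_0`) of `T^c_{B_0}(B_1)`. As the opposite of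
the tensor power in `Cᵒᵖ`, it satisfies `B_1^{□ 0} = B_0`, `B_1^{□ 1} = B_1`, and
`B_1^{□ (n + 2)} = B_1^{□ (n + 1)} □ B_1` is the equalizer of the two maps
`B_1^{□ (n + 1)} ⊗ B_1 ⟶ (B_1^{□ (n + 1)} ⊗ B_0) ⊗ B_1` given by the coactions. -/
noncomputable def cotensorPow (n : ℕ) : C :=
  unop (RelTensor.relPow A.bicomodOne.toOp n).X

/-- The comultiplication `B_1^{□ (a + b)} ⟶ B_1^{□ a} ⊗ B_1^{□ b}` of `T^c_{B_0}(B_1)`. -/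
noncomputable def cotensorComul (a b : ℕ) :
    A.cotensorPow (a + b) ⟶ A.cotensorPow a ⊗ A.cotensorPow b :=
  (RelTensor.relMul A.bicomodOne.toOp a b).unop

section Cotensor

variable {A} (T : GradedBialgebra A.tensorPow) (Tc : GradedBialgebra A.cotensorPow)

/-- The canonical projection `T^c_{B_0}(B_1) ⟶ B_0`. -/
noncomputable def cotensorProjZero : Tc.obj ⟶ X 0 := Tc.proj 0

/-- The canonical projection `T^c_{B_0}(B_1) ⟶ B_1`. -/
noncomputable def cotensorProjOne : Tc.obj ⟶ X 1 := Tc.proj 1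

/-- The canonical injection `B_0 ⟶ T^c_{B_0}(B_1)`. -/
noncomputable def cotensorInjZero : X 0 ⟶ Tc.obj := Tc.inj 0

/-- The canonical injection `B_1 ⟶ T^c_{B_0}(B_1)`. -/
noncomputable def cotensorInjOne : X 1 ⟶ Tc.obj := Tc.inj 1

/-- `T^c` is the canonical graded bialgebra structure on the cotensor coalgebra `T^c_{B_0}(B_1)`:
its coalgebra structure is that of the cotensor coalgebra, and the coalgebra homomorphisms
`m_{T^c}`, `u_{T^c}` satisfy `p_0 m = m_{B_0} (p_0 ⊗ p_0)`,
`p_1 m = μ^l (p_0 ⊗ p_1) + μ^r (p_1 ⊗ p_0)`, `p_0 u = u_{B_0}` and `p_1 u = 0`. -/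
structure IsCotensorBialgebra : Prop where
  comulComp_eq (a b : ℕ) : Tc.comulComp a b = A.cotensorComul a b
  counit_eq : ε[Tc.obj] = cotensorProjZero Tc ≫ A.counitZero
  mul_zero : μ ≫ cotensorProjZero Tc =
    (cotensorProjZero Tc ⊗ₘ cotensorProjZero Tc) ≫ A.mulComp 0 0
  mul_one : μ ≫ cotensorProjOne Tc =
    (cotensorProjZero Tc ⊗ₘ cotensorProjOne Tc) ≫ A.mulComp 0 1 +
      (cotensorProjOne Tc ⊗ₘ cotensorProjZero Tc) ≫ A.mulComp 1 0
  unit_zero : η ≫ cotensorProjZero Tc = A.unitZero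
  unit_one : η ≫ cotensorProjOne Tc = 0

/-- `ψ : B ⟶ T^c_{B_0}(B_1)` is a coalgebra homomorphism with `p_0 ψ = p_0` and `p_1 ψ = p_1`. -/
structure IsCotensorLift (ψ : A.obj ⟶ Tc.obj) : Prop where
  isComonHom : IsComonHom ψ
  proj_zero : ψ ≫ cotensorProjZero Tc = A.proj 0
  proj_one : ψ ≫ cotensorProjOne Tc = A.proj 1

/-- `F : T_{B_0}(B_1) ⟶ T^c_{B_0}(B_1)` is an algebra homomorphism with `F i_0 = i_0` and
`F i_1 = i_1`. -/
structure IsTensorToCotensor (F : T.obj ⟶ Tc.obj) : Prop where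
  isMonHom : IsMonHom F
  inj_zero : tensorInjZero T ≫ F = cotensorInjZero Tc
  inj_one : tensorInjOne T ≫ F = cotensorInjOne Tc

end Cotensor

/-! #### The image of a graded homomorphism -/

section Image

variable {A B} (f : A.obj ⟶ B.obj)

/-- The component `f_n : A_n ⟶ B_n` of `f`. -/
noncomputable def homComp (n : ℕ) : X n ⟶ Y n := A.inj n ≫ f ≫ B.proj n

/-- The components `Im(f_n)` of the image of a graded homomorphism `f`. -/
noncomputable def imComp (n : ℕ) : C := image (homComp f n)

variable (I : GradedBialgebra (imComp f))

/-- The morphism `φ_f = ⨁ φ_n : A ⟶ ⨁ Im(f_n)`. -/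
noncomputable def toIm : A.obj ⟶ I.obj :=
  Limits.Sigma.map (f := X) (g := imComp f) fun n => factorThruImage (homComp f n)

/-- The morphism `ψ_f = ⨁ ψ_n : ⨁ Im(f_n) ⟶ B`. -/
noncomputable def fromIm : I.obj ⟶ B.obj :=
  Limits.Sigma.map (f := imComp f) (g := Y) fun n => image.ι (homComp f n)

/-- `I` is the graded bialgebra structure on the image of `f` for which `φ_f` and `ψ_f` are
homomorphisms of graded bialgebras. -/
structure IsImageBialgebra : Prop where
  toIm_hom : IsGradedHom (toIm f I)
  fromIm_hom : IsGradedHom (fromIm f I)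

end Image

end GradedBialgebra

end Graded

open GradedBialgebra

/-!
# Braided bialgebras of type one

Write `T = ⨁ B_1^{⊗ n}` and `T^c = ⨁ B_1^{□ n}` for the tensor algebra and the cotensor coalgebra of
`B_1` over `B_0`.

*Generators.* The multiplications `T_n ⊗ T_1 ⟶ T_{n + 1}` are epimorphisms, so an algebra
homomorphism on `T` is determined by its restrictions to `B_0` and `B_1`. Conversely, a morphism
`κ : B ⟶ E` which is unital and multiplicative on products of total degree at most `1` (`LowMul`)
induces an algebra homomorphism `T ⟶ E` which agrees with `κ` in degrees `0` and `1`
(`LowMul.exists_lift`). Since the comultiplication of `B` does not raise the degree, `LowMul` is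
stable under `κ ↦ Δ ≫ (κ ⊗ κ)` (`LowMul.comul`). Starting from the inclusion of the generators,
this produces the comultiplication of `T`; the counit is induced in the same way by that of `B`.
The coalgebra axioms are equalities of algebra homomorphisms, and hold because they hold for `B` in
degrees `0` and `1` (`exists_isTensorBialgebra`). The same principle shows that
`φ : T ⟶ B` is a homomorphism of graded bialgebras, and gives all the uniqueness statements for `T`.

*Cogenerators.* The components of `T^c` and of its comultiplication are obtained from those of the
tensor algebra by passing to the opposite monoidal category. The total object is not obtained in
this way, since it is a coproduct and not a product. Two facts replace the duality. First, by AB5 a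
morphism to a countable direct sum is determined by its components (`eq_zero_of_comp_proj_eq_zero`),
and the same holds for tensor products of direct sums. Second, a compatible family of components
`E ⟶ T^c_n` defines a morphism to the direct sum as soon as the coalgebra `E` is graded, because the
family is then homogeneous (`corel_homog`, `ComonGrading`, `LowComul.exists_lift`). This applies to
`𝟙`, `B` and `T^c ⊗ T^c`, which is all that the unit, `ψ` and the multiplication of `T^c` require
(`exists_isCotensorBialgebra`).

*The equivalence.* The composite `φ ≫ ψ` satisfies the conditions which characterize `F`, and the
image of `F` inherits its structure morphisms by lifting along strong epimorphisms
(`exists_bimonObj_of_epi_mono`). If `B` is strongly graded, then `φ` is an epimorphism and `ψ` a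
monomorphism in each degree, by induction on the degree (`StronglyGradedAlgebra.epi`,
`StronglyGradedCoalgebra.mono`). Uniqueness of the epi-mono factorization of `F` then identifies `B`
with the image of `F`, and cancelling the epimorphism `φ` shows that this identification is a
homomorphism of graded bialgebras. Finally, `T` is strongly graded as an algebra and `T^c` as a
coalgebra, so the image of `F`, a quotient of the former and a subobject of the latter, is strongly
graded in both senses, and so is any graded bialgebra isomorphic to it.
-/

set_option linter.unusedSectionVars false

/-! ### Graded multiplications generated in degrees `0` and `1` -/

section Family

variable {D : Type u} [Category.{v} D] [MonoidalCategory D]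

/-- A graded algebra in a monoidal category, given by its homogeneous components; no direct sum
of the components is formed. Since `0 + b = b` and `(a + b) + c = a + (b + c)` do not hold
definitionally, the left unit law and associativity involve `eqToHom`. -/
structure GradedMon (P : ℕ → D) where
  /-- The components of the multiplication. -/
  mul (a b : ℕ) : P a ⊗ P b ⟶ P (a + b)
  /-- The unit. -/
  one : 𝟙_ D ⟶ P 0
  one_mul (b : ℕ) :
    one ▷ P b ≫ mul 0 b ≫ eqToHom (congrArg P (Nat.zero_add b)) = (λ_ (P b)).hom
  mul_one (a : ℕ) : P a ◁ one ≫ mul a 0 = (ρ_ (P a)).hom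
  mul_assoc (a b c : ℕ) :
    mul a b ▷ P c ≫ mul (a + b) c ≫ eqToHom (congrArg P (Nat.add_assoc a b c)) =
      (α_ (P a) (P b) (P c)).hom ≫ P a ◁ mul b c ≫ mul a (b + c)

variable {P : ℕ → D} (m : ∀ a b, P a ⊗ P b ⟶ P (a + b))

theorem comp_eqToHom_succ {k n : ℕ} (h : k = n) :
    m k 1 ≫ eqToHom (congrArg (fun i => P (i + 1)) h) =
      eqToHom (congrArg P h) ▷ P 1 ≫ m n 1 := by
  subst h; simp

/-- If every component of degree `n + 1` is covered by the product of those of degrees `n` and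
`1`, associativity with last degree `0` or `1` implies associativity. -/
theorem graded_assoc_of_step [∀ (Z : D) (b : ℕ), Epi (Z ◁ m b 1)]
    (step : ∀ a b, P a ◁ m b 1 ≫ m a (b + 1) =
      (α_ (P a) (P b) (P 1)).inv ≫ m a b ▷ P 1 ≫ m (a + b) 1)
    (linear : ∀ a b, m a b ▷ P 0 ≫ m (a + b) 0 =
      (α_ (P a) (P b) (P 0)).hom ≫ P a ◁ m b 0 ≫ m a b) (a b c : ℕ) :
    m a b ▷ P c ≫ m (a + b) c ≫ eqToHom (congrArg P (Nat.add_assoc a b c)) =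
      (α_ (P a) (P b) (P c)).hom ≫ P a ◁ m b c ≫ m a (b + c) := by
  induction c with
  | zero => simpa using linear a b
  | succ c ih =>
    rw [← cancel_epi ((P a ⊗ P b) ◁ m c 1)]
    have e := comp_eqToHom_succ m (Nat.add_assoc a b c)
    have e3 : m (a + b) (c + 1) ≫ eqToHom (congrArg P (Nat.add_assoc a b (c + 1))) =
      m (a + b) (c + 1) ≫ eqToHom (congrArg (fun i => P (i + 1)) (Nat.add_assoc a b c)) := rfl
    rw [e3, whisker_exchange_assoc, reassoc_of% (step (a + b) c)]
    have e4 : P a ◁ m b (c + 1) ≫ m a (b + (c + 1)) = P a ◁ m b (c + 1) ≫ m a (b + c + 1) := rfl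
    rw [e4, associator_naturality_right_assoc, ← whiskerLeft_comp_assoc, step b c]
    simp only [whiskerLeft_comp, Category.assoc]
    have e5 := step a (b + c)
    rw [e5]
    simp only [associator_inv_naturality_left_assoc]
    rw [← comp_whiskerRight_assoc, e, ← comp_whiskerRight_assoc, Category.assoc, ih]
    monoidal

/-- If every component of degree `n + 1` is covered by the product of those of degrees `n` and
`1`, the left unit law in degree `0` implies the left unit law. -/
theorem graded_one_mul_of_step [∀ (Z : D) (b : ℕ), Epi (Z ◁ m b 1)] (u : 𝟙_ D ⟶ P 0)
    (step : ∀ a b, P a ◁ m b 1 ≫ m a (b + 1) =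
      (α_ (P a) (P b) (P 1)).inv ≫ m a b ▷ P 1 ≫ m (a + b) 1)
    (unit : u ▷ P 0 ≫ m 0 0 = (λ_ (P 0)).hom) (b : ℕ) :
    u ▷ P b ≫ m 0 b ≫ eqToHom (congrArg P (Nat.zero_add b)) = (λ_ (P b)).hom := by
  induction b with
  | zero => simpa using unit
  | succ b ih =>
    rw [← cancel_epi (𝟙_ D ◁ m b 1)]
    have e := comp_eqToHom_succ m (Nat.zero_add b)
    have e3 : m 0 (b + 1) ≫ eqToHom (congrArg P (Nat.zero_add (b + 1))) =
      m 0 (b + 1) ≫ eqToHom (congrArg (fun i => P (i + 1)) (Nat.zero_add b)) := rfl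
    rw [e3, whisker_exchange_assoc, reassoc_of% (step 0 b), e,
      associator_inv_naturality_left_assoc, ← comp_whiskerRight_assoc, ← comp_whiskerRight_assoc,
      Category.assoc, ih]
    monoidal

end Family

/-! ### The relative tensor algebra by components -/

namespace RelTensor

variable {D : Type u} [Category.{v} D] [MonoidalCategory D] [HasCoequalizers D]
  [∀ Z : D, PreservesColimitsOfShape WalkingParallelPair (tensorRight Z)]
  [∀ Z : D, PreservesColimitsOfShape WalkingParallelPair (tensorLeft Z)]
  {A : Mon D} (M : Bimod A A)

/-- The defining recursion of the multiplication, which is also its associativity with last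
exponent `1`. -/
theorem relMul_step (a b : ℕ) :
    (relPow M a).X ◁ relMul M b 1 ≫ relMul M a (b + 1) =
      (α_ (relPow M a).X (relPow M b).X (relPow M 1).X).inv ≫
        relMul M a b ▷ (relPow M 1).X ≫ relMul M (a + b) 1 := by
  cases b with
  | zero =>
    cases a with
    | zero =>
      change A.X ◁ M.actLeft ≫ M.actLeft = (α_ _ _ _).inv ≫ μ[A.X] ▷ M.X ≫ M.actLeft
      rw [M.left_assoc]; simp
    | succ a =>
      change _ ◁ M.actLeft ≫ toTensorOver _ M =
        (α_ _ _ _).inv ≫ (relPow M (a + 1)).act ▷ M.X ≫ toTensorOver (relPow M (a + 1)) M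
      rw [toTensorOver_condition]; simp
  | succ b => exact toTensorOver_descLeft _ _ _ _

theorem relMul_linear (a b : ℕ) :
    relMul M a b ▷ A.X ≫ (relPow M (a + b)).act =
      (α_ _ _ _).hom ≫ (relPow M a).X ◁ (relPow M b).act ≫ relMul M a b :=
  (relMulLinear M a b).2

instance epi_relMul_one (a : ℕ) : Epi (relMul M a 1) := by
  cases a with
  | zero =>
    have : η[A.X] ▷ M.X ≫ M.actLeft = (λ_ M.X).hom := M.one_actLeft
    have h : Epi (η[A.X] ▷ M.X ≫ M.actLeft) := by
      rw [this]; exact inferInstanceAs (Epi (λ_ M.X).hom)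
    exact epi_of_epi (η[A.X] ▷ M.X) M.actLeft
  | succ a => exact coequalizer.π_epi

instance epi_whiskerLeft_relMul_one (Z : D) (a : ℕ) : Epi (Z ◁ relMul M a 1) := by
  cases a with
  | zero =>
    have : Z ◁ (η[A.X] ▷ M.X) ≫ Z ◁ M.actLeft = Z ◁ (λ_ M.X).hom := by
      rw [← whiskerLeft_comp, M.one_actLeft]
    have h : Epi (Z ◁ (η[A.X] ▷ M.X) ≫ Z ◁ M.actLeft) := by
      rw [this]; exact inferInstanceAs (Epi (whiskerLeftIso Z (λ_ M.X)).hom)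
    exact epi_of_epi (Z ◁ (η[A.X] ▷ M.X)) (Z ◁ M.actLeft)
  | succ a => exact epi_whiskerLeft_toTensorOver _ _ _

theorem relMul_one (a : ℕ) : (relPow M a).X ◁ η[A.X] ≫ relMul M a 0 = (ρ_ _).hom :=
  (relPow M a).act_one

/-- The relative tensor algebra as a graded algebra. -/
noncomputable def relGradedMon : GradedMon fun n => (relPow M n).X where
  mul := relMul M
  one := η[A.X]
  one_mul := graded_one_mul_of_step (relMul M) η[A.X] (relMul_step M) (MonObj.one_mul A.X)
  mul_one := relMul_one M
  mul_assoc := graded_assoc_of_step (relMul M) (relMul_step M) (relMul_linear M)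

/-- The relative tensor algebra is strongly graded. -/
theorem epi_relMul [∀ Z : D, (tensorRight Z).PreservesEpimorphisms] (a b : ℕ) :
    Epi (relMul M a b) := by
  induction b with
  | zero =>
    have := relMul_one M a
    have h : Epi ((relPow M a).X ◁ η[A.X] ≫ relMul M a 0) := by
      rw [this]; infer_instance
    exact epi_of_epi ((relPow M a).X ◁ η[A.X]) _
  | succ b ih =>
    have h : Epi ((relPow M a).X ◁ relMul M b 1 ≫ relMul M a (b + 1)) := by
      rw [relMul_step]
      have : Epi (relMul M a b ▷ (relPow M 1).X) :=
        inferInstanceAs (Epi ((tensorRight _).map (relMul M a b)))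
      infer_instance
    exact epi_of_epi ((relPow M a).X ◁ relMul M b 1) _

section Lift

variable {M} {E : D} [MonObj E] {f₀ : A.X ⟶ E} {f₁ : M.X ⟶ E}

/-- The inductive step of the universal property: a right `A`-linear morphism `g : V ⟶ E` and a
morphism of bimodules `f₁ : M ⟶ E` induce a right `A`-linear morphism `V ⊗_A M ⟶ E`. -/
theorem exists_tensorOver_lift {V : RightModule A} (g : V.X ⟶ E) (hg : V.act ≫ g = (g ⊗ₘ f₀) ≫ μ)
    (hl : M.actLeft ≫ f₁ = (f₀ ⊗ₘ f₁) ≫ μ) (hr : M.actRight ≫ f₁ = (f₁ ⊗ₘ f₀) ≫ μ) :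
    ∃ d : tensorOver V M ⟶ E, toTensorOver V M ≫ d = (g ⊗ₘ f₁) ≫ μ ∧
      tensorOverAct V M ≫ d = (d ⊗ₘ f₀) ≫ μ := by
  have h : V.act ▷ M.X ≫ (g ⊗ₘ f₁) ≫ μ =
      ((α_ V.X A.X M.X).hom ≫ V.X ◁ M.actLeft) ≫ (g ⊗ₘ f₁) ≫ μ := by
    rw [whiskerRight_comp_tensorHom_assoc, hg, ← tensorHom_comp_whiskerRight_assoc,
      Category.assoc, whiskerLeft_comp_tensorHom_assoc, hl, ← tensorHom_comp_whiskerLeft_assoc,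
      MonObj.mul_assoc, MonoidalCategory.associator_naturality_assoc]
  let d : tensorOver V M ⟶ E := coequalizer.desc ((g ⊗ₘ f₁) ≫ μ) h
  have hd : toTensorOver V M ≫ d = (g ⊗ₘ f₁) ≫ μ := coequalizer.π_desc _ _
  refine ⟨d, hd, ?_⟩
  have := epi_toTensorOver_whiskerRight V M A.X
  rw [← cancel_epi (toTensorOver V M ▷ A.X), reassoc_of% (toTensorOver_tensorOverAct V M), hd,
    whiskerRight_comp_tensorHom_assoc, hd, ← tensorHom_comp_whiskerRight_assoc,
    whiskerLeft_comp_tensorHom_assoc, hr, ← tensorHom_comp_whiskerLeft_assoc, MonObj.mul_assoc,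
    MonoidalCategory.associator_naturality_assoc]

/-- The morphism `M^{⊗ n} ⟶ E` induced by an algebra homomorphism `f₀ : A ⟶ E` and a morphism of
bimodules `f₁ : M ⟶ E`, together with its right linearity. -/
noncomputable def relLiftLinear (h₀ : μ[A.X] ≫ f₀ = (f₀ ⊗ₘ f₀) ≫ μ)
    (hl : M.actLeft ≫ f₁ = (f₀ ⊗ₘ f₁) ≫ μ) (hr : M.actRight ≫ f₁ = (f₁ ⊗ₘ f₀) ≫ μ) :
    (n : ℕ) → { f : (relPow M n).X ⟶ E // (relPow M n).act ≫ f = (f ⊗ₘ f₀) ≫ μ }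
  | 0 => ⟨f₀, h₀⟩
  | 1 => ⟨f₁, hr⟩
  | n + 2 =>
    let g := relLiftLinear h₀ hl hr (n + 1)
    have h := exists_tensorOver_lift g.1 g.2 hl hr
    ⟨h.choose, h.choose_spec.2⟩

/-- Universal property of the relative tensor algebra, by components: an algebra homomorphism
`A ⟶ E` and a morphism of bimodules `M ⟶ E` extend to a multiplicative family. -/
theorem exists_relLift (h₀ : μ[A.X] ≫ f₀ = (f₀ ⊗ₘ f₀) ≫ μ)
    (hl : M.actLeft ≫ f₁ = (f₀ ⊗ₘ f₁) ≫ μ) (hr : M.actRight ≫ f₁ = (f₁ ⊗ₘ f₀) ≫ μ) :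
    ∃ f : ∀ n, (relPow M n).X ⟶ E, f 0 = f₀ ∧ f 1 = f₁ ∧
      ∀ a b, relMul M a b ≫ f (a + b) = (f a ⊗ₘ f b) ≫ μ := by
  let f : ∀ n, (relPow M n).X ⟶ E := fun n => (relLiftLinear h₀ hl hr n).1
  have hf0 : f 0 = f₀ := rfl
  have hone : ∀ a, relMul M a 1 ≫ f (a + 1) = (f a ⊗ₘ f 1) ≫ μ := by
    intro a
    cases a with
    | zero => exact hl
    | succ a =>
      exact (exists_tensorOver_lift (relLiftLinear h₀ hl hr (a + 1)).1
        (relLiftLinear h₀ hl hr (a + 1)).2 hl hr).choose_spec.1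
  refine ⟨f, rfl, rfl, fun a b => ?_⟩
  induction b with
  | zero => exact (relLiftLinear h₀ hl hr a).2
  | succ b ih =>
    rw [← cancel_epi ((relPow M a).X ◁ relMul M b 1)]
    have e3 := hone (a + b)
    have e4 : (relPow M a).X ◁ relMul M b 1 ≫ relMul M a (b + 1) ≫ f (a + (b + 1)) =
      (α_ (relPow M a).X (relPow M b).X (relPow M 1).X).inv ≫
        relMul M a b ▷ (relPow M 1).X ≫ relMul M (a + b) 1 ≫ f (a + b + 1) := by
      have := relMul_step M a b =≫ f (a + b + 1)
      rwa [Category.assoc, Category.assoc, Category.assoc] at this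
    rw [e4, e3, whiskerRight_comp_tensorHom_assoc, ih, ← tensorHom_comp_whiskerRight_assoc,
      whiskerLeft_comp_tensorHom_assoc, hone, ← tensorHom_comp_whiskerLeft_assoc,
      MonObj.mul_assoc, MonoidalCategory.associator_naturality_assoc, Iso.inv_hom_id_assoc]

end Lift

end RelTensor

/-! ### Countable direct sums in an AB5 category -/

section DirectSum

variable {C : Type u} [Category.{v} C] [Abelian C] [HasColimits C] [AB5 C]

/-- In an AB5 category the projections of a countable direct sum are jointly monic. Indeed, `f`
may be assumed monic; killing the summands one after the other gives a sequence
`P ⟶ P ⟶ ⋯` with colimit `0`, and `f` identifies the constant sequence at its source with a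
subobject of it. -/
theorem eq_zero_of_comp_proj_eq_zero {X : ℕ → C} {P : C} (i : ∀ n, X n ⟶ P) (p : ∀ n, P ⟶ X n)
    (hne : ∀ m n, m ≠ n → i m ≫ p n = 0) (hself : ∀ n, i n ≫ p n = 𝟙 _)
    (hi : ∀ {W : C} (f : P ⟶ W), (∀ n, i n ≫ f = 0) → f = 0)
    {W : C} (f : W ⟶ P) (hf : ∀ n, f ≫ p n = 0) : f = 0 := by
  have : HasColimitsOfSize.{0, 0} C := hasColimitsOfSizeShrink.{0, 0, v, v} C
  have : AB5OfSize.{0, 0} C := AB5OfSize_shrink.{0, 0, v, v} C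
  let G : ℕ ⥤ C := Functor.ofSequence (X := fun _ => P) fun n => 𝟙 P - p n ≫ i n
  let q (n : ℕ) : P ⟶ colimit G := colimit.ι G n
  have hG (n : ℕ) : (𝟙 P - p n ≫ i n) ≫ q (n + 1) = q n := by
    have := colimit.w G (homOfLE n.le_succ)
    rwa [Functor.ofSequence_map_homOfLE_succ] at this
  have hzero : q 0 = 0 := by
    refine hi _ fun n => ?_
    have key : ∀ k ≤ n, i n ≫ q 0 = i n ≫ q k := by
      intro k
      induction k with
      | zero => intro _; rfl
      | succ k ih =>
        intro hk
        rw [ih (by omega), ← hG k]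
        simp [Preadditive.sub_comp, Preadditive.comp_sub, reassoc_of% (hne n k (by omega))]
    rw [key n le_rfl, ← hG n]
    simp [Preadditive.sub_comp, Preadditive.comp_sub, reassoc_of% (hself n)]
  let g : image f ⟶ P := image.ι f
  have hg (n : ℕ) : g ≫ p n = 0 := by
    rw [← cancel_epi (factorThruImage f), image.fac_assoc, hf, comp_zero]
  let τ : (Functor.const ℕ).obj (image f) ⟶ G := NatTrans.ofSequence (fun _ => g) fun n => by
    rw [Functor.ofSequence_map_homOfLE_succ]
    change 𝟙 (image f) ≫ g = g ≫ (𝟙 P - p n ≫ i n)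
    simp [Preadditive.comp_sub, reassoc_of% (hg n)]
  have hτ : Mono τ := by
    have (n : ℕ) : Mono (τ.app n) := inferInstanceAs (Mono g)
    exact NatTrans.mono_of_mono_app τ
  have hm : Mono (colim.map τ) := inferInstance
  have h0 : colimit.ι ((Functor.const ℕ).obj (image f)) 0 = 0 := by
    rw [← cancel_mono (colim.map τ), zero_comp]
    have : colimit.ι _ 0 ≫ colim.map τ = g ≫ q 0 := ι_colimMap τ 0
    rw [this, hzero, comp_zero]
  have h1 : 𝟙 (image f) = 0 := by
    have := colimit.ι_desc (F := (Functor.const ℕ).obj (image f)) ⟨image f, 𝟙 _⟩ 0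
    rw [h0, zero_comp] at this
    exact this.symm
  rw [← image.fac f, ← Category.comp_id (factorThruImage f), h1, comp_zero, zero_comp]

variable {X Y Z : ℕ → C}

/-- Morphisms to the image of a direct sum under a functor which preserves it are determined by
their components. -/
theorem comp_map_π_ext (F : C ⥤ C) [F.PreservesZeroMorphisms]
    [PreservesColimitsOfShape (Discrete ℕ) F] {W : C} {f g : W ⟶ F.obj (∐ X)}
    (h : ∀ n, f ≫ F.map (Sigma.π X n) = g ≫ F.map (Sigma.π X n)) : f = g := by
  rw [← sub_eq_zero]
  refine eq_zero_of_comp_proj_eq_zero (fun n => F.map (Sigma.ι X n)) (fun n => F.map (Sigma.π X n))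
    (fun m n hmn => ?_) (fun n => ?_) (fun {W} k hk => ?_) _ fun n => ?_
  · rw [← F.map_comp, Sigma.ι_π_of_ne X hmn, F.map_zero]
  · rw [← F.map_comp, Sigma.ι_π_eq_id, F.map_id]
  · refine (isColimitOfPreserves F (coproductIsCoproduct X)).hom_ext fun ⟨n⟩ => ?_
    exact (hk n).trans comp_zero.symm
  · rw [Preadditive.sub_comp, h, sub_self]

theorem sigma_comp_π_ext {W : C} {f g : W ⟶ ∐ X}
    (h : ∀ n, f ≫ Sigma.π X n = g ≫ Sigma.π X n) : f = g :=
  comp_map_π_ext (𝟭 C) h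

variable [MonoidalCategory C] [TensorCommutesWithDirectSums C]

theorem map_ι_comp_ext (F : C ⥤ C) [PreservesColimitsOfShape (Discrete ℕ) F] {W : C}
    {f g : F.obj (∐ X) ⟶ W} (h : ∀ n, F.map (Sigma.ι X n) ≫ f = F.map (Sigma.ι X n) ≫ g) :
    f = g :=
  (isColimitOfPreserves F (coproductIsCoproduct X)).hom_ext fun ⟨n⟩ => h n

theorem sigma_tensor_hom_ext {W : C} {f g : (∐ X) ⊗ (∐ Y) ⟶ W}
    (h : ∀ a b, (Sigma.ι X a ⊗ₘ Sigma.ι Y b) ≫ f = (Sigma.ι X a ⊗ₘ Sigma.ι Y b) ≫ g) : f = g := by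
  refine map_ι_comp_ext (tensorRight (∐ Y)) fun a => map_ι_comp_ext (tensorLeft (X a)) fun b => ?_
  simpa [MonoidalCategory.tensorHom_def'] using h a b

theorem sigma_tensor₃_hom_ext {W : C} {f g : ((∐ X) ⊗ (∐ Y)) ⊗ (∐ Z) ⟶ W}
    (h : ∀ a b c, ((Sigma.ι X a ⊗ₘ Sigma.ι Y b) ⊗ₘ Sigma.ι Z c) ≫ f =
      ((Sigma.ι X a ⊗ₘ Sigma.ι Y b) ⊗ₘ Sigma.ι Z c) ≫ g) : f = g := by
  refine map_ι_comp_ext (tensorRight (∐ Y) ⋙ tensorRight (∐ Z)) fun a =>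
    map_ι_comp_ext (tensorLeft (X a) ⋙ tensorRight (∐ Z)) fun b =>
    map_ι_comp_ext (tensorLeft (X a ⊗ Y b)) fun c => ?_
  simpa [MonoidalCategory.tensorHom_def'] using h a b c

variable [MonoidalPreadditive C]

theorem comp_π_tensor_ext {W : C} {f g : W ⟶ (∐ X) ⊗ (∐ Y)}
    (h : ∀ a b, f ≫ (Sigma.π X a ⊗ₘ Sigma.π Y b) = g ≫ (Sigma.π X a ⊗ₘ Sigma.π Y b)) : f = g := by
  refine comp_map_π_ext (tensorRight (∐ Y)) fun a => comp_map_π_ext (tensorLeft (X a)) fun b => ?_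
  simpa [MonoidalCategory.tensorHom_def] using h a b

theorem comp_π_tensor₃_ext {W : C} {f g : W ⟶ ((∐ X) ⊗ (∐ Y)) ⊗ (∐ Z)}
    (h : ∀ a b c, f ≫ ((Sigma.π X a ⊗ₘ Sigma.π Y b) ⊗ₘ Sigma.π Z c) =
      g ≫ ((Sigma.π X a ⊗ₘ Sigma.π Y b) ⊗ₘ Sigma.π Z c)) : f = g := by
  refine comp_map_π_ext (tensorRight (∐ Y) ⋙ tensorRight (∐ Z)) fun a =>
    comp_map_π_ext (tensorLeft (X a) ⋙ tensorRight (∐ Z)) fun b =>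
    comp_map_π_ext (tensorLeft (X a ⊗ Y b)) fun c => ?_
  simpa [MonoidalCategory.tensorHom_def] using h a b c

end DirectSum

/-! ### Homogeneous morphisms -/

section Homogeneous

variable {C : Type u} [Category.{v} C] [Abelian C] [HasColimits C] [AB5 C] [MonoidalCategory C]
  [MonoidalPreadditive C] [TensorCommutesWithDirectSums C] {X Y X' Y' : ℕ → C}

/-- `f : W ⟶ (⨁ X) ⊗ (⨁ Y)` lands in total degree `n`. -/
def HomogIn (n : ℕ) {W : C} (f : W ⟶ (∐ X) ⊗ (∐ Y)) : Prop :=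
  ∀ a b, a + b ≠ n → f ≫ (Sigma.π X a ⊗ₘ Sigma.π Y b) = 0

/-- `f : (⨁ X) ⊗ (⨁ Y) ⟶ W` vanishes outside total degree `n`. -/
def HomogOut (n : ℕ) {W : C} (f : (∐ X) ⊗ (∐ Y) ⟶ W) : Prop :=
  ∀ a b, a + b ≠ n → (Sigma.ι X a ⊗ₘ Sigma.ι Y b) ≫ f = 0

theorem ι_π (X : ℕ → C) (m n : ℕ) :
    Sigma.ι X m ≫ Sigma.π X n = if h : m = n then eqToHom (congrArg X h) else 0 := by
  split_ifs with h
  · subst h; simp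
  · exact Sigma.ι_π_of_ne X h

theorem ι_tensor_π (X Y : ℕ → C) (a b c d : ℕ) (h : ¬ (a = c ∧ b = d)) :
    (Sigma.ι X a ⊗ₘ Sigma.ι Y b) ≫ (Sigma.π X c ⊗ₘ Sigma.π Y d) = 0 := by
  rw [MonoidalCategory.tensorHom_comp_tensorHom]
  by_cases hac : a = c
  · have hbd : b ≠ d := fun hbd => h ⟨hac, hbd⟩
    rw [Sigma.ι_π_of_ne Y hbd, MonoidalPreadditive.tensor_zero]
  · rw [Sigma.ι_π_of_ne X hac, MonoidalPreadditive.zero_tensor]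

theorem ι_tensor_π_self (X Y : ℕ → C) (a b : ℕ) :
    (Sigma.ι X a ⊗ₘ Sigma.ι Y b) ≫ (Sigma.π X a ⊗ₘ Sigma.π Y b) = 𝟙 _ := by
  rw [MonoidalCategory.tensorHom_comp_tensorHom, Sigma.ι_π_eq_id, Sigma.ι_π_eq_id,
    MonoidalCategory.tensorHom_id, id_whiskerRight]

theorem sum_antidiagonal_ι_π {n : ℕ} {W : C} (g : ∀ a b, W ⟶ X a ⊗ Y b) (a b : ℕ) :
    (∑ s ∈ Finset.HasAntidiagonal.antidiagonal n, g s.1 s.2 ≫ (Sigma.ι X s.1 ⊗ₘ Sigma.ι Y s.2)) ≫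
      (Sigma.π X a ⊗ₘ Sigma.π Y b) = if a + b = n then g a b else 0 := by
  rw [Preadditive.sum_comp]
  split_ifs with h
  · rw [Finset.sum_eq_single_of_mem (a, b) (Finset.HasAntidiagonal.mem_antidiagonal.2 h),
      Category.assoc, ι_tensor_π_self, Category.comp_id]
    intro s _ hs
    rw [Category.assoc, ι_tensor_π _ _ _ _ _ _ (fun hh => hs (Prod.ext hh.1 hh.2)), comp_zero]
  · refine Finset.sum_eq_zero fun s hs => ?_
    rw [Category.assoc, ι_tensor_π, comp_zero]
    rintro ⟨rfl, rfl⟩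
    exact h (Finset.HasAntidiagonal.mem_antidiagonal.1 hs)

/-- Although the direct sum is infinite, a morphism which lands in total degree `n` is a finite sum
of its components. -/
theorem HomogIn.eq_sum {n : ℕ} {W : C} {f : W ⟶ (∐ X) ⊗ (∐ Y)} (hf : HomogIn n f) :
    f = ∑ s ∈ Finset.HasAntidiagonal.antidiagonal n,
      (f ≫ (Sigma.π X s.1 ⊗ₘ Sigma.π Y s.2)) ≫ (Sigma.ι X s.1 ⊗ₘ Sigma.ι Y s.2) := by
  refine comp_π_tensor_ext fun a b => ?_
  rw [sum_antidiagonal_ι_π (fun a b => f ≫ (Sigma.π X a ⊗ₘ Sigma.π Y b))]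
  split_ifs with h
  · rfl
  · exact hf a b h

theorem HomogOut.eq_sum {n : ℕ} {W : C} {f : (∐ X) ⊗ (∐ Y) ⟶ W} (hf : HomogOut n f) :
    f = ∑ s ∈ Finset.HasAntidiagonal.antidiagonal n,
      (Sigma.π X s.1 ⊗ₘ Sigma.π Y s.2) ≫ (Sigma.ι X s.1 ⊗ₘ Sigma.ι Y s.2) ≫ f := by
  refine sigma_tensor_hom_ext fun a b => ?_
  rw [Preadditive.comp_sum]
  by_cases h : a + b = n
  · rw [Finset.sum_eq_single_of_mem (a, b) (Finset.HasAntidiagonal.mem_antidiagonal.2 h),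
      reassoc_of% (ι_tensor_π_self X Y a b)]
    intro s _ hs
    rw [reassoc_of% (ι_tensor_π X Y a b s.1 s.2 (fun hh => hs (Prod.ext hh.1.symm hh.2.symm))),
      zero_comp]
  · rw [hf a b h, Finset.sum_eq_zero fun s hs => ?_]
    rw [reassoc_of% (ι_tensor_π X Y a b s.1 s.2 ?_), zero_comp]
    rintro ⟨rfl, rfl⟩
    exact h (Finset.HasAntidiagonal.mem_antidiagonal.1 hs)

theorem HomogIn.comp_congr {n : ℕ} {W V : C} {f : W ⟶ (∐ X) ⊗ (∐ Y)} (hf : HomogIn n f)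
    {g g' : (∐ X) ⊗ (∐ Y) ⟶ V} (h : ∀ a b, a + b = n →
      (Sigma.ι X a ⊗ₘ Sigma.ι Y b) ≫ g = (Sigma.ι X a ⊗ₘ Sigma.ι Y b) ≫ g') :
    f ≫ g = f ≫ g' := by
  rw [hf.eq_sum, Preadditive.sum_comp, Preadditive.sum_comp]
  refine Finset.sum_congr rfl fun s hs => ?_
  simp only [Category.assoc, h s.1 s.2 (Finset.HasAntidiagonal.mem_antidiagonal.1 hs)]

theorem HomogOut.comp_congr {n : ℕ} {W V : C} {f : (∐ X) ⊗ (∐ Y) ⟶ W} (hf : HomogOut n f)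
    {g g' : V ⟶ (∐ X) ⊗ (∐ Y)} (h : ∀ a b, a + b = n →
      g ≫ (Sigma.π X a ⊗ₘ Sigma.π Y b) = g' ≫ (Sigma.π X a ⊗ₘ Sigma.π Y b)) :
    g ≫ f = g' ≫ f := by
  rw [hf.eq_sum, Preadditive.comp_sum, Preadditive.comp_sum]
  refine Finset.sum_congr rfl fun s hs => ?_
  rw [reassoc_of% (h s.1 s.2 (Finset.HasAntidiagonal.mem_antidiagonal.1 hs))]

theorem HomogIn.tensor_comp_congr {n n' : ℕ} {W W' V : C} {f : W ⟶ (∐ X) ⊗ (∐ Y)}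
    (hf : HomogIn n f) {f' : W' ⟶ (∐ X') ⊗ (∐ Y')} (hf' : HomogIn n' f')
    {g g' : ((∐ X) ⊗ (∐ Y)) ⊗ ((∐ X') ⊗ (∐ Y')) ⟶ V}
    (h : ∀ a b a' b', a + b = n → a' + b' = n' →
      ((Sigma.ι X a ⊗ₘ Sigma.ι Y b) ⊗ₘ (Sigma.ι X' a' ⊗ₘ Sigma.ι Y' b')) ≫ g =
      ((Sigma.ι X a ⊗ₘ Sigma.ι Y b) ⊗ₘ (Sigma.ι X' a' ⊗ₘ Sigma.ι Y' b')) ≫ g') :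
    (f ⊗ₘ f') ≫ g = (f ⊗ₘ f') ≫ g' := by
  rw [hf.eq_sum, hf'.eq_sum, sum_tensor, Preadditive.sum_comp, Preadditive.sum_comp]
  refine Finset.sum_congr rfl fun s hs => ?_
  rw [tensor_sum, Preadditive.sum_comp, Preadditive.sum_comp]
  refine Finset.sum_congr rfl fun t ht => ?_
  rw [← MonoidalCategory.tensorHom_comp_tensorHom, Category.assoc, Category.assoc,
    h _ _ _ _ (Finset.HasAntidiagonal.mem_antidiagonal.1 hs)
      (Finset.HasAntidiagonal.mem_antidiagonal.1 ht)]

theorem HomogOut.tensor_comp_congr {n n' : ℕ} {W W' V : C} {f : (∐ X) ⊗ (∐ Y) ⟶ W}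
    (hf : HomogOut n f) {f' : (∐ X') ⊗ (∐ Y') ⟶ W'} (hf' : HomogOut n' f')
    {g g' : V ⟶ ((∐ X) ⊗ (∐ Y)) ⊗ ((∐ X') ⊗ (∐ Y'))}
    (h : ∀ a b a' b', a + b = n → a' + b' = n' →
      g ≫ ((Sigma.π X a ⊗ₘ Sigma.π Y b) ⊗ₘ (Sigma.π X' a' ⊗ₘ Sigma.π Y' b')) =
      g' ≫ ((Sigma.π X a ⊗ₘ Sigma.π Y b) ⊗ₘ (Sigma.π X' a' ⊗ₘ Sigma.π Y' b'))) :
    g ≫ (f ⊗ₘ f') = g' ≫ (f ⊗ₘ f') := by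
  rw [hf.eq_sum, hf'.eq_sum, sum_tensor, Preadditive.comp_sum, Preadditive.comp_sum]
  refine Finset.sum_congr rfl fun s hs => ?_
  rw [tensor_sum, Preadditive.comp_sum, Preadditive.comp_sum]
  refine Finset.sum_congr rfl fun t ht => ?_
  rw [← MonoidalCategory.tensorHom_comp_tensorHom,
    reassoc_of% (h _ _ _ _ (Finset.HasAntidiagonal.mem_antidiagonal.1 hs)
      (Finset.HasAntidiagonal.mem_antidiagonal.1 ht))]

/-- A morphism to a direct sum with a single nonzero component factors through that summand. -/
theorem comp_π_eq_of_factors {W : C} {n : ℕ} {f : W ⟶ ∐ X}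
    (h : ∀ k, k ≠ n → f ≫ Sigma.π X k = 0) : (f ≫ Sigma.π X n) ≫ Sigma.ι X n = f := by
  refine sigma_comp_π_ext fun k => ?_
  by_cases hk : k = n
  · subst hk; simp
  · rw [h k hk, Category.assoc, Sigma.ι_π_of_ne X (Ne.symm hk), comp_zero]

theorem exists_tensor_desc {W : C} (f : ∀ a b, X a ⊗ Y b ⟶ W) :
    ∃ g : (∐ X) ⊗ (∐ Y) ⟶ W, ∀ a b, (Sigma.ι X a ⊗ₘ Sigma.ι Y b) ≫ g = f a b := by
  have h1 (a : ℕ) : ∃ g : X a ⊗ (∐ Y) ⟶ W, ∀ b, X a ◁ Sigma.ι Y b ≫ g = f a b :=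
    ⟨(isColimitOfPreserves (tensorLeft (X a)) (coproductIsCoproduct Y)).desc
      ⟨W, Discrete.natTrans fun b => f a b.as⟩, fun b =>
      (isColimitOfPreserves (tensorLeft (X a)) (coproductIsCoproduct Y)).fac _ ⟨b⟩⟩
  choose g hg using h1
  refine ⟨(isColimitOfPreserves (tensorRight (∐ Y)) (coproductIsCoproduct X)).desc
      ⟨W, Discrete.natTrans fun a => g a.as⟩, fun a b => ?_⟩
  have := (isColimitOfPreserves (tensorRight (∐ Y)) (coproductIsCoproduct X)).fac
      ⟨W, Discrete.natTrans fun a => g a.as⟩ ⟨a⟩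
  rw [MonoidalCategory.tensorHom_def', Category.assoc, ← hg a b]
  exact congrArg (X a ◁ Sigma.ι Y b ≫ ·) this

end Homogeneous

/-! ### From components to direct sums -/

section Totalize

variable {C : Type u} [Category.{v} C] [MonoidalCategory C]

/-- A graded coalgebra in a monoidal category, given by its homogeneous components. -/
structure GradedComon (P : ℕ → C) where
  /-- The components of the comultiplication. -/
  comul (a b : ℕ) : P (a + b) ⟶ P a ⊗ P b
  /-- The counit. -/
  counit : P 0 ⟶ 𝟙_ C
  counit_comul (b : ℕ) :
    eqToHom (congrArg P (Nat.zero_add b)).symm ≫ comul 0 b ≫ counit ▷ P b = (λ_ (P b)).inv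
  comul_counit (a : ℕ) : comul a 0 ≫ P a ◁ counit = (ρ_ (P a)).inv
  comul_assoc (a b c : ℕ) :
    eqToHom (congrArg P (Nat.add_assoc a b c)).symm ≫ comul (a + b) c ≫ comul a b ▷ P c =
      comul a (b + c) ≫ P a ◁ comul b c ≫ (α_ (P a) (P b) (P c)).inv

/-- The graded coalgebra opposite to a graded algebra in the opposite category. -/
def GradedMon.unop {P : ℕ → Cᵒᵖ} (A : GradedMon P) : GradedComon fun n => (P n).unop where
  comul a b := (A.mul a b).unop
  counit := A.one.unop
  counit_comul b := by
    have := congrArg Quiver.Hom.unop (A.one_mul b)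
    simpa [eqToHom_unop] using this
  comul_counit a := by
    have := congrArg Quiver.Hom.unop (A.mul_one a)
    simpa using this
  comul_assoc a b c := by
    have := congrArg Quiver.Hom.unop (A.mul_assoc a b c)
    simpa [eqToHom_unop] using this

variable [Abelian C] [HasColimits C] [AB5 C]
  [MonoidalPreadditive C] [TensorCommutesWithDirectSums C] {P : ℕ → C}

theorem eqToHom_ι {m n : ℕ} (h : m = n) :
    eqToHom (congrArg P h) ≫ Sigma.ι P n = Sigma.ι P m := by
  subst h; simp

theorem π_eqToHom {m n : ℕ} (h : m = n) :
    Sigma.π P m ≫ eqToHom (congrArg P h) = Sigma.π P n := by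
  subst h; simp

/-- The algebra structure on the direct sum of the components of a graded algebra. -/
theorem GradedMon.exists_monObj (A : GradedMon P) :
    ∃ M : MonObj (∐ P), (∀ a b, (Sigma.ι P a ⊗ₘ Sigma.ι P b) ≫ M.mul =
      A.mul a b ≫ Sigma.ι P (a + b)) ∧ M.one = A.one ≫ Sigma.ι P 0 := by
  obtain ⟨m, hm⟩ := exists_tensor_desc fun a b => A.mul a b ≫ Sigma.ι P (a + b)
  refine ⟨⟨A.one ≫ Sigma.ι P 0, m, ?_, ?_, ?_⟩, hm, rfl⟩
  · refine map_ι_comp_ext (tensorLeft (𝟙_ C)) fun b => ?_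
    change 𝟙_ C ◁ Sigma.ι P b ≫ (A.one ≫ Sigma.ι P 0) ▷ (∐ P) ≫ m =
      𝟙_ C ◁ Sigma.ι P b ≫ (λ_ (∐ P)).hom
    rw [leftUnitor_naturality, ← A.one_mul b, whisker_exchange_assoc, comp_whiskerRight_assoc,
      ← MonoidalCategory.tensorHom_def_assoc, hm, Category.assoc,
      Category.assoc, eqToHom_ι (P := P) (Nat.zero_add b)]
  · refine map_ι_comp_ext (tensorRight (𝟙_ C)) fun a => ?_
    change Sigma.ι P a ▷ 𝟙_ C ≫ (∐ P) ◁ (A.one ≫ Sigma.ι P 0) ≫ m =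
      Sigma.ι P a ▷ 𝟙_ C ≫ (ρ_ (∐ P)).hom
    rw [rightUnitor_naturality, ← A.mul_one a, ← whisker_exchange_assoc, whiskerLeft_comp_assoc,
      ← MonoidalCategory.tensorHom_def'_assoc, hm, Category.assoc]
    rfl
  · refine sigma_tensor₃_hom_ext fun a b c => ?_
    rw [tensorHom_comp_whiskerRight_assoc, hm, ← whiskerRight_comp_tensorHom_assoc, hm,
      MonoidalCategory.associator_naturality_assoc, tensorHom_comp_whiskerLeft_assoc, hm,
      ← whiskerLeft_comp_tensorHom_assoc, hm]
    have := A.mul_assoc a b c =≫ Sigma.ι P (a + (b + c))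
    rwa [Category.assoc, Category.assoc, eqToHom_ι (P := P) (Nat.add_assoc a b c), Category.assoc,
      Category.assoc] at this

/-- The coalgebra structure on the direct sum of the components of a graded coalgebra. The
comultiplication is a finite sum on each component. -/
theorem GradedComon.exists_comonObj (A : GradedComon P) :
    ∃ M : ComonObj (∐ P), (∀ a b, M.comul ≫ (Sigma.π P a ⊗ₘ Sigma.π P b) =
      Sigma.π P (a + b) ≫ A.comul a b) ∧ M.counit = Sigma.π P 0 ≫ A.counit := by
  let d (n a b : ℕ) : P n ⟶ P a ⊗ P b :=
    if h : a + b = n then eqToHom (congrArg P h).symm ≫ A.comul a b else 0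
  let δ : (∐ P) ⟶ (∐ P) ⊗ (∐ P) := Sigma.desc fun n =>
    ∑ s ∈ Finset.HasAntidiagonal.antidiagonal n, d n s.1 s.2 ≫ (Sigma.ι P s.1 ⊗ₘ Sigma.ι P s.2)
  have hδ (a b : ℕ) : δ ≫ (Sigma.π P a ⊗ₘ Sigma.π P b) = Sigma.π P (a + b) ≫ A.comul a b := by
    refine Sigma.hom_ext _ _ fun n => ?_
    rw [Sigma.ι_desc_assoc, sum_antidiagonal_ι_π (d n), ← Category.assoc, ι_π]
    by_cases h : a + b = n
    · subst h; simp [d]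
    · rw [if_neg h, dif_neg (Ne.symm h), zero_comp]
  refine ⟨⟨Sigma.π P 0 ≫ A.counit, δ, ?_, ?_, ?_⟩, hδ, rfl⟩
  · refine comp_map_π_ext (tensorLeft (𝟙_ C)) fun b => ?_
    change (δ ≫ (Sigma.π P 0 ≫ A.counit) ▷ (∐ P)) ≫ 𝟙_ C ◁ Sigma.π P b =
      (λ_ (∐ P)).inv ≫ 𝟙_ C ◁ Sigma.π P b
    rw [← leftUnitor_inv_naturality, ← A.counit_comul b, Category.assoc, ← whisker_exchange,
      comp_whiskerRight, ← MonoidalCategory.tensorHom_def'_assoc,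
      reassoc_of% (hδ 0 b), reassoc_of% (π_eqToHom (P := P) (Nat.zero_add b).symm)]
  · refine comp_map_π_ext (tensorRight (𝟙_ C)) fun a => ?_
    change (δ ≫ (∐ P) ◁ (Sigma.π P 0 ≫ A.counit)) ≫ Sigma.π P a ▷ 𝟙_ C =
      (ρ_ (∐ P)).inv ≫ Sigma.π P a ▷ 𝟙_ C
    rw [← rightUnitor_inv_naturality, ← A.comul_counit a, Category.assoc, whisker_exchange,
      whiskerLeft_comp, ← MonoidalCategory.tensorHom_def_assoc,
      reassoc_of% (hδ a 0)]
    rfl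
  · rw [← cancel_mono (α_ _ _ _).inv]
    refine comp_π_tensor₃_ext fun a b c => ?_
    simp only [Category.assoc, Iso.hom_inv_id, Category.comp_id]
    rw [← MonoidalCategory.associator_inv_naturality, whiskerLeft_comp_tensorHom_assoc, hδ,
      ← tensorHom_comp_whiskerLeft_assoc, reassoc_of% (hδ a (b + c)),
      whiskerRight_comp_tensorHom, hδ, ← tensorHom_comp_whiskerRight,
      reassoc_of% (hδ (a + b) c), ← A.comul_assoc,
      reassoc_of% (π_eqToHom (P := P) (Nat.add_assoc a b c).symm)]

end Totalize

/-! ### Graded bialgebras -/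

namespace GradedBialgebra

variable {C : Type u} [Category.{v} C] [Abelian C] [MonoidalCategory C] [BraidedCategory C]
  [HasColimits C] [AB5 C] [AbelianMonoidal C] [TensorCommutesWithDirectSums C]
  {X Y : ℕ → C} (A : GradedBialgebra X) (B : GradedBialgebra Y)

/-- A bialgebra on a direct sum is graded if all components of the multiplication and of the
comultiplication which do not preserve the degree vanish. -/
noncomputable def ofHomog [BimonObj (∐ X)]
    (hμ : ∀ n, HomogOut n (μ[∐ X] ≫ Sigma.π X n)) (hΔ : ∀ n, HomogIn n (Sigma.ι X n ≫ Δ[∐ X])) :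
    GradedBialgebra X where
  mul_graded n := by
    refine ⟨tensorSqInj X n ≫ μ ≫ Sigma.π X n, ?_⟩
    refine Sigma.hom_ext _ _ fun s => ?_
    have e : Sigma.ι (fun s : { s : ℕ × ℕ // s.1 + s.2 = n } => X s.1.1 ⊗ X s.1.2) s ≫
      tensorSqInj X n = (Sigma.ι X s.1.1 ⊗ₘ Sigma.ι X s.1.2) := Sigma.ι_desc _ _
    simp only [reassoc_of% e, Category.assoc]
    rw [← comp_π_eq_of_factors (n := n)
      (f := (Sigma.ι X s.1.1 ⊗ₘ Sigma.ι X s.1.2) ≫ μ) fun k hk => ?_]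
    · simp only [Category.assoc]
    · rw [Category.assoc]
      exact hμ k _ _ (by rw [s.2]; exact hk.symm)
  comul_graded n := by
    refine ⟨∑ s ∈ (Finset.HasAntidiagonal.antidiagonal n).attach,
      (Sigma.ι X n ≫ Δ ≫ (Sigma.π X s.1.1 ⊗ₘ Sigma.π X s.1.2)) ≫
        Sigma.ι (fun s : { s : ℕ × ℕ // s.1 + s.2 = n } => X s.1.1 ⊗ X s.1.2)
          ⟨s.1, Finset.HasAntidiagonal.mem_antidiagonal.1 s.2⟩, ?_⟩
    rw [(hΔ n).eq_sum, Preadditive.sum_comp, ← Finset.sum_attach]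
    refine Finset.sum_congr rfl fun s _ => ?_
    simp only [tensorSqInj, Category.assoc, Sigma.ι_desc]

theorem hom_ext {W : C} {f g : A.obj ⟶ W} (h : ∀ n, A.inj n ≫ f = A.inj n ≫ g) : f = g :=
  Sigma.hom_ext (f := X) _ _ h

theorem comp_proj_ext {W : C} {f g : W ⟶ A.obj} (h : ∀ n, f ≫ A.proj n = g ≫ A.proj n) : f = g :=
  sigma_comp_π_ext (X := X) h

theorem inj_comul_proj_eq_zero {n a b : ℕ} (h : a + b ≠ n) :
    A.inj n ≫ Δ ≫ (A.proj a ⊗ₘ A.proj b) = 0 := by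
  refine A.inj_comul_eq_zero n _ _ fun a' b' hab => ?_
  by_cases ha : a' = a
  · rw [A.inj_proj_ne (m := b') (n := b) (by omega), MonoidalPreadditive.tensor_zero]
  · rw [A.inj_proj_ne ha, MonoidalPreadditive.zero_tensor]

theorem inj_mul_proj_eq_zero {n a b : ℕ} (h : a + b ≠ n) :
    (A.inj a ⊗ₘ A.inj b) ≫ μ ≫ A.proj n = 0 := by
  rw [← Category.assoc, ← mulComp_inj, Category.assoc, inj_proj_ne _ h, comp_zero]

theorem homogIn_comul (n : ℕ) : HomogIn (X := X) (Y := X) n (A.inj n ≫ Δ) := by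
  intro a b h
  exact (Category.assoc _ _ _).trans (A.inj_comul_proj_eq_zero h)

theorem homogOut_mul (n : ℕ) : HomogOut (X := X) (Y := X) n (μ[A.obj] ≫ A.proj n) := by
  intro a b h
  exact A.inj_mul_proj_eq_zero h

/-- On `A_n` the comultiplication only involves degrees with sum `n`. -/
theorem comul_congr {n : ℕ} {W : C} {f g : A.obj ⊗ A.obj ⟶ W}
    (h : ∀ a b, a + b = n → (A.inj a ⊗ₘ A.inj b) ≫ f = (A.inj a ⊗ₘ A.inj b) ≫ g) :
    A.inj n ≫ Δ ≫ f = A.inj n ≫ Δ ≫ g := by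
  have := (A.homogIn_comul n).comp_congr h
  exact ((Category.assoc _ _ _).symm.trans this).trans (Category.assoc _ _ _)

/-- The component of degree `n` of the product only involves degrees with sum `n`. -/
theorem mul_congr {n : ℕ} {W : C} {f g : W ⟶ A.obj ⊗ A.obj}
    (h : ∀ a b, a + b = n → f ≫ (A.proj a ⊗ₘ A.proj b) = g ≫ (A.proj a ⊗ₘ A.proj b)) :
    f ≫ μ ≫ A.proj n = g ≫ μ ≫ A.proj n :=
  (A.homogOut_mul n).comp_congr h

theorem comul_tensor_congr {m n : ℕ} {W : C} {f g : (A.obj ⊗ A.obj) ⊗ (A.obj ⊗ A.obj) ⟶ W}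
    (h : ∀ a b a' b', a + b = m → a' + b' = n →
      ((A.inj a ⊗ₘ A.inj b) ⊗ₘ (A.inj a' ⊗ₘ A.inj b')) ≫ f =
      ((A.inj a ⊗ₘ A.inj b) ⊗ₘ (A.inj a' ⊗ₘ A.inj b')) ≫ g) :
    (A.inj m ≫ Δ ⊗ₘ A.inj n ≫ Δ) ≫ f = (A.inj m ≫ Δ ⊗ₘ A.inj n ≫ Δ) ≫ g :=
  (A.homogIn_comul m).tensor_comp_congr (A.homogIn_comul n) h

theorem mul_tensor_congr {m n : ℕ} {W : C} {f g : W ⟶ (A.obj ⊗ A.obj) ⊗ (A.obj ⊗ A.obj)}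
    (h : ∀ a b a' b', a + b = m → a' + b' = n →
      f ≫ ((A.proj a ⊗ₘ A.proj b) ⊗ₘ (A.proj a' ⊗ₘ A.proj b')) =
      g ≫ ((A.proj a ⊗ₘ A.proj b) ⊗ₘ (A.proj a' ⊗ₘ A.proj b'))) :
    f ≫ (μ ≫ A.proj m ⊗ₘ μ ≫ A.proj n) = g ≫ (μ ≫ A.proj m ⊗ₘ μ ≫ A.proj n) :=
  (A.homogOut_mul m).tensor_comp_congr (A.homogOut_mul n) h

theorem tensor_hom_ext {W : C} {f g : A.obj ⊗ B.obj ⟶ W}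
    (h : ∀ a b, (A.inj a ⊗ₘ B.inj b) ≫ f = (A.inj a ⊗ₘ B.inj b) ≫ g) : f = g :=
  sigma_tensor_hom_ext (X := X) (Y := Y) h

theorem comp_proj_tensor_ext {W : C} {f g : W ⟶ A.obj ⊗ B.obj}
    (h : ∀ a b, f ≫ (A.proj a ⊗ₘ B.proj b) = g ≫ (A.proj a ⊗ₘ B.proj b)) : f = g :=
  comp_π_tensor_ext (X := X) (Y := Y) h

/-- The unit of a graded algebra has degree `0`: its component of degree `0` is also a unit. -/
theorem one_eq_unitZero : η[A.obj] = A.unitZero ≫ A.inj 0 := by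
  have key : A.obj ◁ (A.unitZero ≫ A.inj 0) ≫ μ = (ρ_ A.obj).hom := by
    refine map_ι_comp_ext (X := X) (tensorRight (𝟙_ C)) fun n => ?_
    change A.inj n ▷ 𝟙_ C ≫ A.obj ◁ (A.unitZero ≫ A.inj 0) ≫ μ = A.inj n ▷ 𝟙_ C ≫ (ρ_ A.obj).hom
    have h : X n ◁ A.unitZero ≫ A.mulComp n 0 = (ρ_ (X n)).hom := A.unit_inj_mul_proj n
    rw [rightUnitor_naturality, ← h, ← whisker_exchange_assoc,
      whiskerLeft_comp_assoc, ← MonoidalCategory.tensorHom_def'_assoc, ← mulComp_inj,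
      Category.assoc]
    rfl
  have := η[A.obj] ▷ 𝟙_ C ≫= key
  rw [← whisker_exchange_assoc, MonObj.one_mul, rightUnitor_naturality, leftUnitor_naturality,
    unitors_equal, cancel_epi] at this
  exact this.symm

/-- The counit of a graded coalgebra is concentrated in degree `0`. -/
theorem counit_eq_counitZero : ε[A.obj] = A.proj 0 ≫ A.counitZero := by
  have key : Δ ≫ A.obj ◁ (A.proj 0 ≫ A.counitZero) = (ρ_ A.obj).inv := by
    refine comp_map_π_ext (X := X) (tensorRight (𝟙_ C)) fun n => ?_
    change (Δ ≫ A.obj ◁ (A.proj 0 ≫ A.counitZero)) ≫ A.proj n ▷ 𝟙_ C =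
      (ρ_ A.obj).inv ≫ A.proj n ▷ 𝟙_ C
    rw [← rightUnitor_inv_naturality, ← A.inj_comul_proj_counit n, Category.assoc,
      whisker_exchange, whiskerLeft_comp, ← MonoidalCategory.tensorHom_def_assoc,
      ← reassoc_of% (A.proj_comulComp n 0)]
    rfl
  have := key =≫ ε[A.obj] ▷ 𝟙_ C
  rw [Category.assoc, whisker_exchange, ComonObj.counit_comul_assoc, ← rightUnitor_inv_naturality,
    ← leftUnitor_inv_naturality, unitors_inv_equal, cancel_mono] at this
  exact this.symm

theorem inj_counit_eq_zero {n : ℕ} (h : n ≠ 0) : A.inj n ≫ ε[A.obj] = 0 := by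
  rw [counit_eq_counitZero, ← Category.assoc, inj_proj_ne _ h, zero_comp]

theorem one_proj_eq_zero {n : ℕ} (h : n ≠ 0) : η[A.obj] ≫ A.proj n = 0 := by
  rw [one_eq_unitZero, Category.assoc, inj_proj_ne _ h.symm, comp_zero]

/-- Two graded bialgebra structures with the same structure morphisms are equal. -/
theorem ext_of_eq {A A' : GradedBialgebra X}
    (hm : (μ[A.obj] : (∐ X) ⊗ (∐ X) ⟶ ∐ X) = μ[A'.obj]) (ho : (η[A.obj] : 𝟙_ C ⟶ ∐ X) = η[A'.obj])
    (hc : (Δ[A.obj] : (∐ X) ⟶ (∐ X) ⊗ (∐ X)) = Δ[A'.obj])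
    (he : (ε[A.obj] : (∐ X) ⟶ 𝟙_ C) = ε[A'.obj]) : A = A' := by
  obtain ⟨⟩ := A
  obtain ⟨⟩ := A'
  rename_i b _ _ b' _ _
  have : b = b' := by
    obtain @⟨⟨_, _⟩, ⟨_, _⟩⟩ := b
    obtain @⟨⟨_, _⟩, ⟨_, _⟩⟩ := b'
    cases hm; cases ho; cases hc; cases he
    rfl
  subst this
  rfl

end GradedBialgebra

/-! ### The relative cotensor coalgebra by components -/

namespace RelTensor

variable {C : Type u} [Category.{v} C] [Abelian C] [MonoidalCategory C]

section Cotensor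

variable [CoabelianMonoidal C] {H : Comon C} (N : Bicomodule H)

/-- The cotensor power `N^{□ n}`. -/
noncomputable abbrev corelPow (n : ℕ) : C := unop (relPow N.toOp n).X

/-- The comultiplication `N^{□ (a + b)} ⟶ N^{□ a} ⊗ N^{□ b}` of the cotensor coalgebra. -/
noncomputable abbrev corelComul (a b : ℕ) :
    corelPow N (a + b) ⟶ corelPow N a ⊗ corelPow N b :=
  (relMul N.toOp a b).unop

/-- The relative cotensor coalgebra as a graded coalgebra. -/
noncomputable def corelGradedComon : GradedComon (corelPow N) := (relGradedMon N.toOp).unop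

theorem mono_corelComul_one (a : ℕ) : Mono (corelComul N a 1) :=
  have := epi_relMul_one N.toOp a
  unop_mono_of_epi _

/-- The relative cotensor coalgebra is strongly graded. -/
theorem mono_corelComul (a b : ℕ) : Mono (corelComul N a b) := by
  have (Z : Cᵒᵖ) : (tensorRight Z).PreservesEpimorphisms :=
    ⟨fun {V W} f hf => by
      have : Mono f.unop := unop_mono_of_epi f
      have : Mono (f.unop ▷ Z.unop) := inferInstanceAs (Mono ((tensorRight Z.unop).map f.unop))
      exact op_epi_of_mono (f.unop ▷ Z.unop)⟩
  have := epi_relMul N.toOp a b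
  exact unop_mono_of_epi _

/-- Universal property of the relative cotensor coalgebra, by components. -/
theorem exists_corelLift {E : C} [ComonObj E] {f₀ : E ⟶ H.X} {f₁ : E ⟶ N.X}
    (h₀ : f₀ ≫ Δ[H.X] = Δ ≫ (f₀ ⊗ₘ f₀)) (hl : f₁ ≫ N.coactLeft = Δ ≫ (f₀ ⊗ₘ f₁))
    (hr : f₁ ≫ N.coactRight = Δ ≫ (f₁ ⊗ₘ f₀)) :
    ∃ f : ∀ n, E ⟶ corelPow N n, f 0 = f₀ ∧ f 1 = f₁ ∧
      ∀ a b, f (a + b) ≫ corelComul N a b = Δ ≫ (f a ⊗ₘ f b) := by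
  -- In the opposite category `E` is an algebra, and this is the universal property of the tensor
  -- algebra.
  let _ : MonObj (op E) := Comon.ComonToMonOpOpObjMon ⟨E⟩
  obtain ⟨f, hf₀, hf₁, hf⟩ := exists_relLift (M := N.toOp) (E := op E) (f₀ := f₀.op) (f₁ := f₁.op)
    (congrArg Quiver.Hom.op h₀) (congrArg Quiver.Hom.op hl) (congrArg Quiver.Hom.op hr)
  exact ⟨fun n => (f n).unop, congrArg Quiver.Hom.unop hf₀, congrArg Quiver.Hom.unop hf₁,
    fun a b => congrArg Quiver.Hom.unop (hf a b)⟩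

end Cotensor

/-! ### Universal properties of the tensor algebra and of the cotensor coalgebra -/

section Total

variable [HasColimits C] [AB5 C] [TensorCommutesWithDirectSums C]

section Tensor

variable [AbelianMonoidal C] {A : Mon C} (M : Bimod A A)

/-- The unit of `A`, as the unit of the tensor algebra. -/
noncomputable def relOne : 𝟙_ C ⟶ (relPow M 0).X := η[A.X]

/-- The algebra structure of `⨁ M^{⊗ n}` is that of the relative tensor algebra. -/
structure IsTensorAlgebra [MonObj (∐ fun n => (relPow M n).X)] : Prop where
  ι_mul (a b : ℕ) : (Sigma.ι (fun n => (relPow M n).X) a ⊗ₘ Sigma.ι _ b) ≫ μ =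
    relMul M a b ≫ Sigma.ι (fun n => (relPow M n).X) (a + b)
  one_eq : η = relOne M ≫ Sigma.ι (fun n => (relPow M n).X) 0

theorem exists_isTensorAlgebra :
    ∃ _ : MonObj (∐ fun n => (relPow M n).X), IsTensorAlgebra M := by
  obtain ⟨m, hm, ho⟩ := (relGradedMon M).exists_monObj
  exact ⟨m, ⟨hm, ho⟩⟩

variable {M} [MonObj (∐ fun n => (relPow M n).X)] {E : C} [MonObj E]

/-- Algebra homomorphisms on the tensor algebra are determined in degrees `0` and `1`. -/
theorem IsTensorAlgebra.hom_ext (hT : IsTensorAlgebra M) {f g : (∐ fun n => (relPow M n).X) ⟶ E}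
    (hf : IsMonHom f) (hg : IsMonHom g)
    (h₀ : Sigma.ι (fun n => (relPow M n).X) 0 ≫ f = Sigma.ι (fun n => (relPow M n).X) 0 ≫ g)
    (h₁ : Sigma.ι (fun n => (relPow M n).X) 1 ≫ f = Sigma.ι (fun n => (relPow M n).X) 1 ≫ g) :
    f = g := by
  refine Sigma.hom_ext _ _ fun n => ?_
  induction n with
  | zero => exact h₀
  | succ n ih =>
    rw [← cancel_epi (relMul M n 1), ← reassoc_of% (hT.ι_mul n 1), ← reassoc_of% (hT.ι_mul n 1),
      IsMonHom.mul_hom, IsMonHom.mul_hom, MonoidalCategory.tensorHom_comp_tensorHom_assoc,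
      MonoidalCategory.tensorHom_comp_tensorHom_assoc, ih, h₁]

theorem IsTensorAlgebra.exists_lift (hT : IsTensorAlgebra M) {f₀ : A.X ⟶ E} {f₁ : M.X ⟶ E}
    (hη : η[A.X] ≫ f₀ = η)
    (h₀ : μ[A.X] ≫ f₀ = (f₀ ⊗ₘ f₀) ≫ μ)
    (hl : M.actLeft ≫ f₁ = (f₀ ⊗ₘ f₁) ≫ μ) (hr : M.actRight ≫ f₁ = (f₁ ⊗ₘ f₀) ≫ μ) :
    ∃ f : (∐ fun n => (relPow M n).X) ⟶ E, IsMonHom f ∧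
      Sigma.ι (fun n => (relPow M n).X) 0 ≫ f = f₀ ∧
      Sigma.ι (fun n => (relPow M n).X) 1 ≫ f = f₁ := by
  obtain ⟨f, hf₀, hf₁, hf⟩ := exists_relLift h₀ hl hr
  have hι (n : ℕ) : Sigma.ι (fun n => (relPow M n).X) n ≫ Limits.Sigma.desc f = f n :=
    Sigma.ι_desc _ _
  refine ⟨Limits.Sigma.desc f, ⟨?_, ?_⟩, (hι 0).trans hf₀, (hι 1).trans hf₁⟩
  · rw [hT.one_eq, Category.assoc, hι, hf₀]
    exact hη
  · refine sigma_tensor_hom_ext fun a b => ?_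
    rw [reassoc_of% (hT.ι_mul a b), hι, hf, MonoidalCategory.tensorHom_comp_tensorHom_assoc,
      hι, hι]

/-- An algebra homomorphism from the tensor algebra is homogeneous if it is so in degrees `0` and
`1`. The degrees on the target are given by morphisms `q s` of degree `deg s`. -/
theorem IsTensorAlgebra.homog (hT : IsTensorAlgebra M) {f : (∐ fun n => (relPow M n).X) ⟶ E}
    (hf : IsMonHom f) {S : Type*} (deg : S → ℕ) {K : S → C} (q : ∀ s, E ⟶ K s)
    (hq : ∀ (s : S) (a b : ℕ), a + b ≠ deg s → ∀ {V W : C} (g : V ⟶ E) (h : W ⟶ E),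
      (∀ t, deg t ≠ a → g ≫ q t = 0) → (∀ t, deg t ≠ b → h ≫ q t = 0) →
      (g ⊗ₘ h) ≫ μ ≫ q s = 0)
    (h₀ : ∀ s, deg s ≠ 0 → Sigma.ι (fun n => (relPow M n).X) 0 ≫ f ≫ q s = 0)
    (h₁ : ∀ s, deg s ≠ 1 → Sigma.ι (fun n => (relPow M n).X) 1 ≫ f ≫ q s = 0) (n : ℕ) (s : S)
    (hs : deg s ≠ n) : Sigma.ι (fun n => (relPow M n).X) n ≫ f ≫ q s = 0 := by
  induction n generalizing s with
  | zero => exact h₀ s hs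
  | succ n ih =>
    rw [← cancel_epi (relMul M n 1), ← reassoc_of% (hT.ι_mul n 1), comp_zero,
      IsMonHom.mul_hom_assoc, MonoidalCategory.tensorHom_comp_tensorHom_assoc]
    exact hq s n 1 hs.symm _ _ (fun t ht => by simpa using ih t ht)
      (fun t ht => by simpa using h₁ t ht)

end Tensor

section Cotensor

variable [CoabelianMonoidal C] {H : Comon C} (N : Bicomodule H)

/-- The counit of `H`, as the counit of the cotensor coalgebra. -/
noncomputable def corelCounit : corelPow N 0 ⟶ 𝟙_ C := ε[H.X]

/-- The coalgebra structure of `⨁ N^{□ n}` is that of the relative cotensor coalgebra. -/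
structure IsCotensorCoalgebra [ComonObj (∐ corelPow N)] : Prop where
  comul_π (a b : ℕ) : Δ ≫ (Sigma.π (corelPow N) a ⊗ₘ Sigma.π (corelPow N) b) =
    Sigma.π (corelPow N) (a + b) ≫ corelComul N a b
  counit_eq : ε = Sigma.π (corelPow N) 0 ≫ corelCounit N

theorem exists_isCotensorCoalgebra :
    ∃ _ : ComonObj (∐ corelPow N), IsCotensorCoalgebra N := by
  obtain ⟨m, hm, ho⟩ := (corelGradedComon N).exists_comonObj
  exact ⟨m, ⟨hm, ho⟩⟩

variable {N} [ComonObj (∐ corelPow N)] {E : C} [ComonObj E]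

/-- Coalgebra homomorphisms to the cotensor coalgebra are determined by their components of
degrees `0` and `1`. -/
theorem IsCotensorCoalgebra.hom_ext (hT : IsCotensorCoalgebra N) {f g : E ⟶ ∐ corelPow N}
    (hf : IsComonHom f) (hg : IsComonHom g)
    (h₀ : f ≫ Sigma.π (corelPow N) 0 = g ≫ Sigma.π (corelPow N) 0)
    (h₁ : f ≫ Sigma.π (corelPow N) 1 = g ≫ Sigma.π (corelPow N) 1) : f = g := by
  refine sigma_comp_π_ext fun n => ?_
  induction n with
  | zero => exact h₀
  | succ n ih =>
    have := mono_corelComul_one N n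
    rw [← cancel_mono (corelComul N n 1), Category.assoc, Category.assoc, ← hT.comul_π n 1,
      IsComonHom.hom_comul_assoc, IsComonHom.hom_comul_assoc,
      MonoidalCategory.tensorHom_comp_tensorHom, MonoidalCategory.tensorHom_comp_tensorHom,
      ih, h₁]

/-- A morphism to the cotensor coalgebra is a coalgebra homomorphism as soon as its components
are comultiplicative. -/
theorem IsCotensorCoalgebra.isComonHom (hT : IsCotensorCoalgebra N) (F : E ⟶ ∐ corelPow N)
    {f : ∀ n, E ⟶ corelPow N n}
    (hf : ∀ a b, f (a + b) ≫ corelComul N a b = Δ ≫ (f a ⊗ₘ f b))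
    (hε : f 0 ≫ corelCounit N = ε[E]) (hF : ∀ n, F ≫ Sigma.π (corelPow N) n = f n) :
    IsComonHom F := by
  refine ⟨?_, ?_⟩
  · rw [hT.counit_eq, ← Category.assoc, hF, hε]
  · refine comp_π_tensor_ext fun a b => ?_
    rw [Category.assoc, Category.assoc, hT.comul_π, ← Category.assoc, hF, hf,
      MonoidalCategory.tensorHom_comp_tensorHom, hF, hF]

/-- A comultiplicative family of morphisms is homogeneous if it is so in degrees `0` and `1`. The
degrees on the source are given by morphisms `j s` of degree `deg s`. -/
theorem corel_homog {S : Type*} (deg : S → ℕ) {K : S → C} (j : ∀ s, K s ⟶ E)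
    (hj : ∀ (s : S) (a b : ℕ), a + b ≠ deg s → ∀ {V W : C} (g : E ⟶ V) (h : E ⟶ W),
      (∀ t, deg t ≠ a → j t ≫ g = 0) → (∀ t, deg t ≠ b → j t ≫ h = 0) →
      j s ≫ Δ ≫ (g ⊗ₘ h) = 0)
    {f : ∀ n, E ⟶ corelPow N n} (hf : ∀ a b, f (a + b) ≫ corelComul N a b = Δ ≫ (f a ⊗ₘ f b))
    (h₀ : ∀ s, deg s ≠ 0 → j s ≫ f 0 = 0) (h₁ : ∀ s, deg s ≠ 1 → j s ≫ f 1 = 0) (n : ℕ) (s : S)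
    (hs : deg s ≠ n) : j s ≫ f n = 0 := by
  induction n generalizing s with
  | zero => exact h₀ s hs
  | succ n ih =>
    have := mono_corelComul_one N n
    rw [← cancel_mono (corelComul N n 1), Category.assoc, hf, zero_comp]
    exact hj s n 1 hs.symm _ _ ih h₁

end Cotensor

end Total

end RelTensor

/-! ### Structure morphisms of a bialgebra -/

section Bimon

variable {C : Type u} [Category.{v} C] [MonoidalCategory C] [BraidedCategory C] {E : C}
  [BimonObj E]

theorem isMonHom_counit : IsMonHom ε[E] where
  one_hom := BimonObj.one_counit _
  mul_hom := by rw [BimonObj.mul_counit]; rfl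

theorem isMonHom_comul : IsMonHom Δ[E] where
  one_hom := BimonObj.one_comul _
  mul_hom := BimonObj.mul_comul _

attribute [local instance] ComonObj.instTensorUnit

theorem isComonHom_one : IsComonHom η[E] where
  hom_counit := BimonObj.one_counit _
  hom_comul := BimonObj.one_comul _

theorem isComonHom_mul : IsComonHom μ[E] where
  hom_counit := BimonObj.mul_counit _
  hom_comul := by
    rw [BimonObj.mul_comul, Comon.tensorObj_comul, Category.assoc]

end Bimon

/-! ### Morphisms which are multiplicative in degrees at most `1` -/

namespace GradedBialgebra

open RelTensor

variable {C : Type u} [Category.{v} C] [Abelian C] [MonoidalCategory C] [BraidedCategory C]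
  [HasColimits C] [AB5 C] [AbelianMonoidal C] [TensorCommutesWithDirectSums C]
  {X : ℕ → C} (B : GradedBialgebra X)

/-- `κ : B ⟶ E` is multiplicative on products of total degree at most `1`, and unital. -/
structure LowMul {E : C} [MonObj E] (κ : B.obj ⟶ E) : Prop where
  one : η ≫ κ = η
  mul (a b : ℕ) (h : a + b ≤ 1) : (B.inj a ⊗ₘ B.inj b) ≫ μ ≫ κ = (B.inj a ≫ κ ⊗ₘ B.inj b ≫ κ) ≫ μ

/-- `κ : E ⟶ B` is comultiplicative in total degree at most `1`, and counital. -/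
structure LowComul {E : C} [ComonObj E] (κ : E ⟶ B.obj) : Prop where
  counit : κ ≫ ε = ε
  comul (a b : ℕ) (h : a + b ≤ 1) :
    κ ≫ Δ ≫ (B.proj a ⊗ₘ B.proj b) = Δ ≫ (κ ≫ B.proj a ⊗ₘ κ ≫ B.proj b)

variable {B}

theorem lowMul_of_isMonHom {E : C} [MonObj E] (f : B.obj ⟶ E) [IsMonHom f] : LowMul B f where
  one := IsMonHom.one_hom f
  mul a b _ := by
    rw [IsMonHom.mul_hom, MonoidalCategory.tensorHom_comp_tensorHom_assoc]

theorem lowComul_of_isComonHom {E : C} [ComonObj E] (f : E ⟶ B.obj) [IsComonHom f] :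
    LowComul B f where
  counit := IsComonHom.hom_counit f
  comul a b _ := by
    rw [IsComonHom.hom_comul_assoc, MonoidalCategory.tensorHom_comp_tensorHom]

/-- The comultiplication of `B` turns morphisms multiplicative in degrees at most `1` into such
morphisms, since the comultiplication does not raise the degree. -/
theorem LowMul.comul {E : C} [MonObj E] {κ : B.obj ⟶ E} (hκ : LowMul B κ) :
    LowMul B (Δ ≫ (κ ⊗ₘ κ)) where
  one := by
    rw [BimonObj.one_comul_assoc, MonObj.tensorObj.one_def, MonObj.tensorObj.one_def,
      Category.assoc, MonoidalCategory.tensorHom_comp_tensorHom, hκ.one]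
  mul a b h := by
    have e1 : (B.inj a ⊗ₘ B.inj b) ≫ μ ≫ Δ ≫ (κ ⊗ₘ κ) =
        (B.inj a ≫ Δ ⊗ₘ B.inj b ≫ Δ) ≫ tensorμ _ _ _ _ ≫ (μ ≫ κ ⊗ₘ μ ≫ κ) := by
      rw [BimonObj.mul_comul_assoc, MonoidalCategory.tensorHom_comp_tensorHom_assoc,
        MonoidalCategory.tensorHom_comp_tensorHom]
    have e2 : (B.inj a ≫ Δ ≫ (κ ⊗ₘ κ) ⊗ₘ B.inj b ≫ Δ ≫ (κ ⊗ₘ κ)) ≫ μ =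
        (B.inj a ≫ Δ ⊗ₘ B.inj b ≫ Δ) ≫ ((κ ⊗ₘ κ) ⊗ₘ (κ ⊗ₘ κ)) ≫ tensorμ _ _ _ _ ≫ (μ ⊗ₘ μ) := by
      rw [MonObj.tensorObj.mul_def, MonoidalCategory.tensorHom_comp_tensorHom_assoc]
      simp only [Category.assoc]
    rw [e1, e2]
    refine B.comul_tensor_congr fun a₁ a₂ b₁ b₂ ha hb => ?_
    rw [tensorμ_natural_assoc, MonoidalCategory.tensorHom_comp_tensorHom,
      hκ.mul _ _ (by omega), hκ.mul _ _ (by omega),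
      MonoidalCategory.tensorHom_comp_tensorHom_assoc, MonoidalCategory.tensorHom_comp_tensorHom,
      MonoidalCategory.tensorHom_comp_tensorHom, tensorμ_natural_assoc,
      MonoidalCategory.tensorHom_comp_tensorHom]

/-- The multiplication of `B` turns morphisms comultiplicative in degrees at most `1` into such
morphisms, since the component of degree at most `1` of a product only involves such degrees. -/
theorem LowComul.mul {E : C} [ComonObj E] {κ : E ⟶ B.obj} (hκ : LowComul B κ) :
    LowComul B ((κ ⊗ₘ κ) ≫ μ) where
  counit := by
    rw [Category.assoc, BimonObj.mul_counit, Comon.tensorObj_counit, Comon.tensorObj_counit,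
      MonoidalCategory.tensorHom_comp_tensorHom_assoc, hκ.counit]
  comul a b h := by
    have e1 : ((κ ⊗ₘ κ) ≫ μ) ≫ Δ ≫ (B.proj a ⊗ₘ B.proj b) =
        ((κ ≫ Δ ⊗ₘ κ ≫ Δ) ≫ tensorμ _ _ _ _) ≫ (μ ≫ B.proj a ⊗ₘ μ ≫ B.proj b) := by
      rw [Category.assoc, BimonObj.mul_comul_assoc,
        MonoidalCategory.tensorHom_comp_tensorHom_assoc,
        MonoidalCategory.tensorHom_comp_tensorHom, Category.assoc]
    have e2 : Δ ≫ (((κ ⊗ₘ κ) ≫ μ) ≫ B.proj a ⊗ₘ ((κ ⊗ₘ κ) ≫ μ) ≫ B.proj b) =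
        (((Δ ⊗ₘ Δ) ≫ tensorμ E E E E) ≫ ((κ ⊗ₘ κ) ⊗ₘ (κ ⊗ₘ κ))) ≫
          (μ ≫ B.proj a ⊗ₘ μ ≫ B.proj b) := by
      rw [Comon.tensorObj_comul, Category.assoc, Category.assoc, Category.assoc, Category.assoc,
        Category.assoc, MonoidalCategory.tensorHom_comp_tensorHom]
    rw [e1, e2]
    refine B.mul_tensor_congr fun a₁ a₂ b₁ b₂ ha hb => ?_
    rw [Category.assoc, ← tensorμ_natural, MonoidalCategory.tensorHom_comp_tensorHom_assoc,
      Category.assoc, Category.assoc, hκ.comul _ _ (by omega), hκ.comul _ _ (by omega),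
      Category.assoc, Category.assoc, MonoidalCategory.tensorHom_comp_tensorHom,
      MonoidalCategory.tensorHom_comp_tensorHom, MonoidalCategory.tensorHom_comp_tensorHom,
      ← tensorμ_natural, MonoidalCategory.tensorHom_comp_tensorHom_assoc]

/-! ### The bialgebra structure of the tensor algebra -/

/-- The product of homogeneous morphisms of degrees `m` and `n` to `A ⊗ A` has degree `m + n`. -/
theorem homogIn_mul {P : ℕ → C} [MonObj (∐ P)] (hμ : ∀ n, HomogOut n (μ[∐ P] ≫ Sigma.π P n))
    {m n : ℕ} {V W : C} {f : V ⟶ (∐ P) ⊗ (∐ P)} (hf : HomogIn m f) {g : W ⟶ (∐ P) ⊗ (∐ P)}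
    (hg : HomogIn n g) : HomogIn (m + n) ((f ⊗ₘ g) ≫ μ) := by
  intro a b hab
  have e : ((f ⊗ₘ g) ≫ μ) ≫ (Sigma.π P a ⊗ₘ Sigma.π P b) =
      (f ⊗ₘ g) ≫ tensorμ _ _ _ _ ≫ (μ ≫ Sigma.π P a ⊗ₘ μ ≫ Sigma.π P b) := by
    rw [MonObj.tensorObj.mul_def, Category.assoc, Category.assoc,
      MonoidalCategory.tensorHom_comp_tensorHom]
  rw [e, hf.tensor_comp_congr hg (g' := 0), comp_zero]
  intro a₁ b₁ a₂ b₂ h₁ h₂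
  rw [comp_zero, tensorμ_natural_assoc, MonoidalCategory.tensorHom_comp_tensorHom]
  by_cases ha : a₁ + a₂ = a
  · rw [hμ b b₁ b₂ (by omega), MonoidalPreadditive.tensor_zero, comp_zero]
  · rw [hμ a a₁ a₂ ha, MonoidalPreadditive.zero_tensor, comp_zero]

section Tensor

variable (B)

/-- The generators of degree `0` of the tensor algebra. -/
noncomputable def tensorGenZero : X 0 ⟶ ∐ B.tensorPow := Sigma.ι B.tensorPow 0

/-- The generators of degree `1` of the tensor algebra. -/
noncomputable def tensorGenOne : X 1 ⟶ ∐ B.tensorPow := Sigma.ι B.tensorPow 1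

/-- The morphism from `B` to the tensor algebra which is the identity in degrees `0` and `1` and
vanishes in higher degrees. -/
noncomputable def toTensorGen : B.obj ⟶ ∐ B.tensorPow :=
  B.proj 0 ≫ B.tensorGenZero + B.proj 1 ≫ B.tensorGenOne

theorem inj_zero_toTensorGen : B.inj 0 ≫ B.toTensorGen = B.tensorGenZero := by
  rw [toTensorGen, Preadditive.comp_add, ← Category.assoc, ← Category.assoc, inj_proj_self,
    inj_proj_ne _ zero_ne_one, Category.id_comp, zero_comp, add_zero]

theorem inj_one_toTensorGen : B.inj 1 ≫ B.toTensorGen = B.tensorGenOne := by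
  rw [toTensorGen, Preadditive.comp_add, ← Category.assoc, ← Category.assoc, inj_proj_self,
    inj_proj_ne _ one_ne_zero, Category.id_comp, zero_comp, zero_add]

variable {B} in
theorem inj_zero_comul_toTensorGen : B.inj 0 ≫ Δ ≫ (B.toTensorGen ⊗ₘ B.toTensorGen) =
    B.comulComp 0 0 ≫ (B.tensorGenZero ⊗ₘ B.tensorGenZero) := by
  have e : B.comulComp 0 0 ≫ (B.tensorGenZero ⊗ₘ B.tensorGenZero) = B.inj 0 ≫ Δ ≫
      (B.proj 0 ≫ B.tensorGenZero ⊗ₘ B.proj 0 ≫ B.tensorGenZero) := by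
    rw [comulComp, Category.assoc, Category.assoc, MonoidalCategory.tensorHom_comp_tensorHom]
  rw [e]
  refine B.comul_congr fun a b h => ?_
  obtain ⟨rfl, rfl⟩ : a = 0 ∧ b = 0 := by omega
  rw [MonoidalCategory.tensorHom_comp_tensorHom, MonoidalCategory.tensorHom_comp_tensorHom,
    inj_zero_toTensorGen, ← Category.assoc, inj_proj_self, Category.id_comp]

variable {B} in
theorem inj_one_comul_toTensorGen : B.inj 1 ≫ Δ ≫ (B.toTensorGen ⊗ₘ B.toTensorGen) =
    B.comulComp 0 1 ≫ (B.tensorGenZero ⊗ₘ B.tensorGenOne) +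
      B.comulComp 1 0 ≫ (B.tensorGenOne ⊗ₘ B.tensorGenZero) := by
  have e : B.comulComp 0 1 ≫ (B.tensorGenZero ⊗ₘ B.tensorGenOne) +
      B.comulComp 1 0 ≫ (B.tensorGenOne ⊗ₘ B.tensorGenZero) = B.inj 1 ≫ Δ ≫
      ((B.proj 0 ≫ B.tensorGenZero ⊗ₘ B.proj 1 ≫ B.tensorGenOne) +
        (B.proj 1 ≫ B.tensorGenOne ⊗ₘ B.proj 0 ≫ B.tensorGenZero)) := by
    rw [comulComp, comulComp, Category.assoc, Category.assoc, Category.assoc, Category.assoc,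
      MonoidalCategory.tensorHom_comp_tensorHom, MonoidalCategory.tensorHom_comp_tensorHom,
      Preadditive.comp_add, Preadditive.comp_add]
  rw [e]
  refine B.comul_congr fun a b h => ?_
  have e0 : B.inj 0 ≫ B.proj 0 ≫ B.tensorGenZero = B.tensorGenZero := by
    rw [← Category.assoc, inj_proj_self, Category.id_comp]
  have e1 : B.inj 1 ≫ B.proj 1 ≫ B.tensorGenOne = B.tensorGenOne := by
    rw [← Category.assoc, inj_proj_self, Category.id_comp]
  have e2 : B.inj 0 ≫ B.proj 1 ≫ B.tensorGenOne = 0 := by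
    rw [← Category.assoc, inj_proj_ne _ zero_ne_one, zero_comp]
  have e3 : B.inj 1 ≫ B.proj 0 ≫ B.tensorGenZero = 0 := by
    rw [← Category.assoc, inj_proj_ne _ one_ne_zero, zero_comp]
  obtain ⟨rfl, rfl⟩ | ⟨rfl, rfl⟩ : (a = 0 ∧ b = 1) ∨ (a = 1 ∧ b = 0) := by omega
  · rw [Preadditive.comp_add]
    simp only [MonoidalCategory.tensorHom_comp_tensorHom, e0, e1, e2, e3, inj_zero_toTensorGen,
      inj_one_toTensorGen, MonoidalPreadditive.zero_tensor, add_zero]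
  · rw [Preadditive.comp_add]
    simp only [MonoidalCategory.tensorHom_comp_tensorHom, e0, e1, e2, e3, inj_zero_toTensorGen,
      inj_one_toTensorGen, MonoidalPreadditive.zero_tensor, zero_add]

instance [MonObj (∐ B.tensorPow)] : MonObj (∐ fun n => (relPow B.bimodOne n).X) :=
  inferInstanceAs (MonObj (∐ B.tensorPow))

/-- The algebra structure on `⨁ B_1^{⊗ n}` is that of the tensor algebra. -/
def IsTensorAlg [MonObj (∐ B.tensorPow)] : Prop :=
  IsTensorAlgebra B.bimodOne

variable {B} [MonObj (∐ B.tensorPow)]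

theorem lowMul_toTensorGen (hT : IsTensorAlg B) : LowMul B B.toTensorGen where
  one := by
    rw [one_eq_unitZero, Category.assoc, inj_zero_toTensorGen]
    exact hT.one_eq.symm
  mul a b h := by
    have e (k l : ℕ) : (B.inj k ⊗ₘ B.inj l) ≫ μ ≫ B.toTensorGen =
        B.mulComp k l ≫ B.inj (k + l) ≫ B.toTensorGen := by
      rw [← Category.assoc, ← mulComp_inj, Category.assoc]
    rw [e]
    obtain ⟨rfl, rfl⟩ | ⟨rfl, rfl⟩ | ⟨rfl, rfl⟩ : (a = 0 ∧ b = 0) ∨ (a = 0 ∧ b = 1) ∨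
      (a = 1 ∧ b = 0) := by omega
    · rw [inj_zero_toTensorGen]
      exact (hT.ι_mul 0 0).symm
    · rw [inj_zero_toTensorGen, inj_one_toTensorGen]
      exact (hT.ι_mul 0 1).symm
    · rw [inj_zero_toTensorGen, inj_one_toTensorGen]
      exact (hT.ι_mul 1 0).symm

/-- Universal property of the tensor algebra: a morphism on `B` which is multiplicative in degrees
at most `1` induces an algebra homomorphism. -/
theorem LowMul.exists_lift (hT : IsTensorAlg B) {E : C} [MonObj E] {κ : B.obj ⟶ E}
    (hκ : LowMul B κ) : ∃ f : (∐ B.tensorPow) ⟶ E, IsMonHom f ∧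
      ∀ n ≤ 1, B.inj n ≫ B.toTensorGen ≫ f = B.inj n ≫ κ := by
  have e (k l : ℕ) (h : k + l ≤ 1) : B.mulComp k l ≫ B.inj (k + l) ≫ κ =
      (B.inj k ≫ κ ⊗ₘ B.inj l ≫ κ) ≫ μ := by
    rw [← hκ.mul k l h, ← Category.assoc, mulComp_inj, Category.assoc]
  have h1 : B.unitZero ≫ B.inj 0 ≫ κ = η := by
    rw [← Category.assoc, ← one_eq_unitZero, hκ.one]
  obtain ⟨f, hf, h0, h1⟩ : ∃ f : (∐ B.tensorPow) ⟶ E, IsMonHom f ∧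
      B.tensorGenZero ≫ f = B.inj 0 ≫ κ ∧ B.tensorGenOne ≫ f = B.inj 1 ≫ κ :=
    IsTensorAlgebra.exists_lift (M := B.bimodOne) hT (f₀ := B.inj 0 ≫ κ)
    (f₁ := B.inj 1 ≫ κ) h1 (e 0 0 (by omega)) (e 0 1 (by omega)) (e 1 0 (by omega))
  refine ⟨f, hf, fun n hn => ?_⟩
  obtain rfl | rfl : n = 0 ∨ n = 1 := by omega
  · rw [← Category.assoc, inj_zero_toTensorGen]; exact h0
  · rw [← Category.assoc, inj_one_toTensorGen]; exact h1

/-- An algebra homomorphism on the tensor algebra is determined by its values on generators. -/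
theorem tensor_hom_ext_low (hT : IsTensorAlg B) {E : C} [MonObj E]
    {f g : (∐ B.tensorPow) ⟶ E} (hf : IsMonHom f) (hg : IsMonHom g)
    (h : ∀ n ≤ 1, B.inj n ≫ B.toTensorGen ≫ f = B.inj n ≫ B.toTensorGen ≫ g) : f = g := by
  refine IsTensorAlgebra.hom_ext (M := B.bimodOne) hT hf hg ?_ ?_
  · have := h 0 (by omega)
    rw [← Category.assoc, ← Category.assoc, inj_zero_toTensorGen] at this
    exact this
  · have := h 1 (by omega)
    rw [← Category.assoc, ← Category.assoc, inj_one_toTensorGen] at this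
    exact this

theorem IsTensorAlg.homogOut_mul (hT : IsTensorAlg B) (n : ℕ) :
    HomogOut n (μ[∐ B.tensorPow] ≫ Sigma.π B.tensorPow n) := by
  intro a b h
  have e : (Sigma.ι B.tensorPow a ⊗ₘ Sigma.ι B.tensorPow b) ≫ μ =
    B.tensorMul a b ≫ Sigma.ι B.tensorPow (a + b) := hT.ι_mul a b
  rw [reassoc_of% e, Sigma.ι_π_of_ne _ h, comp_zero]

end Tensor

/-- The tensor algebra has a graded bialgebra structure which extends that of `B_0` and `B_1`. -/
theorem exists_isTensorBialgebra (B : GradedBialgebra X) :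
    ∃ T : GradedBialgebra B.tensorPow, IsTensorBialgebra T := by
  obtain ⟨inst, hT'⟩ := exists_isTensorAlgebra B.bimodOne
  let inst1 : MonObj (∐ B.tensorPow) := inst
  have hT : IsTensorAlg B := hT'
  have hκ := lowMul_toTensorGen hT
  obtain ⟨δ, hδm, hδ⟩ := hκ.comul.exists_lift hT
  have := isMonHom_counit (E := B.obj)
  obtain ⟨e, hem, he⟩ := (lowMul_of_isMonHom ε[B.obj]).exists_lift hT
  -- Both sides of each coalgebra axiom are algebra homomorphisms, so they are compared on
  -- generators, where the axiom is that of `B`.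
  let inst2 : ComonObj (∐ B.tensorPow) :=
    { counit := e
      comul := δ
      counit_comul := by
        refine tensor_hom_ext_low hT inferInstance inferInstance fun n hn => ?_
        rw [reassoc_of% (hδ n hn), tensorHom_comp_whiskerRight,
          ← ComonObj.counit_comul_hom]
        refine B.comul_congr fun a b h => ?_
        rw [MonoidalCategory.tensorHom_comp_tensorHom, MonoidalCategory.tensorHom_comp_tensorHom,
          he a (by omega)]
      comul_counit := by
        refine tensor_hom_ext_low hT inferInstance inferInstance fun n hn => ?_
        rw [reassoc_of% (hδ n hn), tensorHom_comp_whiskerLeft,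
          ← ComonObj.comul_counit_hom]
        refine B.comul_congr fun a b h => ?_
        rw [MonoidalCategory.tensorHom_comp_tensorHom, MonoidalCategory.tensorHom_comp_tensorHom,
          he b (by omega)]
      comul_assoc := by
        refine tensor_hom_ext_low hT inferInstance inferInstance fun n hn => ?_
        rw [reassoc_of% (hδ n hn), reassoc_of% (hδ n hn), tensorHom_comp_whiskerLeft,
          tensorHom_comp_whiskerRight_assoc]
        have h1 : B.inj n ≫ Δ ≫ (B.toTensorGen ⊗ₘ B.toTensorGen ≫ δ) = B.inj n ≫ Δ ≫
            B.obj ◁ Δ ≫ (B.toTensorGen ⊗ₘ (B.toTensorGen ⊗ₘ B.toTensorGen)) := by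
          refine B.comul_congr fun a b h => ?_
          rw [MonoidalCategory.tensorHom_comp_tensorHom, hδ b (by omega),
            whiskerLeft_comp_tensorHom, MonoidalCategory.tensorHom_comp_tensorHom]
        have h2 : B.inj n ≫ Δ ≫ (B.toTensorGen ≫ δ ⊗ₘ B.toTensorGen) = B.inj n ≫ Δ ≫
            Δ ▷ B.obj ≫ ((B.toTensorGen ⊗ₘ B.toTensorGen) ⊗ₘ B.toTensorGen) := by
          refine B.comul_congr fun a b h => ?_
          rw [MonoidalCategory.tensorHom_comp_tensorHom, hδ a (by omega),
            whiskerRight_comp_tensorHom, MonoidalCategory.tensorHom_comp_tensorHom]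
        rw [h1, reassoc_of% h2, MonoidalCategory.associator_naturality,
          ComonObj.comul_assoc_assoc] }
  let inst3 : BimonObj (∐ B.tensorPow) :=
    { mul_comul := hδm.mul_hom
      one_comul := hδm.one_hom
      mul_counit := hem.mul_hom
      one_counit := hem.one_hom }
  have hδ0 : B.tensorGenZero ≫ δ =
      B.comulComp 0 0 ≫ (B.tensorGenZero ⊗ₘ B.tensorGenZero) := by
    rw [← inj_zero_comul_toTensorGen, ← hδ 0 (by omega), ← inj_zero_toTensorGen, Category.assoc]
  have hδ1 : B.tensorGenOne ≫ δ = B.comulComp 0 1 ≫ (B.tensorGenZero ⊗ₘ B.tensorGenOne) +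
      B.comulComp 1 0 ≫ (B.tensorGenOne ⊗ₘ B.tensorGenZero) := by
    rw [← inj_one_comul_toTensorGen, ← hδ 1 le_rfl, ← inj_one_toTensorGen, Category.assoc]
  have hgraded : ∀ n, HomogIn n (Sigma.ι B.tensorPow n ≫ Δ[∐ B.tensorPow]) := by
    have := IsTensorAlgebra.homog (M := B.bimodOne) hT hδm (fun s : ℕ × ℕ => s.1 + s.2)
      (fun s => Sigma.π B.tensorPow s.1 ⊗ₘ Sigma.π B.tensorPow s.2)
      (fun s a b h V W g g' hg hg' => by
        have := homogIn_mul hT.homogOut_mul (f := g) (g := g') (fun k l hkl => hg (k, l) hkl)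
          (fun k l hkl => hg' (k, l) hkl) s.1 s.2 h.symm
        rwa [Category.assoc] at this)
      (fun s hs => by
        have : (B.tensorGenZero ≫ δ) ≫ (Sigma.π B.tensorPow s.1 ⊗ₘ Sigma.π B.tensorPow s.2) =
            0 := by
          rw [hδ0, Category.assoc]
          have : (B.tensorGenZero ⊗ₘ B.tensorGenZero) ≫
              (Sigma.π B.tensorPow s.1 ⊗ₘ Sigma.π B.tensorPow s.2) = 0 :=
            ι_tensor_π B.tensorPow B.tensorPow 0 0 s.1 s.2 (by omega)
          rw [this, comp_zero]
        rwa [Category.assoc] at this)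
      (fun s hs => by
        have : (B.tensorGenOne ≫ δ) ≫ (Sigma.π B.tensorPow s.1 ⊗ₘ Sigma.π B.tensorPow s.2) = 0 := by
          rw [hδ1, Preadditive.add_comp, Category.assoc, Category.assoc]
          have h1 : (B.tensorGenZero ⊗ₘ B.tensorGenOne) ≫
              (Sigma.π B.tensorPow s.1 ⊗ₘ Sigma.π B.tensorPow s.2) = 0 :=
            ι_tensor_π B.tensorPow B.tensorPow 0 1 s.1 s.2 (by omega)
          have h2 : (B.tensorGenOne ⊗ₘ B.tensorGenZero) ≫
              (Sigma.π B.tensorPow s.1 ⊗ₘ Sigma.π B.tensorPow s.2) = 0 :=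
            ι_tensor_π B.tensorPow B.tensorPow 1 0 s.1 s.2 (by omega)
          rw [h1, h2, comp_zero, comp_zero, add_zero]
        rwa [Category.assoc] at this)
    intro n a b h
    exact (Category.assoc _ _ _).trans (this n (a, b) h)
  refine ⟨ofHomog hT.homogOut_mul hgraded, ?_, ?_, hδ0, hδ1, ?_, ?_⟩
  · intro a b
    have e : (Sigma.ι B.tensorPow a ⊗ₘ Sigma.ι B.tensorPow b) ≫ μ =
      B.tensorMul a b ≫ Sigma.ι B.tensorPow (a + b) := hT.ι_mul a b
    have e' := e =≫ Sigma.π B.tensorPow (a + b)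
    rw [Category.assoc, Category.assoc, Sigma.ι_π_eq_id, Category.comp_id] at e'
    exact e'
  · exact hT.one_eq
  · have := he 0 (by omega)
    rw [← Category.assoc, inj_zero_toTensorGen] at this
    exact this
  · have := he 1 (by omega)
    rw [← Category.assoc, inj_one_toTensorGen, inj_counit_eq_zero _ one_ne_zero] at this
    exact this

end GradedBialgebra

/-! ### Tensor products of coalgebra homomorphisms -/

section ComonHom

variable {C : Type u} [Category.{v} C] [MonoidalCategory C] [BraidedCategory C]
  {V W Z : C} [ComonObj V] [ComonObj W] [ComonObj Z]

attribute [local instance] ComonObj.instTensorUnit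

theorem isComonHom_whiskerRight (f : V ⟶ W) (hf : IsComonHom f) (Z : C) [ComonObj Z] :
    IsComonHom (f ▷ Z) :=
  inferInstanceAs (IsComonHom
    ((Comon.Hom.mk (M := ⟨V⟩) (N := ⟨W⟩) f : Comon.mk V ⟶ Comon.mk W) ▷ Comon.mk Z).hom)

theorem isComonHom_whiskerLeft (f : V ⟶ W) (hf : IsComonHom f) (Z : C) [ComonObj Z] :
    IsComonHom (Z ◁ f) :=
  inferInstanceAs (IsComonHom
    (Comon.mk Z ◁ (Comon.Hom.mk (M := ⟨V⟩) (N := ⟨W⟩) f : Comon.mk V ⟶ Comon.mk W)).hom)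

theorem isComonHom_associator : IsComonHom (α_ V W Z).hom := by
  have e : (α_ (Comon.mk V) (Comon.mk W) (Comon.mk Z)).hom.hom = (α_ V W Z).hom := by
    rw [Comon.monoidal_associator_hom_hom]
    change 𝟙 (V ⊗ W) ▷ Z ≫ (α_ V W Z).hom ≫ V ◁ 𝟙 (W ⊗ Z) = (α_ V W Z).hom
    simp
  rw [← e]
  exact (α_ (Comon.mk V) (Comon.mk W) (Comon.mk Z)).hom.isComonHom_hom

theorem isComonHom_leftUnitor : IsComonHom (λ_ V).hom := by
  have e : (λ_ (Comon.mk V)).hom.hom = (λ_ V).hom := by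
    rw [Comon.monoidal_leftUnitor_hom_hom]
    change 𝟙 (𝟙_ C) ▷ V ≫ (λ_ V).hom = (λ_ V).hom
    simp
  rw [← e]
  exact (λ_ (Comon.mk V)).hom.isComonHom_hom

theorem isComonHom_rightUnitor : IsComonHom (ρ_ V).hom := by
  have e : (ρ_ (Comon.mk V)).hom.hom = (ρ_ V).hom := by
    rw [Comon.monoidal_rightUnitor_hom_hom]
    change V ◁ 𝟙 (𝟙_ C) ≫ (ρ_ V).hom = (ρ_ V).hom
    simp
  rw [← e]
  exact (ρ_ (Comon.mk V)).hom.isComonHom_hom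

theorem isComonHom_tensorHom {V' W' : C} [ComonObj V'] [ComonObj W'] (f : V ⟶ W)
    (hf : IsComonHom f) (g : V' ⟶ W') (hg : IsComonHom g) : IsComonHom (f ⊗ₘ g) := by
  rw [MonoidalCategory.tensorHom_def]
  have := isComonHom_whiskerRight f hf V'
  have := isComonHom_whiskerLeft g hg W
  infer_instance

end ComonHom

/-! ### Gradings of coalgebras -/

section Grading

variable {C : Type u} [Category.{v} C] [Abelian C] [MonoidalCategory C]

/-- A grading of a coalgebra `E`: a decomposition of `E` as the direct sum of objects `K s`, each
with a degree, such that the comultiplication preserves the degree. The last condition is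
expressed through the morphisms on `E` which vanish outside a given degree. -/
structure ComonGrading (E : C) [ComonObj E] where
  /-- The index set. -/
  S : Type
  /-- The degree. -/
  deg : S → ℕ
  /-- The summands. -/
  K : S → C
  /-- The inclusions of the summands. -/
  j (s : S) : K s ⟶ E
  desc {W : C} (g : ∀ s, K s ⟶ W) : ∃ f : E ⟶ W, ∀ s, j s ≫ f = g s
  ext {W : C} {f g : E ⟶ W} (h : ∀ s, j s ≫ f = j s ≫ g) : f = g
  comul (s : S) (a b : ℕ) (hab : a + b ≠ deg s) {V W : C} (g : E ⟶ V) (h : E ⟶ W)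
    (hg : ∀ t, deg t ≠ a → j t ≫ g = 0) (hh : ∀ t, deg t ≠ b → j t ≫ h = 0) :
    j s ≫ Δ ≫ (g ⊗ₘ h) = 0

variable [MonoidalPreadditive C]

/-- The unit coalgebra, in degree `0`. -/
def ComonGrading.unit : letI := ComonObj.instTensorUnit C; ComonGrading (𝟙_ C) :=
  letI := ComonObj.instTensorUnit C
  { S := Unit
    deg := fun _ => 0
    K := fun _ => 𝟙_ C
    j := fun _ => 𝟙 _
    desc := fun g => ⟨g (), fun _ => Category.id_comp _⟩
    ext := fun h => by simpa using h ()
    comul := fun _ a b hab _ _ g h hg hh => by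
      by_cases ha : a = 0
      · have : h = 0 := by simpa using hh () (by omega)
        rw [this, MonoidalPreadditive.tensor_zero, comp_zero, comp_zero]
      · have : g = 0 := by simpa using hg () (by omega)
        rw [this, MonoidalPreadditive.zero_tensor, comp_zero, comp_zero] }

end Grading

namespace GradedBialgebra

open RelTensor

variable {C : Type u} [Category.{v} C] [Abelian C] [MonoidalCategory C] [BraidedCategory C]
  [HasColimits C] [AB5 C] [AbelianMonoidal C] [TensorCommutesWithDirectSums C]
  {X : ℕ → C} (B : GradedBialgebra X)

/-- The grading of the coalgebra underlying a graded bialgebra. -/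
noncomputable def comonGrading : ComonGrading B.obj where
  S := ℕ
  deg := id
  K := X
  j := B.inj
  desc g := ⟨Limits.Sigma.desc (f := X) g, fun _ => Sigma.ι_desc _ _⟩
  ext h := B.hom_ext h
  comul n a b hab V W g h hg hh := by
    rw [B.comul_congr (g := 0), comp_zero, comp_zero]
    intro a' b' hab'
    rw [comp_zero, MonoidalCategory.tensorHom_comp_tensorHom]
    by_cases ha : a' = a
    · have hb : b' ≠ b := by rintro rfl; exact hab (ha ▸ hab')
      rw [hh b' hb, MonoidalPreadditive.tensor_zero]
    · rw [hg a' ha, MonoidalPreadditive.zero_tensor]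

/-- A morphism composed from the comultiplication of `E ⊗ E` and homogeneous morphisms of degrees
`m` and `n` is homogeneous of degree `m + n`. -/
theorem homogOut_comul {P : ℕ → C} [ComonObj (∐ P)]
    (hΔ : ∀ n, HomogIn n (Sigma.ι P n ≫ Δ[∐ P])) {m n : ℕ} {V W : C}
    {f : (∐ P) ⊗ (∐ P) ⟶ V} (hf : HomogOut m f) {g : (∐ P) ⊗ (∐ P) ⟶ W} (hg : HomogOut n g) :
    HomogOut (m + n) (Δ ≫ (f ⊗ₘ g)) := by
  intro a b hab
  have e : (Sigma.ι P a ⊗ₘ Sigma.ι P b) ≫ Δ ≫ (f ⊗ₘ g) =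
      ((Sigma.ι P a ≫ Δ ⊗ₘ Sigma.ι P b ≫ Δ) ≫ tensorμ _ _ _ _) ≫ (f ⊗ₘ g) := by
    rw [Comon.tensorObj_comul, Category.assoc, MonoidalCategory.tensorHom_comp_tensorHom_assoc,
      Category.assoc]
  rw [e, hf.tensor_comp_congr hg (g' := 0), zero_comp]
  intro a₁ b₁ a₂ b₂ h₁ h₂
  rw [zero_comp, Category.assoc, ← tensorμ_natural,
    MonoidalCategory.tensorHom_comp_tensorHom_assoc]
  by_cases ha : a₁ + a₂ = a
  · rw [hΔ b b₁ b₂ (by omega), MonoidalPreadditive.tensor_zero, zero_comp]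
  · rw [hΔ a a₁ a₂ ha, MonoidalPreadditive.zero_tensor, zero_comp]

/-- The grading of the tensor square of a graded coalgebra. -/
noncomputable def comonGradingTensor {P : ℕ → C} [ComonObj (∐ P)]
    (hΔ : ∀ n, HomogIn n (Sigma.ι P n ≫ Δ[∐ P])) : ComonGrading ((∐ P) ⊗ (∐ P)) where
  S := ℕ × ℕ
  deg s := s.1 + s.2
  K s := P s.1 ⊗ P s.2
  j s := Sigma.ι P s.1 ⊗ₘ Sigma.ι P s.2
  desc g :=
    have ⟨f, hf⟩ := exists_tensor_desc fun a b => g (a, b)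
    ⟨f, fun s => hf s.1 s.2⟩
  ext h := sigma_tensor_hom_ext fun a b => h (a, b)
  comul _ _ _ hab _ _ _ _ hg hh :=
    homogOut_comul hΔ (fun k l hkl => hg (k, l) hkl) (fun k l hkl => hh (k, l) hkl) _ _ hab.symm

/-! ### The bialgebra structure of the cotensor coalgebra -/

section Cotensor

variable [CoabelianMonoidal C]

/-- The cogenerators of degree `0` of the cotensor coalgebra. -/
noncomputable def cotensorCogenZero : (∐ B.cotensorPow) ⟶ X 0 := Sigma.π B.cotensorPow 0

/-- The cogenerators of degree `1` of the cotensor coalgebra. -/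
noncomputable def cotensorCogenOne : (∐ B.cotensorPow) ⟶ X 1 := Sigma.π B.cotensorPow 1

/-- The morphism from the cotensor coalgebra to `B` which is the identity in degrees `0` and `1`
and vanishes in higher degrees. -/
noncomputable def fromCotensorCogen : (∐ B.cotensorPow) ⟶ B.obj :=
  B.cotensorCogenZero ≫ B.inj 0 + B.cotensorCogenOne ≫ B.inj 1

theorem fromCotensorCogen_proj_zero : B.fromCotensorCogen ≫ B.proj 0 = B.cotensorCogenZero := by
  rw [fromCotensorCogen, Preadditive.add_comp, Category.assoc, Category.assoc, inj_proj_self,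
    inj_proj_ne _ one_ne_zero, Category.comp_id, comp_zero, add_zero]

theorem fromCotensorCogen_proj_one : B.fromCotensorCogen ≫ B.proj 1 = B.cotensorCogenOne := by
  rw [fromCotensorCogen, Preadditive.add_comp, Category.assoc, Category.assoc, inj_proj_self,
    inj_proj_ne _ zero_ne_one, Category.comp_id, comp_zero, zero_add]

theorem fromCotensorCogen_mul_proj_zero :
    (B.fromCotensorCogen ⊗ₘ B.fromCotensorCogen) ≫ μ ≫ B.proj 0 =
      (B.cotensorCogenZero ⊗ₘ B.cotensorCogenZero) ≫ B.mulComp 0 0 := by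
  have e : (B.cotensorCogenZero ⊗ₘ B.cotensorCogenZero) ≫ B.mulComp 0 0 =
      (B.cotensorCogenZero ≫ B.inj 0 ⊗ₘ B.cotensorCogenZero ≫ B.inj 0) ≫ μ ≫ B.proj 0 := by
    rw [mulComp, MonoidalCategory.tensorHom_comp_tensorHom_assoc]
  rw [e]
  refine B.mul_congr fun a b h => ?_
  obtain ⟨rfl, rfl⟩ : a = 0 ∧ b = 0 := by omega
  rw [MonoidalCategory.tensorHom_comp_tensorHom, MonoidalCategory.tensorHom_comp_tensorHom,
    fromCotensorCogen_proj_zero, Category.assoc, inj_proj_self, Category.comp_id]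

theorem fromCotensorCogen_mul_proj_one :
    (B.fromCotensorCogen ⊗ₘ B.fromCotensorCogen) ≫ μ ≫ B.proj 1 =
      (B.cotensorCogenZero ⊗ₘ B.cotensorCogenOne) ≫ B.mulComp 0 1 +
        (B.cotensorCogenOne ⊗ₘ B.cotensorCogenZero) ≫ B.mulComp 1 0 := by
  have e : (B.cotensorCogenZero ⊗ₘ B.cotensorCogenOne) ≫ B.mulComp 0 1 +
        (B.cotensorCogenOne ⊗ₘ B.cotensorCogenZero) ≫ B.mulComp 1 0 =
      ((B.cotensorCogenZero ≫ B.inj 0 ⊗ₘ B.cotensorCogenOne ≫ B.inj 1) +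
        (B.cotensorCogenOne ≫ B.inj 1 ⊗ₘ B.cotensorCogenZero ≫ B.inj 0)) ≫ μ ≫ B.proj 1 := by
    rw [mulComp, mulComp, MonoidalCategory.tensorHom_comp_tensorHom_assoc,
      MonoidalCategory.tensorHom_comp_tensorHom_assoc, Preadditive.add_comp]
  rw [e]
  refine B.mul_congr fun a b h => ?_
  obtain ⟨rfl, rfl⟩ | ⟨rfl, rfl⟩ : (a = 0 ∧ b = 1) ∨ (a = 1 ∧ b = 0) := by omega
  · rw [Preadditive.add_comp]
    simp only [MonoidalCategory.tensorHom_comp_tensorHom, Category.assoc, inj_proj_self,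
      B.inj_proj_ne one_ne_zero, Category.comp_id, comp_zero,
      fromCotensorCogen_proj_zero, fromCotensorCogen_proj_one, MonoidalPreadditive.zero_tensor,
      add_zero]
  · rw [Preadditive.add_comp]
    simp only [MonoidalCategory.tensorHom_comp_tensorHom, Category.assoc, inj_proj_self,
      B.inj_proj_ne zero_ne_one, Category.comp_id, comp_zero,
      fromCotensorCogen_proj_zero, fromCotensorCogen_proj_one, MonoidalPreadditive.zero_tensor,
      zero_add]

instance [ComonObj (∐ B.cotensorPow)] : ComonObj (∐ corelPow B.bicomodOne) :=
  inferInstanceAs (ComonObj (∐ B.cotensorPow))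

/-- The coalgebra structure on `⨁ B_1^{□ n}` is that of the cotensor coalgebra. -/
def IsCotensorCoalg [ComonObj (∐ B.cotensorPow)] : Prop :=
  IsCotensorCoalgebra B.bicomodOne

variable {B} [ComonObj (∐ B.cotensorPow)]

theorem IsCotensorCoalg.homogIn_comul (hT : IsCotensorCoalg B) (n : ℕ) :
    HomogIn n (Sigma.ι B.cotensorPow n ≫ Δ[∐ B.cotensorPow]) := by
  intro a b h
  have e : Δ ≫ (Sigma.π B.cotensorPow a ⊗ₘ Sigma.π B.cotensorPow b) =
    Sigma.π B.cotensorPow (a + b) ≫ B.cotensorComul a b := hT.comul_π a b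
  rw [Category.assoc, e, reassoc_of% (Sigma.ι_π_of_ne B.cotensorPow h.symm), zero_comp]

theorem lowComul_fromCotensorCogen (hT : IsCotensorCoalg B) :
    LowComul B B.fromCotensorCogen where
  counit := by
    rw [counit_eq_counitZero, ← Category.assoc, fromCotensorCogen_proj_zero]
    exact hT.counit_eq.symm
  comul a b h := by
    have e (k l : ℕ) : B.fromCotensorCogen ≫ Δ ≫ (B.proj k ⊗ₘ B.proj l) =
        (B.fromCotensorCogen ≫ B.proj (k + l)) ≫ B.comulComp k l := by
      rw [← proj_comulComp, Category.assoc]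
    rw [e]
    obtain ⟨rfl, rfl⟩ | ⟨rfl, rfl⟩ | ⟨rfl, rfl⟩ : (a = 0 ∧ b = 0) ∨ (a = 0 ∧ b = 1) ∨
      (a = 1 ∧ b = 0) := by omega
    · rw [fromCotensorCogen_proj_zero]
      exact (hT.comul_π 0 0).symm
    · rw [fromCotensorCogen_proj_zero, fromCotensorCogen_proj_one]
      exact (hT.comul_π 0 1).symm
    · rw [fromCotensorCogen_proj_zero, fromCotensorCogen_proj_one]
      exact (hT.comul_π 1 0).symm

/-- Universal property of the cotensor coalgebra: a morphism to `B` which is comultiplicative in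
degrees at most `1` induces a coalgebra homomorphism. A grading of the source is needed, since the
components of the induced morphism have to be combined into a morphism to a direct sum. -/
theorem LowComul.exists_lift (hT : IsCotensorCoalg B) {E : C} [ComonObj E] {κ : E ⟶ B.obj}
    (hκ : LowComul B κ) (G : ComonGrading E)
    (h0 : ∀ s, G.deg s ≠ 0 → G.j s ≫ κ ≫ B.proj 0 = 0)
    (h1 : ∀ s, G.deg s ≠ 1 → G.j s ≫ κ ≫ B.proj 1 = 0) :
    ∃ f : E ⟶ ∐ B.cotensorPow, IsComonHom f ∧
      (∀ n ≤ 1, f ≫ B.fromCotensorCogen ≫ B.proj n = κ ≫ B.proj n) ∧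
      ∀ s n, G.deg s ≠ n → G.j s ≫ f ≫ Sigma.π B.cotensorPow n = 0 := by
  have e (k l : ℕ) (h : k + l ≤ 1) : (κ ≫ B.proj (k + l)) ≫ B.comulComp k l =
      Δ ≫ (κ ≫ B.proj k ⊗ₘ κ ≫ B.proj l) := by
    rw [← hκ.comul k l h, Category.assoc, proj_comulComp]
  obtain ⟨f, hf0, hf1, hf⟩ : ∃ f : ∀ n, E ⟶ B.cotensorPow n, f 0 = κ ≫ B.proj 0 ∧
      f 1 = κ ≫ B.proj 1 ∧ ∀ a b, f (a + b) ≫ B.cotensorComul a b = Δ ≫ (f a ⊗ₘ f b) :=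
    exists_corelLift B.bicomodOne (e 0 0 (by omega)) (e 0 1 (by omega)) (e 1 0 (by omega))
  have hz := corel_homog (N := B.bicomodOne) G.deg G.j G.comul (f := f) hf
    (fun s hs => by rw [hf0]; exact h0 s hs) (fun s hs => by rw [hf1]; exact h1 s hs)
  obtain ⟨F, hF⟩ := G.desc fun s => G.j s ≫ f (G.deg s) ≫ Sigma.ι B.cotensorPow (G.deg s)
  have hFπ (n : ℕ) : F ≫ Sigma.π B.cotensorPow n = f n := by
    refine G.ext fun s => ?_
    rw [reassoc_of% (hF s)]
    by_cases h : G.deg s = n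
    · subst h
      rw [Sigma.ι_π_eq_id, Category.comp_id]
    · rw [Sigma.ι_π_of_ne _ h, comp_zero, comp_zero]
      exact (hz n s h).symm
  refine ⟨F, ?_, ?_, ?_⟩
  · refine IsCotensorCoalgebra.isComonHom (N := B.bicomodOne) hT F hf ?_ hFπ
    rw [hf0]
    have := hκ.counit
    rw [counit_eq_counitZero, ← Category.assoc] at this
    exact this
  · intro n hn
    obtain rfl | rfl : n = 0 ∨ n = 1 := by omega
    · rw [fromCotensorCogen_proj_zero, ← hf0]; exact hFπ 0
    · rw [fromCotensorCogen_proj_one, ← hf1]; exact hFπ 1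
  · intro s n h
    rw [hFπ]
    exact hz n s h

/-- A coalgebra homomorphism to the cotensor coalgebra is determined by its components on
cogenerators. -/
theorem cotensor_hom_ext_low (hT : IsCotensorCoalg B) {E : C} [ComonObj E]
    {f g : E ⟶ ∐ B.cotensorPow} (hf : IsComonHom f) (hg : IsComonHom g)
    (h : ∀ n ≤ 1, f ≫ B.fromCotensorCogen ≫ B.proj n = g ≫ B.fromCotensorCogen ≫ B.proj n) :
    f = g := by
  refine IsCotensorCoalgebra.hom_ext (N := B.bicomodOne) hT hf hg ?_ ?_
  · have := h 0 (by omega)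
    rw [fromCotensorCogen_proj_zero] at this
    exact this
  · have := h 1 (by omega)
    rw [fromCotensorCogen_proj_one] at this
    exact this

end Cotensor

attribute [local instance] ComonObj.instTensorUnit in
/-- The cotensor coalgebra has a graded bialgebra structure which extends that of `B_0` and
`B_1`. -/
theorem exists_isCotensorBialgebra [CoabelianMonoidal C] (B : GradedBialgebra X) :
    ∃ T : GradedBialgebra B.cotensorPow, IsCotensorBialgebra T := by
  obtain ⟨inst, hT'⟩ := exists_isCotensorCoalgebra B.bicomodOne
  let inst1 : ComonObj (∐ B.cotensorPow) := inst
  have hT : IsCotensorCoalg B := hT'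
  have hκ := lowComul_fromCotensorCogen hT
  obtain ⟨m, hmc, hm, hmh⟩ := hκ.mul.exists_lift hT (comonGradingTensor hT.homogIn_comul)
    (fun s hs => by
      rw [Category.assoc, fromCotensorCogen_mul_proj_zero, ← Category.assoc]
      have : (Sigma.ι B.cotensorPow s.1 ⊗ₘ Sigma.ι B.cotensorPow s.2) ≫
          (B.cotensorCogenZero ⊗ₘ B.cotensorCogenZero) = 0 :=
        ι_tensor_π B.cotensorPow B.cotensorPow s.1 s.2 0 0
          (fun h => hs (by simp [comonGradingTensor, h]))
      exact (congrArg (· ≫ B.mulComp 0 0) this).trans zero_comp)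
    (fun s hs => by
      rw [Category.assoc, fromCotensorCogen_mul_proj_one, Preadditive.comp_add, ← Category.assoc,
        ← Category.assoc]
      have h1 : (Sigma.ι B.cotensorPow s.1 ⊗ₘ Sigma.ι B.cotensorPow s.2) ≫
          (B.cotensorCogenZero ⊗ₘ B.cotensorCogenOne) = 0 :=
        ι_tensor_π B.cotensorPow B.cotensorPow s.1 s.2 0 1
          (fun h => hs (by simp [comonGradingTensor, h]))
      have h2 : (Sigma.ι B.cotensorPow s.1 ⊗ₘ Sigma.ι B.cotensorPow s.2) ≫
          (B.cotensorCogenOne ⊗ₘ B.cotensorCogenZero) = 0 :=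
        ι_tensor_π B.cotensorPow B.cotensorPow s.1 s.2 1 0
          (fun h => hs (by simp [comonGradingTensor, h]))
      have h3 := (congrArg (· ≫ B.mulComp 0 1) h1).trans zero_comp
      have h4 := (congrArg (· ≫ B.mulComp 1 0) h2).trans zero_comp
      exact (congrArg₂ (· + ·) h3 h4).trans (add_zero _))
  have := isComonHom_one (E := B.obj)
  obtain ⟨e, hec, he, -⟩ := (lowComul_of_isComonHom η[B.obj]).exists_lift hT ComonGrading.unit
    (fun s hs => absurd rfl hs)
    (fun s _ => by rw [one_proj_eq_zero _ one_ne_zero, comp_zero])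
  have hm' (n : ℕ) (hn : n ≤ 1) : m ≫ B.fromCotensorCogen ≫ B.proj n =
      (B.fromCotensorCogen ⊗ₘ B.fromCotensorCogen) ≫ μ ≫ B.proj n := by
    rw [hm n hn, Category.assoc]
  -- Both sides of each algebra axiom are coalgebra homomorphisms, so they are compared on
  -- cogenerators, where the axiom is that of `B`.
  let inst2 : MonObj (∐ B.cotensorPow) :=
    { one := e
      mul := m
      one_mul := by
        have := isComonHom_whiskerRight e hec (∐ B.cotensorPow)
        refine cotensor_hom_ext_low hT inferInstance isComonHom_leftUnitor fun n hn => ?_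
        rw [Category.assoc, hm' n hn, whiskerRight_comp_tensorHom_assoc,
          ← Category.assoc (λ_ _).hom, ← MonObj.one_mul_hom, Category.assoc]
        refine B.mul_congr fun a b h => ?_
        rw [MonoidalCategory.tensorHom_comp_tensorHom, MonoidalCategory.tensorHom_comp_tensorHom,
          Category.assoc, he a (by omega)]
      mul_one := by
        have := isComonHom_whiskerLeft e hec (∐ B.cotensorPow)
        refine cotensor_hom_ext_low hT inferInstance isComonHom_rightUnitor fun n hn => ?_
        rw [Category.assoc, hm' n hn, whiskerLeft_comp_tensorHom_assoc,
          ← Category.assoc (ρ_ _).hom, ← MonObj.mul_one_hom, Category.assoc]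
        refine B.mul_congr fun a b h => ?_
        rw [MonoidalCategory.tensorHom_comp_tensorHom, MonoidalCategory.tensorHom_comp_tensorHom,
          Category.assoc, he b (by omega)]
      mul_assoc := by
        have := isComonHom_whiskerLeft m hmc (∐ B.cotensorPow)
        have := isComonHom_whiskerRight m hmc (∐ B.cotensorPow)
        have := isComonHom_associator (V := ∐ B.cotensorPow) (W := ∐ B.cotensorPow)
          (Z := ∐ B.cotensorPow)
        refine cotensor_hom_ext_low hT inferInstance inferInstance fun n hn => ?_
        rw [Category.assoc, Category.assoc, Category.assoc, hm' n hn,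
          whiskerRight_comp_tensorHom_assoc, whiskerLeft_comp_tensorHom_assoc]
        have h1 : (m ≫ B.fromCotensorCogen ⊗ₘ B.fromCotensorCogen) ≫ μ ≫ B.proj n =
            (((B.fromCotensorCogen ⊗ₘ B.fromCotensorCogen) ⊗ₘ B.fromCotensorCogen) ≫ μ ▷ B.obj) ≫
              μ ≫ B.proj n := by
          refine B.mul_congr fun a b h => ?_
          rw [MonoidalCategory.tensorHom_comp_tensorHom, Category.assoc, hm' a (by omega),
            tensorHom_comp_whiskerRight, MonoidalCategory.tensorHom_comp_tensorHom, Category.assoc]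
        have h2 : (B.fromCotensorCogen ⊗ₘ m ≫ B.fromCotensorCogen) ≫ μ ≫ B.proj n =
            ((B.fromCotensorCogen ⊗ₘ (B.fromCotensorCogen ⊗ₘ B.fromCotensorCogen)) ≫ B.obj ◁ μ) ≫
              μ ≫ B.proj n := by
          refine B.mul_congr fun a b h => ?_
          rw [MonoidalCategory.tensorHom_comp_tensorHom, Category.assoc, hm' b (by omega),
            tensorHom_comp_whiskerLeft, MonoidalCategory.tensorHom_comp_tensorHom, Category.assoc]
        rw [h1, h2, Category.assoc, Category.assoc, MonObj.mul_assoc_assoc,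
          MonoidalCategory.associator_naturality_assoc] }
  let inst3 : BimonObj (∐ B.cotensorPow) :=
    { mul_comul := by
        have := hmc.hom_comul
        rw [Comon.tensorObj_comul, Category.assoc] at this
        exact this
      one_comul := hec.hom_comul
      mul_counit := hmc.hom_counit
      one_counit := hec.hom_counit }
  have hgraded : ∀ n, HomogOut n (μ[∐ B.cotensorPow] ≫ Sigma.π B.cotensorPow n) :=
    fun n a b h => hmh (a, b) n h
  refine ⟨ofHomog hgraded hT.homogIn_comul, ?_, ?_, ?_, ?_, ?_, ?_⟩
  · intro a b
    have e : Δ ≫ (Sigma.π B.cotensorPow a ⊗ₘ Sigma.π B.cotensorPow b) =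
      Sigma.π B.cotensorPow (a + b) ≫ B.cotensorComul a b := hT.comul_π a b
    have e' := Sigma.ι B.cotensorPow (a + b) ≫= e
    rw [← Category.assoc (Sigma.ι B.cotensorPow (a + b)) (Sigma.π B.cotensorPow (a + b)),
      Sigma.ι_π_eq_id, Category.id_comp] at e'
    exact e'
  · exact hT.counit_eq
  · have := hm' 0 (by omega)
    rw [fromCotensorCogen_proj_zero, fromCotensorCogen_mul_proj_zero] at this
    exact this
  · have := hm' 1 (by omega)
    rw [fromCotensorCogen_proj_one, fromCotensorCogen_mul_proj_one] at this
    exact this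
  · have := he 0 (by omega)
    rw [fromCotensorCogen_proj_zero] at this
    exact this
  · have := he 1 (by omega)
    rw [fromCotensorCogen_proj_one, one_proj_eq_zero _ one_ne_zero] at this
    exact this

end GradedBialgebra

/-! ### Components of graded homomorphisms -/

section EpiMono

variable {C : Type u} [Category.{v} C] [Abelian C] [MonoidalCategory C]

theorem epi_tensorHom [AbelianMonoidal C] {V V' W W' : C} (f : V ⟶ V') (g : W ⟶ W') [Epi f]
    [Epi g] : Epi (f ⊗ₘ g) := by
  have : Epi (f ▷ W) := inferInstanceAs (Epi ((tensorRight W).map f))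
  have : Epi (V' ◁ g) := inferInstanceAs (Epi ((tensorLeft V').map g))
  rw [MonoidalCategory.tensorHom_def]
  infer_instance

theorem mono_tensorHom [CoabelianMonoidal C] {V V' W W' : C} (f : V ⟶ V') (g : W ⟶ W') [Mono f]
    [Mono g] : Mono (f ⊗ₘ g) := by
  have : Mono (f ▷ W) := inferInstanceAs (Mono ((tensorRight W).map f))
  have : Mono (V' ◁ g) := inferInstanceAs (Mono ((tensorLeft V').map g))
  rw [MonoidalCategory.tensorHom_def]
  infer_instance

end EpiMono

namespace GradedBialgebra

variable {C : Type u} [Category.{v} C] [Abelian C] [MonoidalCategory C] [BraidedCategory C]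
  [HasColimits C] [AB5 C] [AbelianMonoidal C] [TensorCommutesWithDirectSums C]
  {X Y : ℕ → C} {A : GradedBialgebra X} {B : GradedBialgebra Y} {f : A.obj ⟶ B.obj}

theorem exists_eq_comp_inj {W : C} {n : ℕ} {g : W ⟶ B.obj} (h : ∀ k, k ≠ n → g ≫ B.proj k = 0) :
    ∃ g' : W ⟶ Y n, g = g' ≫ B.inj n :=
  ⟨g ≫ B.proj n, (comp_π_eq_of_factors (X := Y) h).symm⟩

theorem comp_homComp_of_graded (hf : ∀ n, ∃ g : X n ⟶ Y n, A.inj n ≫ f = g ≫ B.inj n) (n : ℕ) :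
    A.inj n ≫ f = homComp f n ≫ B.inj n := by
  obtain ⟨g, hg⟩ := hf n
  have : homComp f n = g := by
    rw [homComp, reassoc_of% hg, inj_proj_self, Category.comp_id]
  rw [this, hg]

theorem proj_homComp_of_graded (hf : ∀ n, ∃ g : X n ⟶ Y n, A.inj n ≫ f = g ≫ B.inj n) (n : ℕ) :
    f ≫ B.proj n = A.proj n ≫ homComp f n := by
  refine A.hom_ext fun k => ?_
  rw [← Category.assoc, comp_homComp_of_graded hf, Category.assoc, ← Category.assoc (A.inj k)]
  by_cases h : k = n
  · subst h
    rw [inj_proj_self, inj_proj_self, Category.id_comp, Category.comp_id]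
  · rw [inj_proj_ne _ h, inj_proj_ne _ h, zero_comp, comp_zero]

theorem epi_homComp (hf : ∀ n, ∃ g : X n ⟶ Y n, A.inj n ≫ f = g ≫ B.inj n) [Epi f] (n : ℕ) :
    Epi (homComp f n) :=
  epi_of_epi_fac (proj_homComp_of_graded hf n).symm

theorem mono_homComp (hf : ∀ n, ∃ g : X n ⟶ Y n, A.inj n ≫ f = g ≫ B.inj n) [Mono f] (n : ℕ) :
    Mono (homComp f n) :=
  mono_of_mono_fac (comp_homComp_of_graded hf n).symm

theorem epi_of_epi_homComp (hf : ∀ n, ∃ g : X n ⟶ Y n, A.inj n ≫ f = g ≫ B.inj n)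
    (h : ∀ n, Epi (homComp f n)) : Epi f where
  left_cancellation u v huv := by
    refine B.hom_ext fun n => ?_
    rw [← cancel_epi (homComp f n), ← Category.assoc, ← Category.assoc,
      ← comp_homComp_of_graded hf, Category.assoc, Category.assoc, huv]

theorem mono_of_mono_homComp (hf : ∀ n, ∃ g : X n ⟶ Y n, A.inj n ≫ f = g ≫ B.inj n)
    (h : ∀ n, Mono (homComp f n)) : Mono f where
  right_cancellation u v huv := by
    refine A.comp_proj_ext fun n => ?_
    rw [← cancel_mono (homComp f n), Category.assoc, Category.assoc,
      ← proj_homComp_of_graded hf, ← Category.assoc, ← Category.assoc, huv]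

theorem mulComp_homComp (hf : ∀ n, ∃ g : X n ⟶ Y n, A.inj n ≫ f = g ≫ B.inj n) [IsMonHom f]
    (a b : ℕ) : A.mulComp a b ≫ homComp f (a + b) =
      (homComp f a ⊗ₘ homComp f b) ≫ B.mulComp a b := by
  rw [← cancel_mono (B.inj (a + b)), Category.assoc, Category.assoc, mulComp_inj,
    ← comp_homComp_of_graded hf, MonoidalCategory.tensorHom_comp_tensorHom_assoc,
    ← comp_homComp_of_graded hf, ← comp_homComp_of_graded hf, ← Category.assoc, mulComp_inj,
    Category.assoc, IsMonHom.mul_hom, MonoidalCategory.tensorHom_comp_tensorHom_assoc]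

theorem homComp_comulComp (hf : ∀ n, ∃ g : X n ⟶ Y n, A.inj n ≫ f = g ≫ B.inj n) [IsComonHom f]
    (a b : ℕ) : homComp f (a + b) ≫ B.comulComp a b =
      A.comulComp a b ≫ (homComp f a ⊗ₘ homComp f b) := by
  rw [← cancel_epi (A.proj (a + b)), ← Category.assoc, ← Category.assoc, proj_comulComp,
    ← proj_homComp_of_graded hf, Category.assoc, Category.assoc,
    MonoidalCategory.tensorHom_comp_tensorHom, proj_comulComp,
    ← proj_homComp_of_graded hf, ← proj_homComp_of_graded hf, IsComonHom.hom_comul_assoc,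
    MonoidalCategory.tensorHom_comp_tensorHom]

theorem StronglyGradedAlgebra.of_epi (hA : A.StronglyGradedAlgebra)
    (hf : ∀ n, ∃ g : X n ⟶ Y n, A.inj n ≫ f = g ≫ B.inj n) [IsMonHom f] [Epi f] :
    B.StronglyGradedAlgebra := fun a b => by
  have := hA a b
  have := epi_homComp hf (a + b)
  exact epi_of_epi_fac (mulComp_homComp hf a b).symm

theorem StronglyGradedCoalgebra.of_mono [CoabelianMonoidal C] (hB : B.StronglyGradedCoalgebra)
    (hf : ∀ n, ∃ g : X n ⟶ Y n, A.inj n ≫ f = g ≫ B.inj n) [IsComonHom f] [Mono f] :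
    A.StronglyGradedCoalgebra := fun a b => by
  have := hB a b
  have := mono_homComp hf (a + b)
  exact mono_of_mono_fac (homComp_comulComp hf a b).symm

/-- If `B` is strongly graded as an algebra, then it is generated in degrees `0` and `1`. -/
theorem StronglyGradedAlgebra.epi (hB : B.StronglyGradedAlgebra)
    (hf : ∀ n, ∃ g : X n ⟶ Y n, A.inj n ≫ f = g ≫ B.inj n) [IsMonHom f]
    (h0 : Epi (homComp f 0)) (h1 : Epi (homComp f 1)) : Epi f := by
  refine epi_of_epi_homComp hf fun n => ?_
  induction n with
  | zero => exact h0
  | succ n ih =>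
    have := hB n 1
    have := epi_tensorHom (homComp f n) (homComp f 1)
    have : Epi (A.mulComp n 1 ≫ homComp f (n + 1)) := by
      rw [mulComp_homComp hf]; infer_instance
    exact epi_of_epi (A.mulComp n 1) _

/-- If `A` is strongly graded as a coalgebra, then it is cogenerated in degrees `0` and `1`. -/
theorem StronglyGradedCoalgebra.mono [CoabelianMonoidal C] (hA : A.StronglyGradedCoalgebra)
    (hf : ∀ n, ∃ g : X n ⟶ Y n, A.inj n ≫ f = g ≫ B.inj n) [IsComonHom f]
    (h0 : Mono (homComp f 0)) (h1 : Mono (homComp f 1)) : Mono f := by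
  refine mono_of_mono_homComp hf fun n => ?_
  induction n with
  | zero => exact h0
  | succ n ih =>
    have := hA n 1
    have := mono_tensorHom (homComp f n) (homComp f 1)
    have : Mono (homComp f (n + 1) ≫ B.comulComp n 1) := by
      rw [homComp_comulComp hf]; infer_instance
    exact mono_of_mono _ (B.comulComp n 1)

end GradedBialgebra

/-! ### The image of a homomorphism of graded bialgebras -/

section Image

variable {C : Type u} [Category.{v} C] [Abelian C] [MonoidalCategory C] [BraidedCategory C]
  [AbelianMonoidal C]

/-- A bialgebra homomorphism `e ≫ m` with `e` an epimorphism and `m` a monomorphism factors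
through a bialgebra. -/
theorem exists_bimonObj_of_epi_mono [CoabelianMonoidal C] {E J G : C} [BimonObj E] [BimonObj G]
    (e : E ⟶ J) (m : J ⟶ G) [Epi e] [Mono m] (h : IsBimonHom (e ≫ m)) :
    ∃ _ : BimonObj J, IsBimonHom e ∧ IsBimonHom m := by
  have := epi_tensorHom e e
  have := mono_tensorHom m m
  have hmul : μ[E] ≫ e ≫ m = (e ⊗ₘ e) ≫ (m ⊗ₘ m) ≫ μ[G] := by
    rw [MonoidalCategory.tensorHom_comp_tensorHom_assoc, ← IsMonHom.mul_hom]
  have hcomul : e ≫ m ≫ Δ[G] = Δ[E] ≫ (e ⊗ₘ e) ≫ (m ⊗ₘ m) := by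
    rw [MonoidalCategory.tensorHom_comp_tensorHom, ← IsComonHom.hom_comul, Category.assoc]
  have sq1 : CommSq (μ[E] ≫ e) (e ⊗ₘ e) m ((m ⊗ₘ m) ≫ μ[G]) := ⟨by rw [Category.assoc, hmul]⟩
  have sq2 : CommSq (Δ[E] ≫ (e ⊗ₘ e)) e (m ⊗ₘ m) (m ≫ Δ[G]) := ⟨by rw [Category.assoc, hcomul]⟩
  have : StrongEpi e := strongEpi_of_epi e
  have : StrongEpi (e ⊗ₘ e) := strongEpi_of_epi _
  obtain ⟨mul, hm1, hm2⟩ : ∃ l : J ⊗ J ⟶ J, (e ⊗ₘ e) ≫ l = μ[E] ≫ e ∧ l ≫ m = (m ⊗ₘ m) ≫ μ[G] :=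
    ⟨sq1.lift, sq1.fac_left, sq1.fac_right⟩
  obtain ⟨comul, hc1, hc2⟩ : ∃ l : J ⟶ J ⊗ J, e ≫ l = Δ[E] ≫ (e ⊗ₘ e) ∧ l ≫ (m ⊗ₘ m) = m ≫ Δ[G] :=
    ⟨sq2.lift, sq2.fac_left, sq2.fac_right⟩
  have hone : (η[E] ≫ e) ≫ m = η[G] := by rw [Category.assoc, IsMonHom.one_hom]
  have hcounit : e ≫ m ≫ ε[G] = ε[E] := by rw [← Category.assoc, IsComonHom.hom_counit]
  let inst1 : MonObj J :=
    { one := η[E] ≫ e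
      mul := mul
      one_mul := by
        rw [← cancel_mono m, Category.assoc, hm2, whiskerRight_comp_tensorHom_assoc, hone,
          MonObj.one_mul_hom]
      mul_one := by
        rw [← cancel_mono m, Category.assoc, hm2, whiskerLeft_comp_tensorHom_assoc, hone,
          MonObj.mul_one_hom]
      mul_assoc := by
        rw [← cancel_mono m]
        simp only [Category.assoc]
        rw [hm2, whiskerRight_comp_tensorHom_assoc, whiskerLeft_comp_tensorHom_assoc, hm2,
          ← tensorHom_comp_whiskerRight_assoc, ← tensorHom_comp_whiskerLeft_assoc,
          MonObj.mul_assoc, MonoidalCategory.associator_naturality_assoc] }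
  let inst2 : ComonObj J :=
    { counit := m ≫ ε[G]
      comul := comul
      counit_comul := by
        rw [← cancel_epi e, reassoc_of% hc1, tensorHom_comp_whiskerRight, hcounit,
          ComonObj.counit_comul_hom]
      comul_counit := by
        rw [← cancel_epi e, reassoc_of% hc1, tensorHom_comp_whiskerLeft, hcounit,
          ComonObj.comul_counit_hom]
      comul_assoc := by
        rw [← cancel_epi e, reassoc_of% hc1, reassoc_of% hc1, tensorHom_comp_whiskerRight_assoc,
          tensorHom_comp_whiskerLeft, hc1, ← whiskerRight_comp_tensorHom_assoc,
          ← whiskerLeft_comp_tensorHom, MonoidalCategory.associator_naturality,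
          ComonObj.comul_assoc_assoc] }
  let inst3 : BimonObj J :=
    { mul_comul := by
        change mul ≫ comul = (comul ⊗ₘ comul) ≫ tensorμ J J J J ≫ (mul ⊗ₘ mul)
        rw [← cancel_mono (m ⊗ₘ m)]
        simp only [Category.assoc]
        rw [hc2, reassoc_of% hm2, BimonObj.mul_comul, MonoidalCategory.tensorHom_comp_tensorHom,
          hm2, ← MonoidalCategory.tensorHom_comp_tensorHom, ← tensorμ_natural_assoc,
          MonoidalCategory.tensorHom_comp_tensorHom_assoc,
          MonoidalCategory.tensorHom_comp_tensorHom_assoc, hc2]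
      one_comul := by
        change (η[E] ≫ e) ≫ comul = η[J ⊗ J]
        rw [Category.assoc, hc1, BimonObj.one_comul_assoc, MonObj.tensorObj.one_def,
          MonObj.tensorObj.one_def, Category.assoc, MonoidalCategory.tensorHom_comp_tensorHom]
        rfl
      mul_counit := by
        change mul ≫ m ≫ ε[G] = (m ≫ ε[G] ⊗ₘ m ≫ ε[G]) ≫ (λ_ (𝟙_ C)).hom
        rw [reassoc_of% hm2, BimonObj.mul_counit, Comon.tensorObj_counit,
          MonoidalCategory.tensorHom_comp_tensorHom_assoc]
      one_counit := by
        change (η[E] ≫ e) ≫ m ≫ ε[G] = 𝟙 _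
        rw [← Category.assoc, hone, BimonObj.one_counit] }
  exact ⟨inst3, { one_hom := rfl, mul_hom := hm1.symm, hom_counit := hcounit, hom_comul := hc1 },
    { one_hom := hone, mul_hom := hm2, hom_counit := rfl, hom_comul := hc2.symm }⟩

theorem IsMonHom.of_epi_comp {E J G : C} [MonObj E] [MonObj J] [MonObj G] {e : E ⟶ J} {m : J ⟶ G}
    [Epi e] (he : IsMonHom e) (h : IsMonHom (e ≫ m)) : IsMonHom m where
  one_hom := by rw [← he.one_hom, Category.assoc, h.one_hom]
  mul_hom := by
    have := epi_tensorHom e e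
    rw [← cancel_epi (e ⊗ₘ e), ← IsMonHom.mul_hom_assoc, IsMonHom.mul_hom,
      MonoidalCategory.tensorHom_comp_tensorHom_assoc]

theorem IsComonHom.of_epi_comp {E J G : C} [ComonObj E] [ComonObj J] [ComonObj G] {e : E ⟶ J}
    {m : J ⟶ G} [Epi e] (he : IsComonHom e) (h : IsComonHom (e ≫ m)) : IsComonHom m where
  hom_counit := by
    rw [← cancel_epi e, he.hom_counit, ← Category.assoc, h.hom_counit]
  hom_comul := by
    rw [← cancel_epi e, IsComonHom.hom_comul_assoc, MonoidalCategory.tensorHom_comp_tensorHom,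
      ← Category.assoc, h.hom_comul]

end Image

namespace GradedBialgebra

variable {C : Type u} [Category.{v} C] [Abelian C] [MonoidalCategory C] [BraidedCategory C]
  [HasColimits C] [AB5 C] [AbelianMonoidal C] [TensorCommutesWithDirectSums C]
  {X Y : ℕ → C} {A : GradedBialgebra X} {B : GradedBialgebra Y} {f : A.obj ⟶ B.obj}

section Comparison

variable (f) in
/-- The epimorphism `A_n ⟶ Im(f_n)`. -/
noncomputable def toImComp (n : ℕ) : X n ⟶ imComp f n := factorThruImage (homComp f n)

variable (f) in
/-- The monomorphism `Im(f_n) ⟶ B_n`. -/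
noncomputable def imCompι (n : ℕ) : imComp f n ⟶ Y n := image.ι (homComp f n)

instance (n : ℕ) : Epi (toImComp f n) := inferInstanceAs (Epi (factorThruImage (homComp f n)))

instance (n : ℕ) : Mono (imCompι f n) := inferInstanceAs (Mono (image.ι (homComp f n)))

theorem toImComp_imCompι (n : ℕ) : toImComp f n ≫ imCompι f n = homComp f n := image.fac _

variable (f) in
/-- The morphism `φ_f` to the image, as a morphism to a direct sum. -/
noncomputable def toSigmaIm : A.obj ⟶ ∐ imComp f :=
  Limits.Sigma.map (f := X) (toImComp f)

variable (f) in
/-- The morphism `ψ_f` from the image, as a morphism from a direct sum. -/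
noncomputable def fromSigmaIm : (∐ imComp f) ⟶ B.obj :=
  Limits.Sigma.map (g := Y) (imCompι f)

theorem inj_toSigmaIm (n : ℕ) :
    A.inj n ≫ toSigmaIm f = toImComp f n ≫ Sigma.ι (imComp f) n :=
  Sigma.ι_map _ _

theorem ι_fromSigmaIm (n : ℕ) :
    Sigma.ι (imComp f) n ≫ fromSigmaIm f = imCompι f n ≫ B.inj n :=
  Sigma.ι_map _ _

theorem toSigmaIm_π (n : ℕ) : toSigmaIm f ≫ Sigma.π (imComp f) n = A.proj n ≫ toImComp f n := by
  refine A.hom_ext fun k => ?_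
  rw [← Category.assoc, inj_toSigmaIm, Category.assoc, ← Category.assoc (A.inj k)]
  by_cases h : k = n
  · subst h
    rw [Sigma.ι_π_eq_id, inj_proj_self, Category.id_comp, Category.comp_id]
  · rw [Sigma.ι_π_of_ne _ h, inj_proj_ne _ h, zero_comp, comp_zero]

theorem fromSigmaIm_proj (n : ℕ) :
    fromSigmaIm f ≫ B.proj n = Sigma.π (imComp f) n ≫ imCompι f n := by
  refine Sigma.hom_ext _ _ fun k => ?_
  rw [← Category.assoc, ι_fromSigmaIm, Category.assoc, ← Category.assoc (Sigma.ι _ k)]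
  by_cases h : k = n
  · subst h
    rw [Sigma.ι_π_eq_id, inj_proj_self, Category.id_comp, Category.comp_id]
  · rw [Sigma.ι_π_of_ne _ h, inj_proj_ne _ h, zero_comp, comp_zero]

instance : Epi (toSigmaIm f) where
  left_cancellation u v huv := by
    refine Sigma.hom_ext _ _ fun n => ?_
    rw [← cancel_epi (toImComp f n), ← Category.assoc, ← Category.assoc, ← inj_toSigmaIm,
      Category.assoc, Category.assoc, huv]

instance : Mono (fromSigmaIm f) where
  right_cancellation u v huv := by
    refine sigma_comp_π_ext fun n => ?_
    rw [← cancel_mono (imCompι f n), Category.assoc, Category.assoc, ← fromSigmaIm_proj,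
      ← Category.assoc, ← Category.assoc, huv]

theorem toSigmaIm_fromSigmaIm (hf : ∀ n, ∃ g : X n ⟶ Y n, A.inj n ≫ f = g ≫ B.inj n) :
    toSigmaIm f ≫ fromSigmaIm f = f := by
  refine A.hom_ext fun n => ?_
  rw [reassoc_of% (inj_toSigmaIm (f := f) n), ι_fromSigmaIm, comp_homComp_of_graded hf,
    ← Category.assoc, toImComp_imCompι]

/-- The image of a homomorphism of graded bialgebras is a graded bialgebra. -/
theorem exists_isImageBialgebra [CoabelianMonoidal C] (hf : IsGradedHom f) :
    ∃ I : GradedBialgebra (imComp f), IsImageBialgebra f I := by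
  obtain ⟨inst, he, hm⟩ := exists_bimonObj_of_epi_mono (toSigmaIm f) (fromSigmaIm f)
    (by rw [toSigmaIm_fromSigmaIm hf.graded]; exact hf.isBimonHom)
  refine ⟨ofHomog (fun n a b h => ?_) (fun n a b h => ?_), ⟨he, fun n => ⟨_, inj_toSigmaIm n⟩⟩,
    ⟨hm, fun n => ⟨_, ι_fromSigmaIm n⟩⟩⟩
  · have := epi_tensorHom (toImComp f a) (toImComp f b)
    rw [← cancel_epi (toImComp f a ⊗ₘ toImComp f b),
      MonoidalCategory.tensorHom_comp_tensorHom_assoc, ← inj_toSigmaIm, ← inj_toSigmaIm,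
      ← MonoidalCategory.tensorHom_comp_tensorHom_assoc, ← IsMonHom.mul_hom_assoc, toSigmaIm_π,
      reassoc_of% (A.inj_mul_proj_eq_zero h), zero_comp, comp_zero]
  · rw [← cancel_epi (toImComp f n), Category.assoc, ← reassoc_of% (inj_toSigmaIm (f := f) n),
      IsComonHom.hom_comul_assoc, MonoidalCategory.tensorHom_comp_tensorHom, toSigmaIm_π,
      toSigmaIm_π, ← MonoidalCategory.tensorHom_comp_tensorHom,
      reassoc_of% (A.inj_comul_proj_eq_zero h), zero_comp, comp_zero]

variable (I : GradedBialgebra (imComp f))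

instance : Epi (toIm f I) := inferInstanceAs (Epi (toSigmaIm f))

instance : Mono (fromIm f I) := inferInstanceAs (Mono (fromSigmaIm f))

theorem toIm_fromIm (hf : ∀ n, ∃ g : X n ⟶ Y n, A.inj n ≫ f = g ≫ B.inj n) :
    toIm f I ≫ fromIm f I = f :=
  toSigmaIm_fromSigmaIm hf

theorem IsImageBialgebra.unique {I I' : GradedBialgebra (imComp f)} (h : IsImageBialgebra f I)
    (h' : IsImageBialgebra f I') : I = I' := by
  have e := h.toIm_hom.isBimonHom
  have e' := h'.toIm_hom.isBimonHom
  have := epi_tensorHom (toIm f I) (toIm f I)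
  refine ext_of_eq ?_ ?_ ?_ ?_
  · exact (cancel_epi (toIm f I ⊗ₘ toIm f I)).1 (e.mul_hom.symm.trans e'.mul_hom)
  · exact e.one_hom.symm.trans e'.one_hom
  · exact (cancel_epi (toIm f I)).1 (e.hom_comul.trans e'.hom_comul.symm)
  · exact (cancel_epi (toIm f I)).1 (e.hom_counit.trans e'.hom_counit.symm)

end Comparison

end GradedBialgebra

/-! ### Universal properties of the tensor bialgebra and of the cotensor bialgebra -/

namespace GradedBialgebra

open RelTensor

variable {C : Type u} [Category.{v} C] [Abelian C] [MonoidalCategory C] [BraidedCategory C]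
  [HasColimits C] [AB5 C] [AbelianMonoidal C] [TensorCommutesWithDirectSums C]
  {X Y : ℕ → C} {A : GradedBialgebra Y} {B : GradedBialgebra X}

theorem inj_zero_comul : B.inj 0 ≫ Δ = B.comulComp 0 0 ≫ (B.inj 0 ⊗ₘ B.inj 0) := by
  refine (B.homogIn_comul 0).eq_sum.trans ?_
  simp only [Finset.Nat.antidiagonal_zero, Finset.sum_singleton]
  exact congrArg (· ≫ (B.inj 0 ⊗ₘ B.inj 0)) (Category.assoc _ _ _)

theorem inj_one_comul : B.inj 1 ≫ Δ =
    B.comulComp 0 1 ≫ (B.inj 0 ⊗ₘ B.inj 1) + B.comulComp 1 0 ≫ (B.inj 1 ⊗ₘ B.inj 0) := by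
  refine (B.homogIn_comul 1).eq_sum.trans ?_
  rw [Finset.Nat.antidiagonal_succ]
  simp only [Finset.Nat.antidiagonal_zero, Finset.map_singleton, Finset.sum_cons,
    Finset.sum_singleton]
  exact congrArg₂ (· + ·) (congrArg (· ≫ (B.inj 0 ⊗ₘ B.inj 1)) (Category.assoc _ _ _))
    (congrArg (· ≫ (B.inj 1 ⊗ₘ B.inj 0)) (Category.assoc _ _ _))

theorem mul_proj_zero : μ ≫ B.proj 0 = (B.proj 0 ⊗ₘ B.proj 0) ≫ B.mulComp 0 0 := by
  refine (B.homogOut_mul 0).eq_sum.trans ?_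
  simp only [Finset.Nat.antidiagonal_zero, Finset.sum_singleton]
  rfl

theorem mul_proj_one : μ ≫ B.proj 1 =
    (B.proj 0 ⊗ₘ B.proj 1) ≫ B.mulComp 0 1 + (B.proj 1 ⊗ₘ B.proj 0) ≫ B.mulComp 1 0 := by
  refine (B.homogOut_mul 1).eq_sum.trans ?_
  rw [Finset.Nat.antidiagonal_succ]
  simp only [Finset.Nat.antidiagonal_zero, Finset.map_singleton, Finset.sum_cons,
    Finset.sum_singleton]
  rfl

section Tensor

variable {T T' : GradedBialgebra B.tensorPow}

/-- The algebra underlying a graded bialgebra on the tensor powers. -/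
noncomputable abbrev tensorMonObj (T : GradedBialgebra B.tensorPow) : MonObj (∐ B.tensorPow) :=
  inferInstanceAs (MonObj T.obj)

theorem IsTensorBialgebra.isTensorAlg (hT : IsTensorBialgebra T) :
    letI := tensorMonObj T; IsTensorAlg B :=
  letI := tensorMonObj T
  { ι_mul := fun a b => by
      have := T.mulComp_inj a b
      rw [hT.mulComp_eq] at this
      exact this.symm
    one_eq := hT.unit_eq }

theorem IsTensorBialgebra.exists_lift (hT : IsTensorBialgebra T) {E : C} [MonObj E]
    {κ : B.obj ⟶ E} (hκ : LowMul B κ) : ∃ f : T.obj ⟶ E, IsMonHom f ∧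
      tensorInjZero T ≫ f = B.inj 0 ≫ κ ∧ tensorInjOne T ≫ f = B.inj 1 ≫ κ := by
  let inst := tensorMonObj T
  obtain ⟨f, hf, h⟩ := hκ.exists_lift hT.isTensorAlg
  have h0 := h 0 (by omega)
  have h1 := h 1 (by omega)
  rw [← Category.assoc, inj_zero_toTensorGen] at h0
  rw [← Category.assoc, inj_one_toTensorGen] at h1
  exact ⟨f, hf, h0, h1⟩

theorem IsTensorBialgebra.hom_ext (hT : IsTensorBialgebra T) {E : C} [MonObj E]
    {f g : T.obj ⟶ E} (hf : IsMonHom f) (hg : IsMonHom g)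
    (h0 : tensorInjZero T ≫ f = tensorInjZero T ≫ g)
    (h1 : tensorInjOne T ≫ f = tensorInjOne T ≫ g) : f = g := by
  let inst := tensorMonObj T
  exact IsTensorAlgebra.hom_ext (M := B.bimodOne) hT.isTensorAlg hf hg h0 h1

/-- An algebra homomorphism on the tensor bialgebra is a bialgebra homomorphism if it is
compatible with the coalgebra structures on generators. -/
theorem IsTensorBialgebra.isBimonHom (hT : IsTensorBialgebra T) {E : C} [BimonObj E]
    {f : T.obj ⟶ E} (hf : IsMonHom f)
    (hc0 : tensorInjZero T ≫ f ≫ ε = tensorInjZero T ≫ ε)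
    (hc1 : tensorInjOne T ≫ f ≫ ε = tensorInjOne T ≫ ε)
    (h0 : tensorInjZero T ≫ f ≫ Δ = tensorInjZero T ≫ Δ ≫ (f ⊗ₘ f))
    (h1 : tensorInjOne T ≫ f ≫ Δ = tensorInjOne T ≫ Δ ≫ (f ⊗ₘ f)) : IsBimonHom f :=
  have := isMonHom_counit (E := E)
  have := isMonHom_counit (E := T.obj)
  have := isMonHom_comul (E := E)
  have := isMonHom_comul (E := T.obj)
  { one_hom := hf.one_hom
    mul_hom := hf.mul_hom
    hom_counit := hT.hom_ext inferInstance inferInstance hc0 hc1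
    hom_comul := hT.hom_ext inferInstance inferInstance h0 h1 }

theorem IsTensorBialgebra.unique (hT : IsTensorBialgebra T) (hT' : IsTensorBialgebra T') :
    T = T' := by
  -- The identity is an algebra homomorphism, hence a bialgebra homomorphism.
  let i : T.obj ⟶ T'.obj := 𝟙 (∐ B.tensorPow)
  have hi : i ⊗ₘ i = 𝟙 ((∐ B.tensorPow) ⊗ (∐ B.tensorPow)) := MonoidalCategory.id_tensorHom_id _ _
  have hi0 : tensorInjZero T ≫ i = tensorInjZero T' := Category.comp_id _
  have hi1 : tensorInjOne T ≫ i = tensorInjOne T' := Category.comp_id _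
  have e : IsMonHom i :=
    { one_hom := by
        rw [hT.unit_eq, hT'.unit_eq, Category.assoc, hi0]
      mul_hom := T.tensor_hom_ext T fun a b => by
        have e1 (n : ℕ) : T.inj n ≫ i = T'.inj n := Category.comp_id _
        rw [← Category.assoc, ← mulComp_inj, Category.assoc, e1,
          MonoidalCategory.tensorHom_comp_tensorHom_assoc, e1, e1, ← mulComp_inj, hT.mulComp_eq,
          hT'.mulComp_eq] }
  have e := hT.isBimonHom e
    (by rw [← Category.assoc, hi0, hT.counit_zero, hT'.counit_zero])
    (by rw [← Category.assoc, hi1, hT.counit_one, hT'.counit_one])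
    (by rw [← Category.assoc, hi0, ← Category.assoc, hT.comul_zero, hT'.comul_zero,
      Category.assoc, MonoidalCategory.tensorHom_comp_tensorHom, hi0])
    (by rw [← Category.assoc, hi1, ← Category.assoc, hT.comul_one, hT'.comul_one,
      Preadditive.add_comp, Category.assoc, Category.assoc,
      MonoidalCategory.tensorHom_comp_tensorHom, MonoidalCategory.tensorHom_comp_tensorHom,
      hi0, hi1])
  refine ext_of_eq ?_ ?_ ?_ ?_
  · refine (Category.comp_id _).symm.trans (e.mul_hom.trans ?_)
    rw [hi]; exact Category.id_comp _
  · exact (Category.comp_id _).symm.trans e.one_hom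
  · refine (Category.comp_id _).symm.trans
      (Eq.trans ?_ (e.hom_comul.symm.trans (Category.id_comp _)))
    rw [hi]; rfl
  · exact e.hom_counit.symm.trans (Category.id_comp _)

theorem IsTensorBialgebra.stronglyGraded (hT : IsTensorBialgebra T) :
    T.StronglyGradedAlgebra := fun a b => by
  rw [hT.mulComp_eq]
  exact epi_relMul B.bimodOne a b

theorem IsTensorBialgebra.existsUnique_lift (hT : IsTensorBialgebra T) :
    ∃! φ : T.obj ⟶ B.obj, IsTensorLift T φ := by
  obtain ⟨φ, hφ, h0, h1⟩ := hT.exists_lift (lowMul_of_isMonHom (𝟙 B.obj))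
  rw [Category.comp_id] at h0 h1
  refine ⟨φ, ⟨hφ, h0, h1⟩, fun φ' h' => ?_⟩
  exact hT.hom_ext h'.isMonHom hφ (h'.inj_zero.trans h0.symm) (h'.inj_one.trans h1.symm)

/-- An algebra homomorphism on the tensor bialgebra is graded if it preserves the degrees of the
generators. -/
theorem IsTensorBialgebra.graded (hT : IsTensorBialgebra T) {f : T.obj ⟶ A.obj} (hf : IsMonHom f)
    (h0 : ∃ g, tensorInjZero T ≫ f = g ≫ A.inj 0) (h1 : ∃ g, tensorInjOne T ≫ f = g ≫ A.inj 1)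
    (n : ℕ) : ∃ g : B.tensorPow n ⟶ Y n, T.inj n ≫ f = g ≫ A.inj n := by
  induction n with
  | zero => exact h0
  | succ n ih =>
    obtain ⟨g, hg⟩ := ih
    obtain ⟨g', hg'⟩ : ∃ g' : B.tensorPow 1 ⟶ Y 1, T.inj 1 ≫ f = g' ≫ A.inj 1 := h1
    refine exists_eq_comp_inj fun k hk => ?_
    have := hT.stronglyGraded n 1
    rw [← cancel_epi (T.mulComp n 1), ← Category.assoc, ← Category.assoc, mulComp_inj,
      Category.assoc, Category.assoc, IsMonHom.mul_hom_assoc,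
      MonoidalCategory.tensorHom_comp_tensorHom_assoc, hg, hg',
      ← MonoidalCategory.tensorHom_comp_tensorHom, Category.assoc,
      A.inj_mul_proj_eq_zero hk.symm, comp_zero, comp_zero]

/-- The algebra homomorphism `φ : T ⟶ B` is a homomorphism of graded bialgebras. -/
theorem IsTensorLift.isGradedHom (hT : IsTensorBialgebra T) {φ : T.obj ⟶ B.obj}
    (hφ : IsTensorLift T φ) : IsGradedHom φ where
  isBimonHom := by
    have h0 := hφ.inj_zero
    have h1 := hφ.inj_one
    refine hT.isBimonHom hφ.isMonHom ?_ ?_ ?_ ?_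
    · rw [← Category.assoc, h0, hT.counit_zero, counitZero]
    · rw [← Category.assoc, h1, hT.counit_one, inj_counit_eq_zero _ one_ne_zero]
    · rw [← Category.assoc, h0, ← Category.assoc, hT.comul_zero, inj_zero_comul,
        Category.assoc, MonoidalCategory.tensorHom_comp_tensorHom, h0]
    · rw [← Category.assoc, h1, ← Category.assoc, hT.comul_one, inj_one_comul,
        Preadditive.add_comp, Category.assoc, Category.assoc,
        MonoidalCategory.tensorHom_comp_tensorHom, MonoidalCategory.tensorHom_comp_tensorHom,
        h0, h1]
  graded := hT.graded hφ.isMonHom ⟨𝟙 _, by rw [Category.id_comp, hφ.inj_zero]⟩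
    ⟨𝟙 _, by rw [Category.id_comp, hφ.inj_one]⟩

end Tensor

section Cotensor

variable [CoabelianMonoidal C] {T T' : GradedBialgebra B.cotensorPow}

/-- The coalgebra underlying a graded bialgebra on the cotensor powers. -/
noncomputable abbrev cotensorComonObj (T : GradedBialgebra B.cotensorPow) :
    ComonObj (∐ B.cotensorPow) :=
  inferInstanceAs (ComonObj T.obj)

theorem IsCotensorBialgebra.isCotensorCoalg (hT : IsCotensorBialgebra T) :
    letI := cotensorComonObj T; IsCotensorCoalg B :=
  letI := cotensorComonObj T
  { comul_π := fun a b => by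
      have := T.proj_comulComp a b
      rw [hT.comulComp_eq] at this
      exact this.symm
    counit_eq := hT.counit_eq }

theorem IsCotensorBialgebra.hom_ext (hT : IsCotensorBialgebra T) {E : C} [ComonObj E]
    {f g : E ⟶ T.obj} (hf : IsComonHom f) (hg : IsComonHom g)
    (h0 : f ≫ cotensorProjZero T = g ≫ cotensorProjZero T)
    (h1 : f ≫ cotensorProjOne T = g ≫ cotensorProjOne T) : f = g := by
  let inst := cotensorComonObj T
  exact IsCotensorCoalgebra.hom_ext (N := B.bicomodOne) hT.isCotensorCoalg hf hg h0 h1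

attribute [local instance] ComonObj.instTensorUnit in
/-- A coalgebra homomorphism to the cotensor bialgebra is a bialgebra homomorphism if it is
compatible with the algebra structures on cogenerators. -/
theorem IsCotensorBialgebra.isBimonHom (hT : IsCotensorBialgebra T) {E : GradedBialgebra Y}
    {f : E.obj ⟶ T.obj} (hf : IsComonHom f)
    (hc0 : η ≫ f ≫ cotensorProjZero T = η ≫ cotensorProjZero T)
    (hc1 : η ≫ f ≫ cotensorProjOne T = η ≫ cotensorProjOne T)
    (h0 : μ ≫ f ≫ cotensorProjZero T = (f ⊗ₘ f) ≫ μ ≫ cotensorProjZero T)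
    (h1 : μ ≫ f ≫ cotensorProjOne T = (f ⊗ₘ f) ≫ μ ≫ cotensorProjOne T) : IsBimonHom f := by
  have i1 := isComonHom_one (E := E.obj)
  have i2 := isComonHom_one (E := T.obj)
  have i3 := isComonHom_mul (E := E.obj)
  have i4 := isComonHom_mul (E := T.obj)
  have i5 := isComonHom_tensorHom f hf f hf
  exact
  { hom_counit := hf.hom_counit
    hom_comul := hf.hom_comul
    one_hom := hT.hom_ext inferInstance inferInstance
      ((Category.assoc _ _ _).trans hc0) ((Category.assoc _ _ _).trans hc1)
    mul_hom := hT.hom_ext inferInstance inferInstance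
      ((Category.assoc _ _ _).trans (h0.trans (Category.assoc _ _ _).symm))
      ((Category.assoc _ _ _).trans (h1.trans (Category.assoc _ _ _).symm)) }

theorem IsCotensorBialgebra.unique (hT : IsCotensorBialgebra T) (hT' : IsCotensorBialgebra T') :
    T = T' := by
  -- The identity is a coalgebra homomorphism, hence a bialgebra homomorphism.
  let i : T.obj ⟶ T'.obj := 𝟙 (∐ B.cotensorPow)
  have hi : i ⊗ₘ i = 𝟙 ((∐ B.cotensorPow) ⊗ (∐ B.cotensorPow)) :=
    MonoidalCategory.id_tensorHom_id _ _
  have hi0 : i ≫ cotensorProjZero T' = cotensorProjZero T := Category.id_comp _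
  have hi1 : i ≫ cotensorProjOne T' = cotensorProjOne T := Category.id_comp _
  have e : IsComonHom i :=
    { hom_counit := by
        rw [hT.counit_eq, hT'.counit_eq, ← Category.assoc, hi0]
      hom_comul := T'.comp_proj_tensor_ext T' fun a b => by
        have e1 (n : ℕ) : i ≫ T'.proj n = T.proj n := Category.id_comp _
        rw [Category.assoc, Category.assoc, ← proj_comulComp, ← Category.assoc, e1,
          MonoidalCategory.tensorHom_comp_tensorHom, e1, e1, ← proj_comulComp, hT.comulComp_eq,
          hT'.comulComp_eq] }
  have e := hT'.isBimonHom e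
    (by rw [hi0, hT.unit_zero, hT'.unit_zero])
    (by rw [hi1, hT.unit_one, hT'.unit_one])
    (by rw [hi0, hT.mul_zero, hT'.mul_zero, ← Category.assoc,
      MonoidalCategory.tensorHom_comp_tensorHom, hi0])
    (by rw [hi1, hT.mul_one, hT'.mul_one, Preadditive.comp_add, ← Category.assoc,
      ← Category.assoc, MonoidalCategory.tensorHom_comp_tensorHom,
      MonoidalCategory.tensorHom_comp_tensorHom, hi0, hi1])
  refine ext_of_eq ?_ ?_ ?_ ?_
  · refine (Category.comp_id _).symm.trans (e.mul_hom.trans ?_)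
    rw [hi]; exact Category.id_comp _
  · exact (Category.comp_id _).symm.trans e.one_hom
  · refine (Category.comp_id _).symm.trans
      (Eq.trans ?_ (e.hom_comul.symm.trans (Category.id_comp _)))
    rw [hi]; rfl
  · exact e.hom_counit.symm.trans (Category.id_comp _)

theorem IsCotensorBialgebra.stronglyGraded (hT : IsCotensorBialgebra T) :
    T.StronglyGradedCoalgebra := fun a b => by
  rw [hT.comulComp_eq]
  exact mono_corelComul B.bicomodOne a b

theorem IsCotensorBialgebra.existsUnique_lift (hT : IsCotensorBialgebra T) :
    ∃! ψ : B.obj ⟶ T.obj, IsCotensorLift T ψ := by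
  let inst := cotensorComonObj T
  obtain ⟨ψ, hψ, h, -⟩ := (lowComul_of_isComonHom (𝟙 B.obj)).exists_lift hT.isCotensorCoalg
    B.comonGrading
    (fun s hs => by rw [Category.id_comp]; exact B.inj_proj_ne hs)
    (fun s hs => by rw [Category.id_comp]; exact B.inj_proj_ne hs)
  have h0 := h 0 (by omega)
  have h1 := h 1 (by omega)
  rw [fromCotensorCogen_proj_zero, Category.id_comp] at h0
  rw [fromCotensorCogen_proj_one, Category.id_comp] at h1
  refine ⟨ψ, ⟨hψ, h0, h1⟩, fun ψ' h' => ?_⟩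
  exact hT.hom_ext h'.isComonHom hψ (h'.proj_zero.trans h0.symm) (h'.proj_one.trans h1.symm)

/-- A coalgebra homomorphism to the cotensor bialgebra is graded if its components in degrees `0`
and `1` are. -/
theorem IsCotensorBialgebra.graded (hT : IsCotensorBialgebra T) {f : A.obj ⟶ T.obj}
    (hf : IsComonHom f) (h0 : ∀ k ≠ 0, A.inj k ≫ f ≫ cotensorProjZero T = 0)
    (h1 : ∀ k ≠ 1, A.inj k ≫ f ≫ cotensorProjOne T = 0) (n : ℕ) :
    ∃ g : Y n ⟶ B.cotensorPow n, A.inj n ≫ f = g ≫ T.inj n := by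
  have key (n : ℕ) : ∀ k ≠ n, A.inj k ≫ f ≫ T.proj n = 0 := by
    induction n with
    | zero => exact h0
    | succ n ih =>
      intro k hk
      have h1' : ∀ k ≠ 1, A.inj k ≫ f ≫ T.proj 1 = 0 := h1
      have := hT.stronglyGraded n 1
      rw [← cancel_mono (T.comulComp n 1), Category.assoc, Category.assoc, proj_comulComp,
        zero_comp, IsComonHom.hom_comul_assoc, MonoidalCategory.tensorHom_comp_tensorHom,
        A.comul_congr (g := 0), comp_zero, comp_zero]
      intro a b hab
      rw [MonoidalCategory.tensorHom_comp_tensorHom, comp_zero]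
      by_cases ha : a = n
      · rw [h1' b (by omega), MonoidalPreadditive.tensor_zero]
      · rw [ih a ha, MonoidalPreadditive.zero_tensor]
  refine exists_eq_comp_inj fun k hk => ?_
  rw [Category.assoc, key k n hk.symm]

/-- The coalgebra homomorphism `ψ : B ⟶ T^c` is a homomorphism of graded bialgebras. -/
theorem IsCotensorLift.isGradedHom (hT : IsCotensorBialgebra T) {ψ : B.obj ⟶ T.obj}
    (hψ : IsCotensorLift T ψ) : IsGradedHom ψ where
  isBimonHom := by
    have h0 := hψ.proj_zero
    have h1 := hψ.proj_one
    refine hT.isBimonHom hψ.isComonHom ?_ ?_ ?_ ?_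
    · rw [h0, hT.unit_zero, unitZero]
    · rw [h1, hT.unit_one, one_proj_eq_zero _ one_ne_zero]
    · rw [h0, hT.mul_zero, mul_proj_zero, ← Category.assoc,
        MonoidalCategory.tensorHom_comp_tensorHom, h0]
    · rw [h1, hT.mul_one, mul_proj_one, Preadditive.comp_add, ← Category.assoc,
        ← Category.assoc, MonoidalCategory.tensorHom_comp_tensorHom,
        MonoidalCategory.tensorHom_comp_tensorHom, h0, h1]
  graded := hT.graded hψ.isComonHom
    (fun k hk => by rw [hψ.proj_zero, inj_proj_ne _ hk])
    (fun k hk => by rw [hψ.proj_one, inj_proj_ne _ hk])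

end Cotensor

end GradedBialgebra

/-! ### The characterization of bialgebras of type one -/

namespace GradedBialgebra

variable {C : Type u} [Category.{v} C] [Abelian C] [MonoidalCategory C] [BraidedCategory C]
  [HasColimits C] [AB5 C] [AbelianMonoidal C] [CoabelianMonoidal C]
  [TensorCommutesWithDirectSums C] {X Y Z : ℕ → C} {A : GradedBialgebra X} {B : GradedBialgebra Y}
  {D : GradedBialgebra Z}

theorem IsGradedHom.comp {f : A.obj ⟶ B.obj} {g : B.obj ⟶ D.obj} (hf : IsGradedHom f)
    (hg : IsGradedHom g) : IsGradedHom (f ≫ g) where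
  isBimonHom := by
    have := hf.isBimonHom
    have := hg.isBimonHom
    exact { one_hom := by rw [← Category.assoc, IsMonHom.one_hom, IsMonHom.one_hom]
            mul_hom := by
              rw [IsMonHom.mul_hom_assoc, IsMonHom.mul_hom,
                MonoidalCategory.tensorHom_comp_tensorHom_assoc]
            hom_counit := by rw [Category.assoc, IsComonHom.hom_counit, IsComonHom.hom_counit]
            hom_comul := by
              rw [Category.assoc, IsComonHom.hom_comul, IsComonHom.hom_comul_assoc,
                MonoidalCategory.tensorHom_comp_tensorHom] }
  graded n := by
    obtain ⟨u, hu⟩ := hf.graded n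
    obtain ⟨w, hw⟩ := hg.graded n
    exact ⟨u ≫ w, by rw [reassoc_of% hu, hw, Category.assoc]⟩

/-- If `f ≫ g` and the epimorphism `f` are homomorphisms of graded bialgebras, then so is `g`. -/
theorem IsGradedHom.of_epi_comp {f : A.obj ⟶ B.obj} {g : B.obj ⟶ D.obj} [Epi f]
    (hf : IsGradedHom f) (h : IsGradedHom (f ≫ g)) : IsGradedHom g where
  isBimonHom :=
    { IsMonHom.of_epi_comp hf.isBimonHom.toIsMonHom h.isBimonHom.toIsMonHom,
      IsComonHom.of_epi_comp hf.isBimonHom.toIsComonHom h.isBimonHom.toIsComonHom with }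
  graded n := by
    refine exists_eq_comp_inj fun k hk => ?_
    have := epi_homComp hf.graded n
    obtain ⟨w, hw⟩ := h.graded n
    rw [← cancel_epi (homComp f n), ← Category.assoc, ← Category.assoc,
      ← comp_homComp_of_graded hf.graded, Category.assoc (A.inj n), hw, Category.assoc,
      inj_proj_ne _ hk.symm, comp_zero, comp_zero]

/-- Strong gradings are invariant under isomorphism of graded bialgebras. -/
theorem StronglyGradedAlgebra.of_iso (hB : B.StronglyGradedAlgebra) (θ : A.obj ≅ B.obj)
    (hθ : IsGradedHom θ.hom) : A.StronglyGradedAlgebra := fun a b => by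
  have := hB a b
  have := hθ.isBimonHom
  have (n : ℕ) := epi_homComp hθ.graded n
  have (n : ℕ) := mono_homComp hθ.graded n
  have := epi_tensorHom (homComp θ.hom a) (homComp θ.hom b)
  have := isIso_of_mono_of_epi (homComp θ.hom (a + b))
  rw [(IsIso.eq_comp_inv (homComp θ.hom (a + b))).2 (mulComp_homComp hθ.graded a b)]
  infer_instance

section Main

variable {T : GradedBialgebra B.tensorPow} {Tc : GradedBialgebra B.cotensorPow}
  {φ : T.obj ⟶ B.obj} {ψ : B.obj ⟶ Tc.obj} {F : T.obj ⟶ Tc.obj}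

theorem isTensorToCotensor_comp (hT : IsTensorBialgebra T) (hTc : IsCotensorBialgebra Tc)
    (hφ : IsTensorLift T φ) (hψ : IsCotensorLift Tc ψ) : IsTensorToCotensor T Tc (φ ≫ ψ) where
  isMonHom := ((hφ.isGradedHom hT).comp (hψ.isGradedHom hTc)).isBimonHom.toIsMonHom
  inj_zero := by
    have e : B.inj 0 ≫ ψ = (B.inj 0 ≫ ψ ≫ cotensorProjZero Tc) ≫ cotensorInjZero Tc :=
      comp_homComp_of_graded (hψ.isGradedHom hTc).graded 0
    rw [hψ.proj_zero, inj_proj_self, Category.id_comp] at e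
    rw [← Category.assoc, hφ.inj_zero, e]
  inj_one := by
    have e : B.inj 1 ≫ ψ = (B.inj 1 ≫ ψ ≫ cotensorProjOne Tc) ≫ cotensorInjOne Tc :=
      comp_homComp_of_graded (hψ.isGradedHom hTc).graded 1
    rw [hψ.proj_one, inj_proj_self, Category.id_comp] at e
    rw [← Category.assoc, hφ.inj_one, e]

theorem IsTensorToCotensor.eq (hT : IsTensorBialgebra T) {F' : T.obj ⟶ Tc.obj}
    (hF : IsTensorToCotensor T Tc F) (hF' : IsTensorToCotensor T Tc F') : F = F' :=
  hT.hom_ext hF.isMonHom hF'.isMonHom (hF.inj_zero.trans hF'.inj_zero.symm)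
    (hF.inj_one.trans hF'.inj_one.symm)

theorem IsTensorLift.epi (hT : IsTensorBialgebra T) (hφ : IsTensorLift T φ)
    (hB : B.StronglyGradedAlgebra) : Epi φ := by
  have hg := hφ.isGradedHom hT
  have := hφ.isMonHom
  have h0 : tensorInjZero T ≫ φ ≫ B.proj 0 = 𝟙 _ := by
    rw [← Category.assoc, hφ.inj_zero, inj_proj_self]
  have h1 : tensorInjOne T ≫ φ ≫ B.proj 1 = 𝟙 _ := by
    rw [← Category.assoc, hφ.inj_one, inj_proj_self]
  have e0 : Epi (tensorInjZero T ≫ φ ≫ B.proj 0) := by rw [h0]; infer_instance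
  have e1 : Epi (tensorInjOne T ≫ φ ≫ B.proj 1) := by rw [h1]; infer_instance
  exact hB.epi hg.graded e0 e1

theorem IsCotensorLift.mono (hTc : IsCotensorBialgebra Tc) (hψ : IsCotensorLift Tc ψ)
    (hB : B.StronglyGradedCoalgebra) : Mono ψ := by
  have hg := hψ.isGradedHom hTc
  have := hψ.isComonHom
  have h0 : B.inj 0 ≫ ψ ≫ cotensorProjZero Tc = 𝟙 _ := by
    rw [hψ.proj_zero, inj_proj_self]
  have h1 : B.inj 1 ≫ ψ ≫ cotensorProjOne Tc = 𝟙 _ := by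
    rw [hψ.proj_one, inj_proj_self]
  have e0 : Mono (B.inj 0 ≫ ψ ≫ cotensorProjZero Tc) := by rw [h0]; infer_instance
  have e1 : Mono (B.inj 1 ≫ ψ ≫ cotensorProjOne Tc) := by rw [h1]; infer_instance
  exact hB.mono hg.graded e0 e1

end Main

end GradedBialgebra

open GradedBialgebra
theorem mainTheorem1 {C : Type u} [Category.{v} C] [Abelian C] [HasColimits C] [HasLimits C]
    [AB5 C] [MonoidalCategory C] [BraidedCategory C] [AbelianMonoidal C] [CoabelianMonoidal C]
    [TensorCommutesWithDirectSums C] {X : ℕ → C} (B : GradedBialgebra X) :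
    (∃! T : GradedBialgebra B.tensorPow, IsTensorBialgebra T) ∧
    (∃! Tc : GradedBialgebra B.cotensorPow, IsCotensorBialgebra Tc) ∧
    ∀ (T : GradedBialgebra B.tensorPow) (Tc : GradedBialgebra B.cotensorPow),
      IsTensorBialgebra T → IsCotensorBialgebra Tc →
      (∃! φ : T.obj ⟶ B.obj, IsTensorLift T φ) ∧
      (∃! ψ : B.obj ⟶ Tc.obj, IsCotensorLift Tc ψ) ∧
      (∃! F : T.obj ⟶ Tc.obj, IsTensorToCotensor T Tc F) ∧
      ∀ (φ : T.obj ⟶ B.obj) (ψ : B.obj ⟶ Tc.obj) (F : T.obj ⟶ Tc.obj),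
        IsTensorLift T φ → IsCotensorLift Tc ψ → IsTensorToCotensor T Tc F →
        IsGradedHom φ ∧ IsGradedHom ψ ∧
        φ ≫ ψ = F ∧ IsGradedHom F ∧
        (∃! I : GradedBialgebra (imComp F),
          IsImageBialgebra F I) ∧
        ∀ I : GradedBialgebra (imComp F),
          IsImageBialgebra F I →
          (toIm F I ≫ fromIm F I = F ∧
            Epi (toIm F I) ∧ Mono (fromIm F I)) ∧
          List.TFAE
            [B.StronglyGradedAlgebra ∧ B.StronglyGradedCoalgebra,
              Epi φ ∧ Mono ψ,
              ∃ θ : B.obj ≅ I.obj, φ ≫ θ.hom = toIm F I ∧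
                θ.hom ≫ fromIm F I = ψ,
              ∃ θ : B.obj ≅ I.obj, IsGradedHom θ.hom ∧
                B.inj 0 ≫ θ.hom = tensorInjZero T ≫ toIm F I ∧
                B.inj 1 ≫ θ.hom = tensorInjOne T ≫ toIm F I,
              ∃ θ : B.obj ≅ I.obj, IsGradedHom θ.hom] := by
  obtain ⟨T₀, hT₀⟩ := exists_isTensorBialgebra B
  obtain ⟨Tc₀, hTc₀⟩ := exists_isCotensorBialgebra B
  refine ⟨⟨T₀, hT₀, fun T hT => hT.unique hT₀⟩, ⟨Tc₀, hTc₀, fun T hT => hT.unique hTc₀⟩,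
    fun T Tc hT hTc => ?_⟩
  obtain ⟨φ₀, hφ₀, hφ₀u⟩ := hT.existsUnique_lift
  obtain ⟨ψ₀, hψ₀, hψ₀u⟩ := hTc.existsUnique_lift
  refine ⟨⟨φ₀, hφ₀, hφ₀u⟩, ⟨ψ₀, hψ₀, hψ₀u⟩, ⟨φ₀ ≫ ψ₀, isTensorToCotensor_comp hT hTc hφ₀ hψ₀,
    fun F hF => hF.eq hT (isTensorToCotensor_comp hT hTc hφ₀ hψ₀)⟩, fun φ ψ F hφ hψ hF => ?_⟩
  have hgφ := hφ.isGradedHom hT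
  have hgψ := hψ.isGradedHom hTc
  -- From here on, `F` is replaced by `φ ≫ ψ`.
  obtain rfl := (isTensorToCotensor_comp hT hTc hφ hψ).eq hT hF
  have hgF := hgφ.comp hgψ
  obtain ⟨I₀, hI₀⟩ := exists_isImageBialgebra hgF
  refine ⟨hgφ, hgψ, rfl, hgF, ⟨I₀, hI₀, fun I hI => hI.unique hI₀⟩, fun I hI => ?_⟩
  have hfac := toIm_fromIm I hgF.graded
  refine ⟨⟨hfac, inferInstance, inferInstance⟩, ?_⟩
  tfae_have 1 → 2 := fun ⟨h1, h2⟩ => ⟨hφ.epi hT h1, hψ.mono hTc h2⟩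
  tfae_have 2 → 3 := by
    rintro ⟨_, _⟩
    -- `φ ≫ ψ` and `toIm ≫ fromIm` are two epi-mono factorizations of the same morphism.
    have sq : CommSq (toIm (φ ≫ ψ) I) φ (fromIm (φ ≫ ψ) I) ψ := ⟨hfac⟩
    have : StrongEpi φ := strongEpi_of_epi φ
    have h1 : φ ≫ sq.lift = toIm (φ ≫ ψ) I := sq.fac_left
    have h2 : sq.lift ≫ fromIm (φ ≫ ψ) I = ψ := sq.fac_right
    have : Epi sq.lift := epi_of_epi_fac h1
    have : Mono sq.lift := mono_of_mono_fac h2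
    have := isIso_of_mono_of_epi sq.lift
    exact ⟨asIso sq.lift, h1, h2⟩
  tfae_have 3 → 4 := by
    rintro ⟨θ, h1, -⟩
    have : Epi φ := by
      rw [(Iso.eq_comp_inv θ).2 h1]; infer_instance
    refine ⟨θ, hgφ.of_epi_comp (h1 ▸ hI.toIm_hom), ?_, ?_⟩
    · rw [← h1, ← hφ.inj_zero, Category.assoc]
    · rw [← h1, ← hφ.inj_one, Category.assoc]
  tfae_have 4 → 5 := fun ⟨θ, h, _⟩ => ⟨θ, h⟩
  tfae_have 5 → 1 := by
    rintro ⟨θ, hθ⟩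
    have := hI.toIm_hom.isBimonHom
    have := hI.fromIm_hom.isBimonHom
    have := hθ.isBimonHom
    have hI1 : I.StronglyGradedAlgebra := hT.stronglyGraded.of_epi hI.toIm_hom.graded
    have hI2 : I.StronglyGradedCoalgebra := hTc.stronglyGraded.of_mono hI.fromIm_hom.graded
    exact ⟨hI1.of_iso θ hθ, hI2.of_mono hθ.graded⟩
  tfae_finish
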